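/- **Setting.** Let $N\ge 0$ and let $\hat\xi^a=(\hat q_1,\dots,\hat q_N,\hat p_1,\dots,\hat p_N)$ be either the bosonic quadratures, $[\hat q_j,\hat p_k]=\mathrm i\delta_{jk}$, in the Schrödinger representation on $\mathcal H=L^2(\mathbb R^N)$ (acting on Schwartz functions), or the fermionic Majorana modes, $\{\hat\xi^a,\hat\xi^b\}=\delta^{ab}$, on the fermionic Fock space $\mathcal H$ of $N$ modes. For a unit vector $\psi$ put $z^a=\langle\psi|\hat\xi^a|\psi\rangle$ and $C_2^{ab}=\langle\psi|(\hat\xi-z)^a(\hat\xi-z)^b|\psi\rangle=\tfrac12(G^{ab}+\mathrm i\,\Omega^{ab})$ with $G,\Omega$ real, and $J=-G\,\Omega^{-1}$. The state is *Gaussian* if $J^2=-\mathbb 1$ (and, for fermions, $z=0$); its covariance matrix is $\Gamma=G$ for bosons and $\Gamma=\Omega$ for fermions. With $\mathbb Q_\psi\delta=\delta-\langle\psi|\delta\rangle\psi$, the tangent space $\mathcal T_\psi\subset\mathcal H$ of the Gaussian manifold is the real vector space of the vectors $\mathbb Q_\psi\dot\gamma(0)$, where $\gamma$ is a curve of Gaussian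 unit vectors through $\psi=\gamma(0)$ that is differentiable at $0$, and $\mathbb P_\psi$ is the orthogonal projection of $\mathcal H$ onto $\mathcal T_\psi$ with respect to $\mathrm{Re}\langle\cdot|\cdot\rangle$. Below, $\psi$ is a Gaussian unit vector. **Proposition.** Let $\hat A=f_a\hat\xi^a+\tfrac12h_{ab}\hat\xi^a\hat\xi^b$ be Hermitian ($f_a,h_{ab}\in\mathbb C$) and let $\phi\in\mathcal H$ satisfy $\langle\psi|\phi\rangle=0$. For fermions assume in addition that $f=0$, or that $\phi$ has the same fermion parity as $\psi$. Then $$\delta\langle\hat A\rangle=2\,\mathrm{Re}\langle\psi|\hat A|\phi\rangle=2\,\mathrm{Re}\langle\psi|\hat A\,\mathbb P_\psi|\phi\rangle .$$ Here $\delta\langle\hat A\rangle$ is the derivative at $t=0$ of $\langle u(t)|\hat A|u(t)\rangle/\langle u(t)|u(t)\rangle$ along any curve $u$ with $u(0)=\psi$ whose velocity at $0$ is $\phi$, or is $\mathbb P_\psi\phi$ (for bosons: any such curve in the domain of the closure of $\hat A$ for which $\hat Au(t)$ is continuous at $0$). **Corollary.** Let $\hat H$ be a Hamiltonian, i.e.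 a Hermitian operator (for bosons possibly unbounded, with $\psi$ in its domain), and put $\chi=\mathbb P_\psi(-\mathrm i\hat H\psi)$. Then the numbers $$\dot z^a=2\,\mathrm{Re}\langle\psi|\hat\xi^a|\chi\rangle=\langle\psi|[\mathrm i\hat H,\hat\xi^a]|\psi\rangle,$$ $$\dot G^{ab}=2\,\mathrm{Re}\langle\psi|\{\hat\xi^a,\hat\xi^b\}|\chi\rangle-2(\dot z^az^b+z^a\dot z^b)=\langle\psi|[\mathrm i\hat H,\{\hat\xi^a,\hat\xi^b\}]|\psi\rangle-2(\dot z^az^b+z^a\dot z^b),$$ $$\dot\Omega^{ab}=2\,\mathrm{Re}\langle\psi|(-\mathrm i)[\hat\xi^a,\hat\xi^b]|\chi\rangle=\langle\psi|[\mathrm i\hat H,-\mathrm i[\hat\xi^a,\hat\xi^b]]|\psi\rangle$$ satisfy the stated equalities and are the derivatives at $t=0$ of $z^a$, $G^{ab}$, $\Omega^{ab}$ both along the exact evolution (curves $u$ with $u(0)=\psi$, $\dot u(0)=-\mathrm i\hat H\psi$) and along the projected evolution (curves $u$ of Gaussian unit vectors with $u(0)=\psi$, $\mathbb Q_\psi\dot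 u(0)=\chi$). For fermions, the statements about $\dot z^a$ assume that $\hat H$ commutes with fermion parity. (Here $\langle\psi|[\mathrm i\hat H,\hat B]|\psi\rangle$ is read as $\mathrm i(\langle\hat H\psi|\hat B\psi\rangle-\langle\hat B\psi|\hat H\psi\rangle)$ for Hermitian $\hat B$, and in the bosonic case the curves are such that $\hat\xi^au(t)$ and $\hat\xi^a\hat\xi^bu(t)$ exist, with the closed operators $\hat\xi^a$, and are continuous at $t=0$.) In particular the displacement and the covariance matrix $\Gamma$ have the same time derivative under the exact and the projected dynamics. -/

import Mathlib

open MeasureTheory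

noncomputable section

namespace GaussianProjection

/-! ## Systems of modes -/

/-- The operators `ξ a` (quadratures or Majorana modes) acting on a common invariant core `D` of
state vectors, together with the inclusion of the core into the Hilbert space `H`. Only the two
concrete systems `boson N` and `fermion N` constructed below are ever used. -/
structure ModeSystem (κ D H : Type*) [AddCommGroup D] [Module ℂ D]
    [NormedAddCommGroup H] [InnerProductSpace ℂ H] where
  incl : D →ₗ[ℂ] H
  ξ : κ → D →ₗ[ℂ] D

section Generic

variable {κ D H : Type*} [AddCommGroup D] [Module ℂ D]
  [NormedAddCommGroup H] [InnerProductSpace ℂ H]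

/-- The curve `u` in the Hilbert space has velocity `v` at time `0` (derivative in norm). -/
def HasVelocity (u : ℝ → H) (v : H) : Prop := HasDerivAt u v 0

/-- The projector `Q_ψ δ = δ - (⟨ψ|δ⟩ / ⟨ψ|ψ⟩) ψ` that removes changes of phase and norm. -/
def phaseProj (ψ δ : H) : H := δ - (inner ℂ ψ δ / inner ℂ ψ ψ) • ψ

/-- `z^a = ⟨u|ξ^a|u⟩` for a vector `u` with images `x a = ξ^a u`. -/
def displacementOf (u : H) (x : κ → H) (a : κ) : ℝ := (inner ℂ u (x a)).re

/-- `C₂^{ab} = ⟨u|(ξ - z)^a (ξ - z)^b|u⟩` for a vector `u` with images `x a = ξ^a u`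
(the Hermitian operator `(ξ - z)^a` is moved to the left entry). -/
def corrOf (u : H) (x : κ → H) (a b : κ) : ℂ :=
  inner ℂ (x a - (displacementOf u x a : ℂ) • u) (x b - (displacementOf u x b : ℂ) • u)

/-- `G` in `C₂ = (G + i Ω) / 2`. -/
def metricOf (u : H) (x : κ → H) : Matrix κ κ ℝ := fun a b => 2 * (corrOf u x a b).re

/-- `Ω` in `C₂ = (G + i Ω) / 2`. -/
def symplecticOf (u : H) (x : κ → H) : Matrix κ κ ℝ := fun a b => 2 * (corrOf u x a b).im

namespace ModeSystem

variable (S : ModeSystem κ D H)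

/-- Displacement vector `z` of `ψ`. -/
def displacement (ψ : D) (a : κ) : ℝ :=
  displacementOf (S.incl ψ) (fun c => S.incl (S.ξ c ψ)) a

/-- The matrix `G` of `ψ` (for bosons this is the covariance matrix). -/
def metric (ψ : D) : Matrix κ κ ℝ :=
  metricOf (S.incl ψ) (fun c => S.incl (S.ξ c ψ))

/-- The matrix `Ω` of `ψ` (for fermions this is the covariance matrix). -/
def symplectic (ψ : D) : Matrix κ κ ℝ :=
  symplecticOf (S.incl ψ) (fun c => S.incl (S.ξ c ψ))

/-- `J = - G ω` with `ω = Ω⁻¹`. If `Ω` is singular, then neither this `J` (where `Ω⁻¹ = 0`) nor the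
one formed with the pseudo-inverse of `Ω` is invertible, so that `J² = -1` fails for both. -/
def complexStructure [Fintype κ] [DecidableEq κ] (ψ : D) : Matrix κ κ ℝ :=
  -(S.metric ψ * (S.symplectic ψ)⁻¹)

/-- `f_a ξ^a + ½ h_{ab} ξ^a ξ^b`. -/
def linQuad [Fintype κ] (f : κ → ℂ) (h : κ → κ → ℂ) : D →ₗ[ℂ] D :=
  ∑ a, f a • S.ξ a + (1 / 2 : ℂ) • ∑ a, ∑ b, h a b • (S.ξ a ∘ₗ S.ξ b)

/-- `{ξ^a, ξ^b}`. -/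
def anticomm (a b : κ) : D →ₗ[ℂ] D := S.ξ a ∘ₗ S.ξ b + S.ξ b ∘ₗ S.ξ a

/-- The Hermitian operator `-i [ξ^a, ξ^b]`. -/
def hermComm (a b : κ) : D →ₗ[ℂ] D :=
  (-Complex.I) • (S.ξ a ∘ₗ S.ξ b - S.ξ b ∘ₗ S.ξ a)

/-- `A` is a Hermitian operator on the core. -/
def IsHermitian (A : D →ₗ[ℂ] D) : Prop :=
  ∀ u v : D, inner ℂ (S.incl (A u)) (S.incl v) = inner ℂ (S.incl u) (S.incl (A v))

/-- `2 Re ⟨ψ|A|φ⟩` for a Hermitian operator `A`, a state vector `ψ` of the core and an arbitrary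
Hilbert space vector `φ`. -/
def change (A : D →ₗ[ℂ] D) (ψ : D) (φ : H) : ℝ := 2 * (inner ℂ (S.incl (A ψ)) φ).re

/-- `2 Re ⟨ψ|{ξ^a,ξ^b}|φ⟩ - 2 (δz^a z^b + z^a δz^b)` with `δz^a = 2 Re ⟨ψ|ξ^a|φ⟩`. -/
def changeMetric (ψ : D) (φ : H) (a b : κ) : ℝ :=
  S.change (S.anticomm a b) ψ φ
    - 2 * (S.change (S.ξ a) ψ φ * S.displacement ψ b
      + S.displacement ψ a * S.change (S.ξ b) ψ φ)

/-- The vector `u` lies in the domain of the closure of the operator `A` (given on the core),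
and the closure maps it to `w`. -/
def ClosureMaps (A : D →ₗ[ℂ] D) (u w : H) : Prop :=
  (u, w) ∈ closure (Set.range fun f : D => (S.incl f, S.incl (A f)))

/-- A curve `vec t` of vectors in the Hilbert space on which all `ξ^a` and `ξ^a ξ^b` are defined
(as closed operators), with `img t a = ξ^a vec t` and `img2 t a b = ξ^a ξ^b vec t` continuous at
time `0`. -/
structure MomentCurve where
  vec : ℝ → H
  img : ℝ → κ → H
  img2 : ℝ → κ → κ → H
  maps : ∀ t a, S.ClosureMaps (S.ξ a) (vec t) (img t a)
  maps2 : ∀ t a b, S.ClosureMaps (S.ξ a) (img t b) (img2 t a b)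
  continuousAt_img : ∀ a, ContinuousAt (fun t => img t a) 0
  continuousAt_img2 : ∀ a b, ContinuousAt (fun t => img2 t a b) 0

/-- The tangent vectors at `ψ` to the family of states represented by the unit vectors in `M`:
the vectors `Q_ψ γ'(0)` for differentiable curves `γ` in `M` through `ψ`. -/
def tangentVectors (M : Set D) (ψ : D) : Set H :=
  {v | ∃ (γ : ℝ → D) (δ : H), γ 0 = ψ ∧ (∀ t, γ t ∈ M) ∧
    HasVelocity (fun t => S.incl (γ t)) δ ∧ v = phaseProj (S.incl ψ) δ}

/-- The tangent space at `ψ` as a closed real subspace of the Hilbert space. (For a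
finite-dimensional submanifold, such as the Gaussian one, passing to the closed span
adds nothing to the set of tangent vectors.) -/
def tangentSpace (M : Set D) (ψ : D) : Submodule ℝ H :=
  (Submodule.span ℝ (S.tangentVectors M ψ)).topologicalClosure

/-- The orthogonal projection onto the tangent space, with respect to the real inner product
`Re ⟨·|·⟩`. -/
def tangentProj [CompleteSpace H] (M : Set D) (ψ : D) (φ : H) : H :=
  letI : InnerProductSpace ℝ H := InnerProductSpace.rclikeToReal ℂ H
  haveI : CompleteSpace (S.tangentSpace M ψ) :=
    (Submodule.isClosed_topologicalClosure _).completeSpace_coe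
  Submodule.starProjection (𝕜 := ℝ) (S.tangentSpace M ψ) φ

end ModeSystem

end Generic

/-! ## Bosons: the Schrödinger representation -/

/-- Configuration space of `N` bosonic modes. -/
abbrev Conf (N : ℕ) : Type := EuclideanSpace ℝ (Fin N)

/-- The bosonic Hilbert space `L²(ℝ^N)`. -/
abbrev BosonSpace (N : ℕ) : Type := Lp ℂ 2 (volume : Measure (Conf N))

/-- The bosonic core: Schwartz functions. -/
abbrev BosonCore (N : ℕ) : Type := SchwartzMap (Conf N) ℂ

/-- `q_j`, multiplication by the `j`-th coordinate. -/
def position (N : ℕ) (j : Fin N) : BosonCore N →ₗ[ℂ] BosonCore N :=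
  (SchwartzMap.smulLeftCLM ℂ (fun x : Conf N => ((x j : ℝ) : ℂ))).toLinearMap

/-- `p_j = -i ∂_j`. -/
def momentum (N : ℕ) (j : Fin N) : BosonCore N →ₗ[ℂ] BosonCore N :=
  (-Complex.I) •
    (LineDeriv.lineDerivOpCLM ℂ (BosonCore N) (EuclideanSpace.single j (1 : ℝ))).toLinearMap

theorem position_apply (N : ℕ) (j : Fin N) (f : BosonCore N) (x : Conf N) :
    position N j f x = (x j : ℂ) * f x := by
  have h : (fun x : Conf N => ((x j : ℝ) : ℂ)).HasTemperateGrowth :=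
    ((Complex.ofRealCLM).comp (EuclideanSpace.proj (𝕜 := ℝ) j)).hasTemperateGrowth
  simp [position, SchwartzMap.smulLeftCLM_apply_apply h]

theorem momentum_apply (N : ℕ) (j : Fin N) (f : BosonCore N) (x : Conf N) :
    momentum N j f x = -Complex.I * fderiv ℝ f x (EuclideanSpace.single j 1) := by
  simp [momentum, SchwartzMap.lineDerivOp_apply_eq_fderiv]

/-- `N` bosonic modes, `ξ = (q_1, …, q_N, p_1, …, p_N)`. -/
def boson (N : ℕ) : ModeSystem (Fin N ⊕ Fin N) (BosonCore N) (BosonSpace N) where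
  incl := (SchwartzMap.toLpCLM ℂ ℂ 2 (volume : Measure (Conf N))).toLinearMap
  ξ := Sum.elim (position N) (momentum N)

/-- The unit vectors representing pure bosonic Gaussian states. -/
def bosonGaussian (N : ℕ) : Set (BosonCore N) :=
  {ψ | ‖(boson N).incl ψ‖ = 1 ∧
    (boson N).complexStructure ψ * (boson N).complexStructure ψ = -1}

/-- `⟨ψ|[iH, A]|ψ⟩` for a Hermitian operator `A` on the core and a symmetric, possibly unbounded,
operator `Ham` that has `ψ` in its domain, with the Hermitian operators moved to the left entry
where this is needed: `i (⟨Hψ|Aψ⟩ - ⟨Aψ|Hψ⟩)`. -/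
def bosonCommExpect {N : ℕ} (Ham : BosonSpace N →ₗ.[ℂ] BosonSpace N)
    (A : BosonCore N →ₗ[ℂ] BosonCore N) (ψ : BosonCore N) (hψ : (boson N).incl ψ ∈ Ham.domain) : ℂ :=
  Complex.I * (inner ℂ (Ham ⟨(boson N).incl ψ, hψ⟩) ((boson N).incl (A ψ))
    - inner ℂ ((boson N).incl (A ψ)) (Ham ⟨(boson N).incl ψ, hψ⟩))

/-! ## Fermions: the Fock representation -/

/-- The fermionic Fock space of `N` modes; coordinate `s` is the amplitude of the basis state in
which exactly the modes in `s` are occupied. -/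
abbrev Fock (N : ℕ) : Type := EuclideanSpace ℂ (Finset (Fin N))

/-- The sign `(-1)^{#{k ∈ s : k < j}}`. -/
def fockSign {N : ℕ} (j : Fin N) (s : Finset (Fin N)) : ℂ := (-1) ^ (s.filter (· < j)).card

/-- The annihilation operator of mode `j`. -/
def annihilate (N : ℕ) (j : Fin N) : Fock N →ₗ[ℂ] Fock N where
  toFun ψ := WithLp.toLp 2 fun s => if j ∈ s then 0 else fockSign j s * ψ (insert j s)
  map_add' φ ψ := by
    ext s
    by_cases h : j ∈ s <;> simp [h, mul_add]
  map_smul' c ψ := by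
    ext s
    by_cases h : j ∈ s <;> simp [h, mul_left_comm]

/-- The creation operator of mode `j`. -/
def create (N : ℕ) (j : Fin N) : Fock N →ₗ[ℂ] Fock N where
  toFun ψ := WithLp.toLp 2 fun s => if j ∈ s then fockSign j s * ψ (s.erase j) else 0
  map_add' φ ψ := by
    ext s
    by_cases h : j ∈ s <;> simp [h, mul_add]
  map_smul' c ψ := by
    ext s
    by_cases h : j ∈ s <;> simp [h, mul_left_comm]

/-- `N` fermionic modes, `ξ = (q_1, …, q_N, p_1, …, p_N)` with `q_j = (a_j† + a_j)/√2` and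
`p_j = i (a_j† - a_j)/√2`. -/
def fermion (N : ℕ) : ModeSystem (Fin N ⊕ Fin N) (Fock N) (Fock N) where
  incl := LinearMap.id
  ξ := Sum.elim
    (fun j => ((Real.sqrt 2 : ℝ) : ℂ)⁻¹ • (create N j + annihilate N j))
    (fun j => (Complex.I * ((Real.sqrt 2 : ℝ) : ℂ)⁻¹) • (create N j - annihilate N j))

/-- The unit vectors representing pure fermionic Gaussian states. -/
def fermionGaussian (N : ℕ) : Set (Fock N) :=
  {ψ | ‖ψ‖ = 1 ∧ (∀ a, (fermion N).displacement ψ a = 0) ∧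
    (fermion N).complexStructure ψ * (fermion N).complexStructure ψ = -1}

/-- The fermion parity operator `(-1)^{number of particles}`. -/
def parity (N : ℕ) : Fock N →ₗ[ℂ] Fock N where
  toFun ψ := WithLp.toLp 2 fun s => (-1) ^ s.card * ψ s
  map_add' φ ψ := by
    ext s
    simp [mul_add]
  map_smul' c ψ := by
    ext s
    simp [mul_left_comm]

/-- `ψ` and `φ` lie in the same sector (even or odd) of fermion parity. -/
def SameParity {N : ℕ} (ψ φ : Fock N) : Prop :=
  ∃ s : ℂ, parity N ψ = s • ψ ∧ parity N φ = s • φ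

/-- `⟨ψ|[iH, A]|ψ⟩`. -/
def fermionCommExpect {N : ℕ} (Ham A : Fock N →ₗ[ℂ] Fock N) (ψ : Fock N) : ℂ :=
  inner ℂ ψ (Complex.I • (Ham (A ψ) - A (Ham ψ)))

end GaussianProjection

end

open GaussianProjection

/-! ### Tangent projections and first-order changes in an arbitrary system of modes -/

noncomputable section

namespace GaussianProjection

open Filter Topology Complex

section Generic

variable {κ D H : Type*} [AddCommGroup D] [Module ℂ D]
  [NormedAddCommGroup H] [InnerProductSpace ℂ H]

/-! ### The phase projection -/

/-! The change `2 Re ⟨Aψ|φ⟩` is a real-linear functional of `φ`, and the tangent projection is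
symmetric for `Re ⟨·|·⟩`. If `Q_ψ Aψ` is itself a tangent vector, the functional cannot tell `φ`
from its projection: the component of `Aψ` along `ψ` is harmless, since `φ` and all tangent vectors
are orthogonal to `ψ` (`change_tangentProj_of_inner_eq_zero`). For `φ = -iHψ` only `Re ⟨ψ|φ⟩ = 0`
holds; there Hermiticity of `A` removes the phase direction (`IsHermitian.change_tangentProj`). So
everything rests on the tangency of `Q_ψ Aψ`.

Bosons. `J² = -1` makes a certain combination of the vectors `(ξ - z)^a ψ` orthogonal to all of
them, hence zero: `ψ` is killed by annihilation operators. These equations say that the logarithmic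
derivative of `ψ` is affine with negative definite real part, so `ψ` is a Gaussian function, on
which linear-quadratic operators act as multiplication by polynomials `P` of degree at most two. The
curve `ψ exp(tP)`, normalized, stays Gaussian for small `t` and has velocity `Pψ` modulo `ψ`
(`phaseProj_mem_of_polynomial`).

Fermions. The unitaries `exp(2t ξ^a ξ^b)` rotate the Majorana modes and preserve Gaussian states,
which makes `Q_ψ ξ^a ξ^b ψ` tangent; complex coefficients are allowed because `i ξ^b ψ` is a real
combination of the `ξ^a ψ` (`fermionGaussian_relation`). Linear terms vanish on tangent vectors, as
`z = 0` along Gaussian curves, and on `φ` of the same parity as `ψ`. For the corollary `ψ` must have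
definite parity; this follows from uniqueness of the vacuum, which rests on irreducibility of the
Majorana operators (`exists_parity_eq_smul`).

The derivatives need only continuity of `A u(t)`, since symmetry moves `A` onto the fixed vector `ψ`
(`hasDerivAt_inner_of_adjoint`). -/

theorem phaseProj_of_norm_eq_one {ψ : H} (hψ : ‖ψ‖ = 1) (δ : H) :
    phaseProj ψ δ = δ - inner ℂ ψ δ • ψ := by
  simp [phaseProj, inner_self_eq_norm_sq_to_K, hψ]

theorem inner_phaseProj {ψ : H} (hψ : ‖ψ‖ = 1) (δ : H) : inner ℂ ψ (phaseProj ψ δ) = 0 := by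
  rw [phaseProj_of_norm_eq_one hψ, inner_sub_right, inner_smul_right,
    inner_self_eq_norm_sq_to_K, hψ]
  simp

theorem phaseProj_add (ψ δ ε : H) : phaseProj ψ (δ + ε) = phaseProj ψ δ + phaseProj ψ ε := by
  simp only [phaseProj, inner_add_right, add_div, add_smul]
  abel

theorem phaseProj_smul (ψ : H) (c : ℂ) (δ : H) : phaseProj ψ (c • δ) = c • phaseProj ψ δ := by
  simp only [phaseProj, inner_smul_right, mul_div_assoc, mul_smul, smul_sub]

theorem phaseProj_real_smul (ψ : H) (c : ℝ) (δ : H) : phaseProj ψ (c • δ) = c • phaseProj ψ δ := by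
  simpa only [Complex.coe_smul] using phaseProj_smul ψ (c : ℂ) δ

theorem phaseProj_self {ψ : H} (hψ : ‖ψ‖ = 1) : phaseProj ψ ψ = 0 := by
  rw [phaseProj_of_norm_eq_one hψ, inner_self_eq_norm_sq_to_K, hψ]
  simp

theorem phaseProj_smul_self {ψ : H} (hψ : ‖ψ‖ = 1) (c : ℂ) : phaseProj ψ (c • ψ) = 0 := by
  rw [phaseProj_smul, phaseProj_self hψ, smul_zero]

theorem re_inner_eq_zero_of_norm_eq_one {u : ℝ → H} {v : H} (hu : HasVelocity u v)
    (h1 : ∀ t, ‖u t‖ = 1) : (inner ℂ (u 0) v).re = 0 := by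
  have h := HasDerivAt.inner ℂ hu hu
  have h2 : (fun t => inner ℂ (u t) (u t)) = fun _ => (1 : ℂ) := by
    funext t
    rw [inner_self_eq_norm_sq_to_K, h1 t]
    simp
  rw [h2] at h
  have h3 := congrArg Complex.re (h.unique (hasDerivAt_const 0 (1 : ℂ)))
  rw [Complex.add_re, ← inner_conj_symm v, Complex.conj_re] at h3
  simp only [Complex.zero_re] at h3
  linarith

namespace ModeSystem

variable (S : ModeSystem κ D H)

/-! ### Tangent space and projection -/

/-- A continuous real-linear map that vanishes on all tangent vectors vanishes on the tangent
space. -/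
theorem map_tangentSpace_eq_zero {E : Type*} [NormedAddCommGroup E] [NormedSpace ℝ E]
    {M : Set D} {ψ : D} (L : H →L[ℝ] E) (hL : ∀ v ∈ S.tangentVectors M ψ, L v = 0)
    {w : H} (hw : w ∈ S.tangentSpace M ψ) : L w = 0 := by
  have h : S.tangentSpace M ψ ≤ LinearMap.ker L.toLinearMap := by
    refine Submodule.topologicalClosure_minimal _ (Submodule.span_le.2 fun v hv => hL v hv) ?_
    exact L.isClosed_ker
  exact h hw

theorem inner_tangentSpace {M : Set D} {ψ : D} (hψ : ‖S.incl ψ‖ = 1) {w : H}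
    (hw : w ∈ S.tangentSpace M ψ) : inner ℂ (S.incl ψ) w = 0 := by
  refine S.map_tangentSpace_eq_zero ((innerSL ℂ (S.incl ψ)).restrictScalars ℝ) ?_ hw
  rintro v ⟨γ, δ, -, -, -, rfl⟩
  exact inner_phaseProj hψ δ

theorem mem_tangentSpace {M : Set D} {ψ : D} {v : H} (h : v ∈ S.tangentVectors M ψ) :
    v ∈ S.tangentSpace M ψ :=
  Submodule.le_topologicalClosure _ (Submodule.subset_span h)

theorem tangentProj_mem [CompleteSpace H] (M : Set D) (ψ : D) (φ : H) :
    S.tangentProj M ψ φ ∈ S.tangentSpace M ψ := by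
  let _ : InnerProductSpace ℝ H := InnerProductSpace.rclikeToReal ℂ H
  have : CompleteSpace (S.tangentSpace M ψ) :=
    (Submodule.isClosed_topologicalClosure _).completeSpace_coe
  exact Submodule.starProjection_apply_mem (𝕜 := ℝ) (S.tangentSpace M ψ) φ

/-- The residual of the projection is orthogonal to the tangent space only for the real inner
product, so only real parts are compared. -/
theorem re_inner_tangentProj [CompleteSpace H] {M : Set D} {ψ : D} (φ : H) {w : H}
    (hw : w ∈ S.tangentSpace M ψ) :
    (inner ℂ w (S.tangentProj M ψ φ)).re = (inner ℂ w φ).re := by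
  let _ : InnerProductSpace ℝ H := InnerProductSpace.rclikeToReal ℂ H
  have : CompleteSpace (S.tangentSpace M ψ) :=
    (Submodule.isClosed_topologicalClosure _).completeSpace_coe
  have h := Submodule.starProjection_inner_eq_zero (𝕜 := ℝ) (K := S.tangentSpace M ψ) φ w hw
  -- The real inner product of `rclikeToReal` is by definition the real part of the complex one.
  have h2 : (inner ℂ (φ - S.tangentProj M ψ φ) w).re = 0 := h
  rw [← inner_conj_symm, Complex.conj_re, inner_sub_right, Complex.sub_re] at h2
  linarith

/-! ### First-order changes -/

/-- The basic principle: pairing with the tangent vector `Q_ψ Aψ` ignores the residual of the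
projection, and the part of `Aψ` along `ψ` pairs to zero with both `φ` and its projection. -/
theorem change_tangentProj_of_inner_eq_zero [CompleteSpace H] {M : Set D} {ψ : D}
    (hψ : ‖S.incl ψ‖ = 1) {A : D →ₗ[ℂ] D}
    (hA : phaseProj (S.incl ψ) (S.incl (A ψ)) ∈ S.tangentSpace M ψ) {φ : H}
    (hφ : inner ℂ (S.incl ψ) φ = 0) :
    S.change A ψ φ = S.change A ψ (S.tangentProj M ψ φ) := by
  have h := S.re_inner_tangentProj φ hA
  rw [phaseProj_of_norm_eq_one hψ, inner_sub_left, inner_sub_left, inner_smul_left,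
    inner_smul_left, hφ, S.inner_tangentSpace hψ (S.tangentProj_mem M ψ φ)] at h
  simp only [mul_zero, sub_zero] at h
  simp only [change, h]

variable {S}

theorem IsHermitian.im_expect {A : D →ₗ[ℂ] D} (hA : S.IsHermitian A) (ψ : D) :
    (inner ℂ (S.incl (A ψ)) (S.incl ψ)).im = 0 := by
  have h := hA ψ ψ
  rw [← inner_conj_symm (S.incl ψ)] at h
  have := congrArg Complex.im h
  rw [Complex.conj_im] at this
  linarith

/-- A Hermitian expectation value does not change along an imaginary multiple of the state. -/
theorem IsHermitian.change_phaseProj {A : D →ₗ[ℂ] D} (hA : S.IsHermitian A) {ψ : D}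
    (hψ : ‖S.incl ψ‖ = 1) {φ : H} (hφ : (inner ℂ (S.incl ψ) φ).re = 0) :
    S.change A ψ (phaseProj (S.incl ψ) φ) = S.change A ψ φ := by
  rw [phaseProj_of_norm_eq_one hψ]
  simp only [change, inner_sub_right, inner_smul_right, Complex.sub_re, Complex.mul_re, hφ,
    hA.im_expect]
  ring

/-- What `phaseProj` removes is a complex multiple of `ψ`, which is orthogonal to every tangent
vector. -/
theorem tangentProj_phaseProj [CompleteSpace H] {M : Set D} {ψ : D}
    (hψ : ‖S.incl ψ‖ = 1) (φ : H) :
    S.tangentProj M ψ (phaseProj (S.incl ψ) φ) = S.tangentProj M ψ φ := by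
  have key : ∀ w ∈ S.tangentSpace M ψ, (inner ℂ w
      (S.tangentProj M ψ (phaseProj (S.incl ψ) φ) - S.tangentProj M ψ φ)).re = 0 := by
    intro w hw
    rw [inner_sub_right, Complex.sub_re, S.re_inner_tangentProj _ hw,
      S.re_inner_tangentProj _ hw, phaseProj_of_norm_eq_one hψ, inner_sub_right,
      inner_smul_right, ← inner_conj_symm w (S.incl ψ), S.inner_tangentSpace hψ hw]
    simp
  have h := key _ (Submodule.sub_mem _ (S.tangentProj_mem M ψ (phaseProj (S.incl ψ) φ))
    (S.tangentProj_mem M ψ φ))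
  rw [inner_self_eq_norm_sq_to_K] at h
  have h2 : ‖S.tangentProj M ψ (phaseProj (S.incl ψ) φ) - S.tangentProj M ψ φ‖ ^ 2 = 0 := by
    exact_mod_cast h
  exact sub_eq_zero.1 (norm_eq_zero.1 (pow_eq_zero_iff two_ne_zero |>.1 h2))

/-- The form needed for `φ = -iHψ`, which is not orthogonal to `ψ` in general but differs from an
orthogonal vector by an imaginary multiple of `ψ`. -/
theorem IsHermitian.change_tangentProj [CompleteSpace H] {A : D →ₗ[ℂ] D} (hA : S.IsHermitian A)
    {M : Set D} {ψ : D} (hψ : ‖S.incl ψ‖ = 1)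
    (hQ : phaseProj (S.incl ψ) (S.incl (A ψ)) ∈ S.tangentSpace M ψ) {φ : H}
    (hφ : (inner ℂ (S.incl ψ) φ).re = 0) :
    S.change A ψ (S.tangentProj M ψ φ) = S.change A ψ φ := by
  rw [← hA.change_phaseProj hψ hφ, ← tangentProj_phaseProj hψ]
  exact (S.change_tangentProj_of_inner_eq_zero hψ hQ (inner_phaseProj hψ φ)).symm

theorem isHermitian_anticomm (hS : ∀ a, S.IsHermitian (S.ξ a)) (a b : κ) :
    S.IsHermitian (S.anticomm a b) := by
  intro u v
  simp only [anticomm, LinearMap.add_apply, LinearMap.comp_apply, map_add, inner_add_left,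
    inner_add_right]
  rw [hS a, hS b, hS b, hS a]
  ring

theorem isHermitian_hermComm (hS : ∀ a, S.IsHermitian (S.ξ a)) (a b : κ) :
    S.IsHermitian (S.hermComm a b) := by
  intro u v
  simp only [hermComm, LinearMap.smul_apply, LinearMap.sub_apply, LinearMap.comp_apply, map_smul,
    map_sub, inner_sub_left, inner_sub_right, inner_smul_left, inner_smul_right]
  rw [hS a, hS b, hS b, hS a]
  simp
  ring

/-! ### Closures and derivatives of expectation values -/

/-- For fixed `g` the adjoint relation is a closed condition on the pair `(u, w)`, so it passes from
the graph to its closure. -/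
theorem ClosureMaps.inner_incl {A A' : D →ₗ[ℂ] D}
    (h : ∀ f g : D, inner ℂ (S.incl (A' g)) (S.incl f) = inner ℂ (S.incl g) (S.incl (A f)))
    {u w : H} (hu : S.ClosureMaps A u w) (g : D) :
    inner ℂ (S.incl (A' g)) u = inner ℂ (S.incl g) w := by
  have hc : IsClosed {p : H × H | inner ℂ (S.incl (A' g)) p.1 = inner ℂ (S.incl g) p.2} :=
    isClosed_eq (by fun_prop) (by fun_prop)
  refine closure_minimal ?_ hc hu
  rintro _ ⟨f, rfl⟩
  exact h f g

theorem ClosureMaps.inner_comm {A : D →ₗ[ℂ] D} (hA : S.IsHermitian A) {u w u' w' : H}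
    (hu : S.ClosureMaps A u w) (hu' : S.ClosureMaps A u' w') :
    inner ℂ w u' = inner ℂ u w' := by
  have hc : IsClosed {p : H × H | inner ℂ w p.1 = inner ℂ u p.2} :=
    isClosed_eq (by fun_prop) (by fun_prop)
  refine closure_minimal ?_ hc hu'
  rintro _ ⟨f, rfl⟩
  have h := hu.inner_incl (fun f g => hA g f) f
  show inner ℂ w (S.incl f) = inner ℂ u (S.incl (A f))
  rw [← inner_conj_symm, ← h, inner_conj_symm]

/-- A symmetric operator is closable: the inner products of `w` with the dense core are determined
by `ψ`. -/
theorem ClosureMaps.eq_incl {A : D →ₗ[ℂ] D} (hA : S.IsHermitian A) (hd : DenseRange S.incl)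
    {ψ : D} {w : H} (h : S.ClosureMaps A (S.incl ψ) w) : w = S.incl (A ψ) := by
  refine hd.eq_of_inner_right ℂ ?_
  intro g
  rw [← h.inner_incl (fun f g => hA g f) g, hA g ψ]

theorem closureMaps_incl (A : D →ₗ[ℂ] D) (f : D) : S.ClosureMaps A (S.incl f) (S.incl (A f)) :=
  subset_closure ⟨f, rfl⟩

end ModeSystem

theorem hasDerivAt_of_eq {E : Type*} [NormedAddCommGroup E] [NormedSpace ℝ E] {f g : ℝ → E}
    {f' g' : E} {x : ℝ} (h : HasDerivAt f f' x) (hf : ∀ t, g t = f t) (hf' : g' = f') :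
    HasDerivAt g g' x := by
  rw [hf', show g = f from funext hf]
  exact h

/-- Product rule for `⟨u, w⟩` where `u` is differentiable at `0` and `w` merely continuous there,
if the change of `⟨u 0, w⟩` can be moved to `u`. -/
theorem hasDerivAt_inner_of_adjoint {u w : ℝ → H} {v y : H} (hu : HasVelocity u v)
    (hw : ContinuousAt w 0) (h : ∀ t, inner ℂ (u 0) (w t) = inner ℂ y (u t)) :
    HasDerivAt (fun t => inner ℂ (u t) (w t)) (inner ℂ v (w 0) + inner ℂ y v) 0 := by
  -- The slope of this function at `0` is `⟨slope of u, w t⟩`, so convergence of the slope of `u`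
  -- and continuity of `w` suffice.
  have h1 : HasDerivAt (fun t => inner ℂ (u t - u 0) (w t)) (inner ℂ v (w 0)) 0 := by
    rw [hasDerivAt_iff_tendsto_slope]
    have h2 : Tendsto (fun t => inner ℂ (slope u 0 t) (w t)) (𝓝[≠] 0) (𝓝 (inner ℂ v (w 0))) :=
      (hasDerivAt_iff_tendsto_slope.1 hu).inner (hw.tendsto.mono_left nhdsWithin_le_nhds)
    refine h2.congr fun t => ?_
    simp only [slope, sub_zero, vsub_eq_sub, sub_self, inner_zero_left]
    rw [← Complex.coe_smul, inner_smul_left, Complex.conj_ofReal, ← Complex.coe_smul, smul_eq_mul]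
  have h2 : HasDerivAt (fun t => inner ℂ y (u t)) (inner ℂ y v) 0 := by
    simpa using (hasDerivAt_const (0 : ℝ) y).inner ℂ hu
  refine (h1.add h2).congr_of_eventuallyEq (Eventually.of_forall fun t => ?_)
  simp only [Pi.add_apply, ← h t, inner_sub_left]
  ring

theorem hasDerivAt_norm_sq {u : ℝ → H} {v : H} (hu : HasVelocity u v) :
    HasDerivAt (fun t => ‖u t‖ ^ 2) (2 * (inner ℂ (u 0) v).re) 0 := by
  have h := (Complex.reCLM.hasFDerivAt.comp_hasDerivAt (0 : ℝ) (HasDerivAt.inner ℂ hu hu))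
  refine hasDerivAt_of_eq h (fun t => ?_) ?_
  · simp only [Function.comp, Complex.reCLM_apply]
    exact (inner_self_eq_norm_sq (𝕜 := ℂ) (u t)).symm
  · simp only [Complex.reCLM_apply, Complex.add_re]
    rw [← inner_conj_symm v, Complex.conj_re]
    ring

namespace ModeSystem

variable {S : ModeSystem κ D H}

theorem IsHermitian.hasDerivAt_expect {A : D →ₗ[ℂ] D} (hA : S.IsHermitian A)
    (hd : DenseRange S.incl) {ψ : D} {u w : ℝ → H} {v : H} (h0 : u 0 = S.incl ψ)
    (hu : HasVelocity u v) (hm : ∀ t, S.ClosureMaps A (u t) (w t)) (hw : ContinuousAt w 0) :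
    HasDerivAt (fun t => (inner ℂ (u t) (w t)).re) (S.change A ψ v) 0 := by
  have hw0 : w 0 = S.incl (A ψ) := ClosureMaps.eq_incl hA hd (h0 ▸ hm 0)
  have h := hasDerivAt_inner_of_adjoint (y := S.incl (A ψ)) hu hw fun t => by
    rw [h0, (hm t).inner_incl (fun f g => hA g f) ψ]
  refine hasDerivAt_of_eq (Complex.reCLM.hasFDerivAt.comp_hasDerivAt (0 : ℝ) h) (fun t => rfl) ?_
  simp only [change, hw0, Complex.reCLM_apply, Complex.add_re]
  rw [← inner_conj_symm v, Complex.conj_re]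
  ring

/-- The squared norm has derivative `2 Re ⟨ψ|v⟩ = 0`, so the denominator does not contribute to
first order. -/
theorem IsHermitian.hasDerivAt_expect_div {A : D →ₗ[ℂ] D} (hA : S.IsHermitian A)
    (hd : DenseRange S.incl) {ψ : D} (hψ : ‖S.incl ψ‖ = 1) {u w : ℝ → H} {v : H}
    (h0 : u 0 = S.incl ψ) (hu : HasVelocity u v) (hv : (inner ℂ (S.incl ψ) v).re = 0)
    (hm : ∀ t, S.ClosureMaps A (u t) (w t)) (hw : ContinuousAt w 0) :
    HasDerivAt (fun t => (inner ℂ (u t) (w t)).re / ‖u t‖ ^ 2) (S.change A ψ v) 0 := by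
  have h := (hA.hasDerivAt_expect hd h0 hu hm hw).div (hasDerivAt_norm_sq hu)
    (by rw [h0, hψ]; norm_num)
  refine hasDerivAt_of_eq h (fun t => rfl) ?_
  rw [h0, hv, hψ]
  simp

theorem hasDerivAt_moments (hS : ∀ a, S.IsHermitian (S.ξ a)) (hd : DenseRange S.incl) {ψ : D}
    (hψ : ‖S.incl ψ‖ = 1) {u : ℝ → H} {x : ℝ → κ → H} {y : ℝ → κ → κ → H} {v : H}
    (h0 : u 0 = S.incl ψ) (hu : HasVelocity u v) (hv : (inner ℂ (S.incl ψ) v).re = 0)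
    (hm : ∀ t a, S.ClosureMaps (S.ξ a) (u t) (x t a))
    (hm2 : ∀ t a b, S.ClosureMaps (S.ξ a) (x t b) (y t a b))
    (hx : ∀ a, ContinuousAt (fun t => x t a) 0)
    (hy : ∀ a b, ContinuousAt (fun t => y t a b) 0) :
    (∀ a, HasDerivAt (fun t => displacementOf (u t) (x t) a) (S.change (S.ξ a) ψ v) 0) ∧
    (∀ a b, HasDerivAt (fun t => metricOf (u t) (x t) a b) (S.changeMetric ψ v a b) 0) ∧
    (∀ a b, HasDerivAt (fun t => symplecticOf (u t) (x t) a b)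
      (S.change (S.hermComm a b) ψ v) 0) := by
  have hz : ∀ a, HasDerivAt (fun t => displacementOf (u t) (x t) a) (S.change (S.ξ a) ψ v) 0 :=
    fun a => (hS a).hasDerivAt_expect hd h0 hu (fun t => hm t a) (hx a)
  have hx0 : ∀ a, x 0 a = S.incl (S.ξ a ψ) := fun a => ClosureMaps.eq_incl (hS a) hd (h0 ▸ hm 0 a)
  have hy0 : ∀ a b, y 0 a b = S.incl (S.ξ a (S.ξ b ψ)) := fun a b =>
    ClosureMaps.eq_incl (hS a) hd (hx0 b ▸ hm2 0 a b)
  have hz0 : ∀ a, displacementOf (u 0) (x 0) a = S.displacement ψ a := by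
    intro a
    simp only [displacement, displacementOf, h0, hx0]
  have hzr : ∀ t a, inner ℂ (u t) (x t a) = (displacementOf (u t) (x t) a : ℂ) := by
    intro t a
    apply Complex.ext
    · simp [displacementOf]
    · have h := (hm t a).inner_comm (hS a) (hm t a)
      rw [← inner_conj_symm] at h
      have := congrArg Complex.im h
      rw [Complex.conj_im] at this
      rw [Complex.ofReal_im]
      linarith
  -- The two cross terms give `-2 z^a z^b`, the last one `‖u‖² z^a z^b`. The norm has to be kept
  -- because `u t` need not be a unit vector for `t ≠ 0`; the correction is real and so does not
  -- enter `Ω`.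
  have hcorr : ∀ t a b, corrOf (u t) (x t) a b = inner ℂ (u t) (y t a b)
      + ((displacementOf (u t) (x t) a * displacementOf (u t) (x t) b * (‖u t‖ ^ 2 - 2) : ℝ) : ℂ)
      := by
    intro t a b
    have h1 : inner ℂ (x t a) (x t b) = inner ℂ (u t) (y t a b) :=
      (hm t a).inner_comm (hS a) (hm2 t a b)
    have h2 : inner ℂ (x t a) (u t) = (displacementOf (u t) (x t) a : ℂ) := by
      rw [(hm t a).inner_comm (hS a) (hm t a), hzr]
    simp only [corrOf, inner_sub_left, inner_sub_right, inner_smul_left, inner_smul_right, h1, h2,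
      hzr, Complex.conj_ofReal, inner_self_eq_norm_sq_to_K]
    push_cast
    simp only [Complex.coe_algebraMap]
    ring
  -- The product `ξ^a ξ^b` is not Hermitian: moving it to the left entry reverses the order of the
  -- factors.
  have hmain : ∀ a b, HasDerivAt (fun t => inner ℂ (u t) (y t a b))
      (inner ℂ v (S.incl (S.ξ a (S.ξ b ψ))) + inner ℂ (S.incl (S.ξ b (S.ξ a ψ))) v) 0 := by
    intro a b
    rw [← hy0]
    refine hasDerivAt_inner_of_adjoint hu (hy a b) fun t => ?_
    rw [h0, ← (hm2 t a b).inner_incl (fun f g => hS a g f) ψ,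
      ← (hm t b).inner_incl (fun f g => hS b g f) (S.ξ a ψ)]
  have hcross : ∀ a b, HasDerivAt (fun t => displacementOf (u t) (x t) a
      * displacementOf (u t) (x t) b * (‖u t‖ ^ 2 - 2))
      (-(S.change (S.ξ a) ψ v * S.displacement ψ b
        + S.displacement ψ a * S.change (S.ξ b) ψ v)) 0 := by
    intro a b
    have h := ((hz a).mul (hz b)).mul ((hasDerivAt_norm_sq hu).sub_const 2)
    refine hasDerivAt_of_eq h (fun t => rfl) ?_
    simp only [Pi.mul_apply, hz0]
    rw [h0, hv, hψ]
    ring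
  refine ⟨hz, fun a b => ?_, fun a b => ?_⟩
  · have h := ((Complex.reCLM.hasFDerivAt.comp_hasDerivAt (0 : ℝ) (hmain a b)).add
      (hcross a b)).const_mul 2
    refine hasDerivAt_of_eq h (fun t => ?_) ?_
    · simp only [metricOf, hcorr, Function.comp, Complex.add_re, Complex.ofReal_re,
        Complex.reCLM_apply, Pi.add_apply]
    · simp only [changeMetric, change, anticomm, LinearMap.add_apply, LinearMap.comp_apply,
        map_add, inner_add_left, Complex.add_re, Complex.reCLM_apply]
      rw [← inner_conj_symm v, Complex.conj_re]
      ring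
  · have h := (Complex.imCLM.hasFDerivAt.comp_hasDerivAt (0 : ℝ) (hmain a b)).const_mul 2
    refine hasDerivAt_of_eq h (fun t => ?_) ?_
    · simp only [symplecticOf, hcorr, Function.comp, Complex.add_im, Complex.ofReal_im,
        Complex.imCLM_apply, add_zero]
    · simp only [change, hermComm, LinearMap.smul_apply, LinearMap.sub_apply,
        LinearMap.comp_apply, map_smul, map_sub, inner_sub_left, inner_smul_left, Complex.add_im,
        Complex.imCLM_apply]
      rw [← inner_conj_symm v, Complex.conj_im]
      simp
      ring

end ModeSystem

end Generic

end GaussianProjection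
end

/-! ### The algebra of Majorana operators on Fock space -/

noncomputable section

namespace GaussianProjection

open Filter Topology Complex

/-! ### Majorana modes -/

section Fermion

variable {N : ℕ}

/-- The mode to which a Majorana operator belongs. -/
def modeOf (a : Fin N ⊕ Fin N) : Fin N := Sum.elim id id a

/-- Toggling mode `k` changes the number of occupied modes below `j` by one exactly when `k < j`. -/
theorem fockSign_symmDiff (j k : Fin N) (s : Finset (Fin N)) :
    fockSign j (symmDiff s {k}) = if k < j then -fockSign j s else fockSign j s := by
  have key : ∀ t : Finset (Fin N), k ∉ t →
      fockSign j (insert k t) = if k < j then -fockSign j t else fockSign j t := by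
    intro t ht
    unfold fockSign
    rw [Finset.filter_insert]
    split_ifs with h
    · rw [Finset.card_insert_of_notMem (by simp [ht]), pow_succ]
      ring
    · rfl
  by_cases hk : k ∈ s
  · have h1 : symmDiff s {k} = s.erase k := by
      ext x
      by_cases hx : x = k <;> simp [Finset.mem_symmDiff, hx, hk]
    have h2 := key (s.erase k) (Finset.notMem_erase k s)
    rw [Finset.insert_erase hk] at h2
    rw [h1, h2]
    split_ifs <;> simp
  · have h1 : symmDiff s {k} = insert k s := by
      ext x
      by_cases hx : x = k <;> simp [Finset.mem_symmDiff, hx, hk]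
    rw [h1, key s hk]

theorem fockSign_mul_self (j : Fin N) (s : Finset (Fin N)) : fockSign j s * fockSign j s = 1 := by
  unfold fockSign
  rw [← pow_add, ← two_mul, pow_mul]
  simp

theorem conj_fockSign (j : Fin N) (s : Finset (Fin N)) :
    (starRingEnd ℂ) (fockSign j s) = fockSign j s := by
  simp [fockSign]

/-- The sign `+1` or `-1` according to whether mode `j` is occupied. -/
def occSign (j : Fin N) (s : Finset (Fin N)) : ℂ := if j ∈ s then 1 else -1

theorem occSign_symmDiff (j k : Fin N) (s : Finset (Fin N)) :
    occSign j (symmDiff s {k}) = if j = k then -occSign j s else occSign j s := by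
  unfold occSign
  by_cases hjk : j = k <;> by_cases hj : j ∈ s <;> by_cases hk : k ∈ s <;>
    simp_all [Finset.mem_symmDiff]

theorem occSign_mul_self (j : Fin N) (s : Finset (Fin N)) : occSign j s * occSign j s = 1 := by
  unfold occSign
  split_ifs <;> norm_num

theorem conj_occSign (j : Fin N) (s : Finset (Fin N)) :
    (starRingEnd ℂ) (occSign j s) = occSign j s := by
  unfold occSign
  split_ifs <;> simp

/-- The matrix elements of the Majorana operators, see `fermion_ξ_apply`. -/
def majoranaCoeff : Fin N ⊕ Fin N → Finset (Fin N) → ℂ :=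
  Sum.elim (fun j s => ((Real.sqrt 2 : ℝ) : ℂ)⁻¹ * fockSign j s)
    (fun j s => I * ((Real.sqrt 2 : ℝ) : ℂ)⁻¹ * (occSign j s * fockSign j s))

/-- Each Majorana operator toggles one mode and multiplies by a scalar, which reduces the operator
algebra to identities between signs. -/
theorem fermion_ξ_apply (a : Fin N ⊕ Fin N) (ψ : Fock N) (s : Finset (Fin N)) :
    (fermion N).ξ a ψ s = majoranaCoeff a s * ψ (symmDiff s {modeOf a}) := by
  have h1 : ∀ j ∈ s, symmDiff s {j} = s.erase j := by
    intro j hj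
    ext x
    by_cases hx : x = j <;> simp [Finset.mem_symmDiff, hx, hj]
  have h2 : ∀ j ∉ s, symmDiff s {j} = insert j s := by
    intro j hj
    ext x
    by_cases hx : x = j <;> simp [Finset.mem_symmDiff, hx, hj]
  rcases a with j | j <;> by_cases hj : j ∈ s <;>
    simp [fermion, majoranaCoeff, modeOf, create, annihilate, occSign, hj, h1, h2, mul_assoc]

theorem sqrt_two_inv_mul_self : ((Real.sqrt 2 : ℝ) : ℂ)⁻¹ * ((Real.sqrt 2 : ℝ) : ℂ)⁻¹ = 1 / 2 := by
  rw [← mul_inv, ← Complex.ofReal_mul, Real.mul_self_sqrt (by norm_num)]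
  norm_num

/-- For distinct modes only the sign belonging to the larger index notices the toggling of the other
mode, so the two products cancel. In a single mode `occSign` flips, which makes `q_j` and `p_j`
anticommute and gives squares `1/2`. -/
theorem majoranaCoeff_anticomm (a b : Fin N ⊕ Fin N) (s : Finset (Fin N)) :
    majoranaCoeff a s * majoranaCoeff b (symmDiff s {modeOf a})
      + majoranaCoeff b s * majoranaCoeff a (symmDiff s {modeOf b}) = if a = b then 1 else 0 := by
  have hr := sqrt_two_inv_mul_self
  have hI := Complex.I_mul_I
  rcases a with j | j <;> rcases b with k | k <;>
    simp only [majoranaCoeff, modeOf, Sum.elim_inl, Sum.elim_inr, id, fockSign_symmDiff,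
      occSign_symmDiff]
  all_goals
    rcases lt_trichotomy j k with h | h | h
    · simp only [h, h.not_gt, h.ne, h.ne', Sum.inl.injEq, Sum.inr.injEq, if_true, if_false,
        reduceCtorEq]
      ring
    · subst h
      have hs := fockSign_mul_self j s
      have ho := occSign_mul_self j s
      simp only [lt_irrefl, if_true, if_false, reduceCtorEq]
      first
        | linear_combination (2 * (fockSign j s * fockSign j s)) * hr + hs
        | linear_combination (-2 * I * I * (fockSign j s * fockSign j s) * (occSign j s
            * occSign j s)) * hr - (I * I * (fockSign j s * fockSign j s)) * ho - I * I * hs - hI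
        | ring
    · simp only [h, h.not_gt, h.ne, h.ne', Sum.inl.injEq, Sum.inr.injEq, if_true, if_false,
        reduceCtorEq]
      ring

/-- Hermiticity in coordinates: for `p_j` the conjugation of `I` is compensated by the flip of
`occSign`. -/
theorem conj_majoranaCoeff (a : Fin N ⊕ Fin N) (s : Finset (Fin N)) :
    (starRingEnd ℂ) (majoranaCoeff a (symmDiff s {modeOf a})) = majoranaCoeff a s := by
  rcases a with j | j <;>
    simp [majoranaCoeff, modeOf, fockSign_symmDiff, occSign_symmDiff, conj_fockSign, conj_occSign]

theorem fermion_anticomm (a b : Fin N ⊕ Fin N) (ψ : Fock N) :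
    (fermion N).ξ a ((fermion N).ξ b ψ) + (fermion N).ξ b ((fermion N).ξ a ψ)
      = (if a = b then (1 : ℂ) else 0) • ψ := by
  ext s
  simp only [PiLp.add_apply, PiLp.smul_apply, fermion_ξ_apply, smul_eq_mul]
  have h : (if a = b then (1 : ℂ) else 0) * ψ s
      = (if a = b then 1 else 0) * ψ (symmDiff (symmDiff s {modeOf a}) {modeOf b}) := by
    split_ifs with hab
    · rw [hab, symmDiff_symmDiff_cancel_right]
    · simp
  rw [symmDiff_right_comm s {modeOf b} {modeOf a}, h, ← majoranaCoeff_anticomm a b s]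
  ring

theorem fermion_sq (a : Fin N ⊕ Fin N) (ψ : Fock N) :
    (fermion N).ξ a ((fermion N).ξ a ψ) = (1 / 2 : ℂ) • ψ := by
  have h := fermion_anticomm a a ψ
  rw [if_pos rfl, ← two_smul ℂ] at h
  calc _ = (1 / 2 : ℂ) • ((2 : ℂ) • (fermion N).ξ a ((fermion N).ξ a ψ)) := by
        rw [smul_smul]; norm_num
    _ = _ := by rw [h, one_smul]

theorem fermion_swap {a b : Fin N ⊕ Fin N} (h : a ≠ b) (ψ : Fock N) :
    (fermion N).ξ a ((fermion N).ξ b ψ) = -(fermion N).ξ b ((fermion N).ξ a ψ) := by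
  have h' := fermion_anticomm a b ψ
  rw [if_neg h, zero_smul] at h'
  exact eq_neg_of_add_eq_zero_left h'

theorem fermion_inner_ξ (a : Fin N ⊕ Fin N) (φ ψ : Fock N) :
    inner ℂ ((fermion N).ξ a φ) ψ = inner ℂ φ ((fermion N).ξ a ψ) := by
  simp only [PiLp.inner_apply, RCLike.inner_apply, fermion_ξ_apply]
  refine Finset.sum_bij' (fun s _ => symmDiff s {modeOf a}) (fun s _ => symmDiff s {modeOf a})
    (by simp) (by simp) (fun s _ => by simp) (fun s _ => by simp) fun s _ => ?_
  rw [symmDiff_symmDiff_cancel_right, map_mul, ← conj_majoranaCoeff a (symmDiff s {modeOf a}),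
    symmDiff_symmDiff_cancel_right]
  ring

theorem fermion_isHermitian (a : Fin N ⊕ Fin N) : (fermion N).IsHermitian ((fermion N).ξ a) :=
  fermion_inner_ξ a

theorem parity_ξ (a : Fin N ⊕ Fin N) (ψ : Fock N) :
    parity N ((fermion N).ξ a ψ) = -(fermion N).ξ a (parity N ψ) := by
  have h : ∀ (s : Finset (Fin N)) (k : Fin N),
      (-1 : ℂ) ^ (symmDiff s {k}).card = -(-1) ^ s.card := by
    intro s k
    by_cases hk : k ∈ s
    · have h1 : symmDiff s {k} = s.erase k := by
        ext x
        by_cases hx : x = k <;> simp [Finset.mem_symmDiff, hx, hk]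
      rw [h1, ← Finset.card_erase_add_one hk, pow_succ]
      ring
    · have h1 : symmDiff s {k} = insert k s := by
        ext x
        by_cases hx : x = k <;> simp [Finset.mem_symmDiff, hx, hk]
      rw [h1, Finset.card_insert_of_notMem hk, pow_succ]
      ring
  ext s
  have e1 : ∀ (φ : Fock N) s, parity N φ s = (-1) ^ s.card * φ s := fun φ s => rfl
  rw [e1, PiLp.neg_apply, fermion_ξ_apply, fermion_ξ_apply, e1, h]
  ring

theorem inner_parity_parity (φ ψ : Fock N) :
    inner ℂ (parity N φ) (parity N ψ) = inner ℂ φ ψ := by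
  have e1 : ∀ (φ : Fock N) s, parity N φ s = (-1) ^ s.card * φ s := fun φ s => rfl
  simp only [PiLp.inner_apply, RCLike.inner_apply, e1]
  refine Finset.sum_congr rfl fun s _ => ?_
  have : ((-1 : ℂ) ^ s.card) * (-1) ^ s.card = 1 := by
    rw [← pow_add, ← two_mul, pow_mul]; simp
  simp only [map_mul, map_pow, map_neg, map_one]
  linear_combination (ψ s * (starRingEnd ℂ) (φ s)) * this

end Fermion

end GaussianProjection
end

/-! ### Fermionic Gaussian states, their rotations and their tangent vectors -/

noncomputable section

namespace GaussianProjection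

open Filter Topology Complex

section Fermion

variable {N : ℕ}

/-! ### Fermionic Gaussian states -/

theorem fermion_displacement_eq_zero_iff {ψ : Fock N} {a : Fin N ⊕ Fin N} :
    (fermion N).displacement ψ a = 0 ↔ inner ℂ ψ ((fermion N).ξ a ψ) = 0 := by
  constructor
  · intro h
    have h2 := (fermion_isHermitian a).im_expect ψ
    rw [← inner_conj_symm, Complex.conj_im, neg_eq_zero] at h2
    exact Complex.ext h h2
  · intro h
    show (inner ℂ ψ ((fermion N).ξ a ψ)).re = 0
    rw [h, Complex.zero_re]

/-- The anticommutation relations fix the real part, so `G = 1` and only `Ω` depends on the state.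
-/
theorem fermion_inner_ξ_ξ {ψ : Fock N} (h1 : ‖ψ‖ = 1)
    (hz : ∀ a, (fermion N).displacement ψ a = 0) (a b : Fin N ⊕ Fin N) :
    inner ℂ ((fermion N).ξ a ψ) ((fermion N).ξ b ψ)
      = ((if a = b then 1 else 0) + (((fermion N).symplectic ψ a b : ℝ) : ℂ) * I) / 2 := by
  have hc : corrOf ((fermion N).incl ψ) (fun c => (fermion N).incl ((fermion N).ξ c ψ)) a b
      = inner ℂ ((fermion N).ξ a ψ) ((fermion N).ξ b ψ) := by
    have hz' : ∀ a, displacementOf ((fermion N).incl ψ)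
      (fun c => (fermion N).incl ((fermion N).ξ c ψ)) a = 0 := hz
    simp only [corrOf, hz', Complex.ofReal_zero, zero_smul, sub_zero]
    rfl
  have hre : 2 * (inner ℂ ((fermion N).ξ a ψ) ((fermion N).ξ b ψ)).re
      = if a = b then 1 else 0 := by
    have h := congrArg (fun x => (inner ℂ ψ x).re) (fermion_anticomm a b ψ)
    simp only [inner_add_right, inner_smul_right, inner_self_eq_norm_sq_to_K, h1] at h
    rw [← fermion_inner_ξ a ψ, ← fermion_inner_ξ b ψ] at h
    rw [← inner_conj_symm ((fermion N).ξ b ψ)] at h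
    simp only [Complex.add_re, Complex.conj_re] at h
    rw [two_mul, h]
    split_ifs <;> simp
  have him : (fermion N).symplectic ψ a b
      = 2 * (inner ℂ ((fermion N).ξ a ψ) ((fermion N).ξ b ψ)).im := by
    rw [← hc]; rfl
  rw [him]
  apply Complex.ext
  · split_ifs at hre ⊢ <;> simp <;> linarith
  · split_ifs <;> simp

theorem fermion_metric_eq_one {ψ : Fock N} (h1 : ‖ψ‖ = 1)
    (hz : ∀ a, (fermion N).displacement ψ a = 0) : (fermion N).metric ψ = 1 := by
  ext a b
  have hc : corrOf ((fermion N).incl ψ) (fun c => (fermion N).incl ((fermion N).ξ c ψ)) a b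
      = inner ℂ ((fermion N).ξ a ψ) ((fermion N).ξ b ψ) := by
    have hz' : ∀ a, displacementOf ((fermion N).incl ψ)
      (fun c => (fermion N).incl ((fermion N).ξ c ψ)) a = 0 := hz
    simp only [corrOf, hz', Complex.ofReal_zero, zero_smul, sub_zero]
    rfl
  show 2 * (corrOf ((fermion N).incl ψ) (fun c => (fermion N).incl ((fermion N).ξ c ψ)) a b).re = _
  rw [hc, fermion_inner_ξ_ξ h1 hz, Matrix.one_apply]
  split_ifs <;> simp

theorem fermion_complexStructure_sq {ψ : Fock N} (h1 : ‖ψ‖ = 1)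
    (hz : ∀ a, (fermion N).displacement ψ a = 0) :
    (fermion N).complexStructure ψ * (fermion N).complexStructure ψ = -1 ↔
      (fermion N).symplectic ψ * (fermion N).symplectic ψ = -1 := by
  rw [ModeSystem.complexStructure, fermion_metric_eq_one h1 hz, one_mul, neg_mul_neg]
  set Ω := (fermion N).symplectic ψ
  constructor
  · intro h
    -- The inverse of a singular matrix is `0` by convention, so invertibility of `Ω` has to be
    -- derived from `J² = -1` first.
    have hu : IsUnit (Ω⁻¹).det := by
      have h2 : Ω⁻¹ * (-Ω⁻¹) = 1 := by rw [mul_neg, h, neg_neg]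
      exact Matrix.isUnit_det_of_right_inverse h2
    have hu' : IsUnit Ω.det := Matrix.isUnit_nonsing_inv_det_iff.1 hu
    calc Ω * Ω = Ω * (-(Ω⁻¹ * Ω⁻¹)) * Ω := by rw [h, neg_neg, mul_one]
      _ = -((Ω * Ω⁻¹) * (Ω⁻¹ * Ω)) := by noncomm_ring
      _ = -1 := by rw [Matrix.mul_nonsing_inv _ hu', Matrix.nonsing_inv_mul _ hu', one_mul]
  · intro h
    have h2 : Ω⁻¹ = -Ω := Matrix.inv_eq_right_inv (by rw [mul_neg, h, neg_neg])
    rw [h2, neg_mul_neg, h]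

/-- By `Ω² = -1` the difference of the two sides is orthogonal to every `ξ^c ψ`; being in their
complex span, it is orthogonal to itself. In other words, `ψ` is the vacuum of the complex
structure. -/
theorem fermionGaussian_relation {ψ : Fock N} (hψ : ψ ∈ fermionGaussian N) (b : Fin N ⊕ Fin N) :
    I • (fermion N).ξ b ψ = -∑ a, (((fermion N).symplectic ψ a b : ℝ) : ℂ) • (fermion N).ξ a ψ := by
  obtain ⟨h1, hz, hJ⟩ := hψ
  have hΩ := (fermion_complexStructure_sq h1 hz).1 hJ
  rw [← add_eq_zero_iff_eq_neg]
  set x := I • (fermion N).ξ b ψ + ∑ a, (((fermion N).symplectic ψ a b : ℝ) : ℂ) • (fermion N).ξ a ψ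
    with hx
  have horth : ∀ c, inner ℂ ((fermion N).ξ c ψ) x = 0 := by
    intro c
    have hcb := congrFun (congrFun hΩ c) b
    rw [Matrix.mul_apply] at hcb
    have hcb' : (∑ a, (((fermion N).symplectic ψ c a : ℝ) : ℂ)
        * (((fermion N).symplectic ψ a b : ℝ) : ℂ)) = -(if c = b then 1 else 0) := by
      rw [Matrix.neg_apply, Matrix.one_apply] at hcb
      simp only [← Complex.ofReal_mul, ← Complex.ofReal_sum, hcb]
      split_ifs <;> simp
    simp only [hx, inner_add_right, inner_smul_right, inner_sum, fermion_inner_ξ_ξ h1 hz]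
    have : ∀ a, (((fermion N).symplectic ψ a b : ℝ) : ℂ) * (((if c = a then 1 else 0)
        + (((fermion N).symplectic ψ c a : ℝ) : ℂ) * I) / 2)
        = (if c = a then (((fermion N).symplectic ψ a b : ℝ) : ℂ) / 2 else 0)
          + (((fermion N).symplectic ψ c a : ℝ) : ℂ)
          * (((fermion N).symplectic ψ a b : ℝ) : ℂ) * (I / 2) := by
      intro a
      split_ifs <;> ring
    rw [Finset.sum_congr rfl fun a _ => this a, Finset.sum_add_distrib, ← Finset.sum_mul, hcb']
    simp only [Finset.sum_ite_eq, Finset.mem_univ, if_true]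
    split_ifs
    · linear_combination ((((fermion N).symplectic ψ c b : ℝ) : ℂ) / 2) * Complex.I_mul_I
    · linear_combination ((((fermion N).symplectic ψ c b : ℝ) : ℂ) / 2) * Complex.I_mul_I
  have hxx : inner ℂ x x = 0 := by
    conv_lhs => arg 2; rw [hx]
    simp only [inner_add_left, inner_smul_left, sum_inner, horth, mul_zero, Finset.sum_const_zero,
      add_zero]
  exact inner_self_eq_zero.1 hxx

/-- The real span of the vectors `ξ^a ψ`. -/
def linearSpan (ψ : Fock N) : Submodule ℝ (Fock N) :=
  Submodule.span ℝ (Set.range fun a => (fermion N).ξ a ψ)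

theorem ξ_mem_linearSpan (a : Fin N ⊕ Fin N) (ψ : Fock N) :
    (fermion N).ξ a ψ ∈ linearSpan ψ := Submodule.subset_span ⟨a, rfl⟩

theorem I_smul_mem_linearSpan {ψ : Fock N} (hψ : ψ ∈ fermionGaussian N) (b : Fin N ⊕ Fin N) :
    I • (fermion N).ξ b ψ ∈ linearSpan ψ := by
  rw [fermionGaussian_relation hψ b]
  refine Submodule.neg_mem _ (Submodule.sum_mem _ fun a _ => ?_)
  rw [Complex.coe_smul]
  exact Submodule.smul_mem _ _ (ξ_mem_linearSpan a ψ)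

/-- A criterion that unitaries transport easily: stability of the real span under `i`. Pairing `i
ξ^b ψ = ∑ L_a ξ^a ψ` with `ξ^c ψ`, the real part identifies the real coefficients `L` with `-Ω`, and
the imaginary part then says `Ω² = -1`. -/
theorem mem_fermionGaussian {ψ : Fock N} (h1 : ‖ψ‖ = 1)
    (hz : ∀ a, (fermion N).displacement ψ a = 0)
    (h : ∀ b, I • (fermion N).ξ b ψ ∈ linearSpan ψ) : ψ ∈ fermionGaussian N := by
  refine ⟨h1, hz, (fermion_complexStructure_sq h1 hz).2 ?_⟩
  have h' : ∀ b, ∃ L : Fin N ⊕ Fin N → ℝ, ∑ a, L a • (fermion N).ξ a ψ = I • (fermion N).ξ b ψ :=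
    fun b => (Submodule.mem_span_range_iff_exists_fun ℝ).1 (h b)
  choose L hL using h'
  have key : ∀ c b, (L b c = -(fermion N).symplectic ψ c b) ∧
      ∑ a, (fermion N).symplectic ψ c a * L b a = if c = b then 1 else 0 := by
    intro c b
    have h2 := congrArg (fun x => inner ℂ ((fermion N).ξ c ψ) x) (hL b)
    simp only [inner_sum, ← Complex.coe_smul, inner_smul_right, fermion_inner_ξ_ξ h1 hz] at h2
    have : ∀ a, ((L b a : ℝ) : ℂ) * (((if c = a then 1 else 0)
        + (((fermion N).symplectic ψ c a : ℝ) : ℂ) * I) / 2)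
        = (if c = a then ((L b a : ℝ) : ℂ) / 2 else 0)
          + (((fermion N).symplectic ψ c a * L b a : ℝ) : ℂ) * (I / 2) := by
      intro a
      push_cast
      split_ifs <;> ring
    rw [Finset.sum_congr rfl fun a _ => this a, Finset.sum_add_distrib, ← Finset.sum_mul] at h2
    simp only [Finset.sum_ite_eq, Finset.mem_univ, if_true] at h2
    rw [← Complex.ofReal_sum] at h2
    have hre := congrArg Complex.re h2
    have him := congrArg Complex.im h2
    split_ifs at hre him ⊢ <;> simp [-Fintype.sum_sum_type] at hre him <;> constructor <;> linarith
  ext c b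
  rw [Matrix.mul_apply, Matrix.neg_apply, Matrix.one_apply]
  have h3 := (key c b).2
  rw [← h3, ← Finset.sum_neg_distrib]
  refine Finset.sum_congr rfl fun a _ => ?_
  rw [(key a b).1]
  ring

/-! ### Rotations generated by pairs of Majorana modes -/

/-- The unitary `exp (2 t ξ^a ξ^b)` for `a ≠ b`. -/
def majoranaRotation (a b : Fin N ⊕ Fin N) (t : ℝ) (ψ : Fock N) : Fock N :=
  Real.cos t • ψ + (2 * Real.sin t) • (fermion N).ξ a ((fermion N).ξ b ψ)

theorem fermion_map_real_smul (A : Fock N →ₗ[ℂ] Fock N) (r : ℝ) (ψ : Fock N) :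
    A (r • ψ) = r • A ψ := by
  rw [← Complex.coe_smul, map_smul, Complex.coe_smul]

/-- Thus `2 ξ^a ξ^b` squares to `-1`, and its exponential has the form `cos + sin` used in
`majoranaRotation`. -/
theorem fermion_pair_sq {a b : Fin N ⊕ Fin N} (hab : a ≠ b) (ψ : Fock N) :
    (fermion N).ξ a ((fermion N).ξ b ((fermion N).ξ a ((fermion N).ξ b ψ)))
      = (-1 / 4 : ℝ) • ψ := by
  rw [fermion_swap hab.symm, map_neg, fermion_sq, fermion_sq, smul_smul, ← Complex.coe_smul,
    ← neg_smul]
  norm_num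

theorem majoranaRotation_add {a b : Fin N ⊕ Fin N} (hab : a ≠ b) (s t : ℝ) (ψ : Fock N) :
    majoranaRotation a b s (majoranaRotation a b t ψ) = majoranaRotation a b (s + t) ψ := by
  simp only [majoranaRotation, map_add, fermion_map_real_smul, fermion_pair_sq hab,
    Real.cos_add, Real.sin_add]
  module

theorem majoranaRotation_zero (a b : Fin N ⊕ Fin N) (ψ : Fock N) :
    majoranaRotation a b 0 ψ = ψ := by
  simp [majoranaRotation]

/-- The adjoint of `ξ^a ξ^b` is `ξ^b ξ^a = -ξ^a ξ^b`, so the adjoint of the rotation by `t` is the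
rotation by `-t`. -/
theorem inner_majoranaRotation {a b : Fin N ⊕ Fin N} (hab : a ≠ b) (t : ℝ) (φ ψ : Fock N) :
    inner ℂ (majoranaRotation a b t φ) (majoranaRotation a b t ψ) = inner ℂ φ ψ := by
  have h : inner ℂ (majoranaRotation a b t φ) (majoranaRotation a b t ψ)
      = inner ℂ φ (majoranaRotation a b (-t) (majoranaRotation a b t ψ)) := by
    generalize majoranaRotation a b t ψ = χ
    simp only [majoranaRotation, Real.cos_neg, Real.sin_neg, inner_add_left, inner_add_right,
      ← Complex.coe_smul, inner_smul_left, inner_smul_right, Complex.conj_ofReal,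
      fermion_inner_ξ]
    rw [fermion_swap hab.symm, inner_neg_right]
    push_cast
    ring
  rw [h, majoranaRotation_add hab, neg_add_cancel, majoranaRotation_zero]

theorem majoranaRotation_real_smul (a b : Fin N ⊕ Fin N) (t r : ℝ) (ψ : Fock N) :
    majoranaRotation a b t (r • ψ) = r • majoranaRotation a b t ψ := by
  simp only [majoranaRotation, fermion_map_real_smul]
  module

theorem majoranaRotation_I_smul (a b : Fin N ⊕ Fin N) (t : ℝ) (ψ : Fock N) :
    majoranaRotation a b t (I • ψ) = I • majoranaRotation a b t ψ := by
  simp only [majoranaRotation, map_smul]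
  module

theorem majoranaRotation_map_add (a b : Fin N ⊕ Fin N) (t : ℝ) (φ ψ : Fock N) :
    majoranaRotation a b t (φ + ψ) = majoranaRotation a b t φ + majoranaRotation a b t ψ := by
  simp only [majoranaRotation, map_add]
  module

/-- A rotation acts on the Majorana operators by a real linear map. -/
theorem majoranaRotation_ξ {a b : Fin N ⊕ Fin N} (hab : a ≠ b) (c : Fin N ⊕ Fin N) (t : ℝ)
    (ψ : Fock N) : majoranaRotation a b t ((fermion N).ξ c ψ)
      ∈ linearSpan (majoranaRotation a b t ψ) := by
  have h : ∃ r₁ r₂ r₃ : ℝ, majoranaRotation a b t ((fermion N).ξ c ψ)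
      = r₁ • (fermion N).ξ c (majoranaRotation a b t ψ)
        + r₂ • (fermion N).ξ a (majoranaRotation a b t ψ)
        + r₃ • (fermion N).ξ b (majoranaRotation a b t ψ) := by
    by_cases hca : c = a
    · subst hca
      -- Conjugation by the unitary rotates the plane of `ξ^a` and `ξ^b` by the doubled angle.
      refine ⟨0, Real.cos (2 * t), -Real.sin (2 * t), ?_⟩
      have h1 : (fermion N).ξ c ((fermion N).ξ b ((fermion N).ξ c ψ))
          = (-(1 / 2) : ℝ) • (fermion N).ξ b ψ := by
        rw [fermion_swap hab.symm, map_neg, fermion_sq, ← neg_smul, ← Complex.coe_smul]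
        norm_num
      have h2 : (fermion N).ξ c ((fermion N).ξ c ((fermion N).ξ b ψ))
          = (1 / 2 : ℝ) • (fermion N).ξ b ψ := by
        rw [fermion_sq, ← Complex.coe_smul]
        norm_num
      have h3 : (fermion N).ξ b ((fermion N).ξ c ((fermion N).ξ b ψ))
          = (-(1 / 2) : ℝ) • (fermion N).ξ c ψ := by
        rw [fermion_swap hab, map_neg, fermion_sq, ← neg_smul, ← Complex.coe_smul]
        norm_num
      simp only [majoranaRotation, map_add, fermion_map_real_smul, h1, h2, h3, Real.cos_two_mul,
        Real.sin_two_mul, smul_add, smul_smul, zero_mul, zero_smul, zero_add]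
      have hcs := Real.sin_sq_add_cos_sq t
      match_scalars
      · linear_combination (-2 * Real.cos t) * hcs
      · ring
    · by_cases hcb : c = b
      · subst hcb
        refine ⟨0, Real.sin (2 * t), Real.cos (2 * t), ?_⟩
        have h1 : (fermion N).ξ a ((fermion N).ξ c ((fermion N).ξ c ψ))
            = (1 / 2 : ℝ) • (fermion N).ξ a ψ := by
          rw [fermion_sq, map_smul, ← Complex.coe_smul]
          norm_num
        have h2 : (fermion N).ξ a ((fermion N).ξ a ((fermion N).ξ c ψ))
            = (1 / 2 : ℝ) • (fermion N).ξ c ψ := by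
          rw [fermion_sq, ← Complex.coe_smul]
          norm_num
        have h3 : (fermion N).ξ c ((fermion N).ξ a ((fermion N).ξ c ψ))
            = (-(1 / 2) : ℝ) • (fermion N).ξ a ψ := by
          rw [fermion_swap hca, h1, neg_smul]
        simp only [majoranaRotation, map_add, fermion_map_real_smul, h1, h2, h3,
          Real.cos_two_mul, Real.sin_two_mul, smul_add, smul_smul, zero_mul, zero_smul, zero_add]
        have hcs := Real.sin_sq_add_cos_sq t
        match_scalars
        · linear_combination (-2 * Real.cos t) * hcs
        · ring
      -- A Majorana operator different from both commutes with the even product `ξ^a ξ^b`.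
      · refine ⟨1, 0, 0, ?_⟩
        have h1 : (fermion N).ξ a ((fermion N).ξ b ((fermion N).ξ c ψ))
            = (fermion N).ξ c ((fermion N).ξ a ((fermion N).ξ b ψ)) := by
          rw [fermion_swap (Ne.symm hcb), map_neg, fermion_swap (Ne.symm hca), neg_neg]
        simp only [majoranaRotation, map_add, fermion_map_real_smul, h1]
        module
  obtain ⟨r₁, r₂, r₃, h⟩ := h
  rw [h]
  exact Submodule.add_mem _ (Submodule.add_mem _
    (Submodule.smul_mem _ _ (ξ_mem_linearSpan _ _)) (Submodule.smul_mem _ _ (ξ_mem_linearSpan _ _)))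
    (Submodule.smul_mem _ _ (ξ_mem_linearSpan _ _))

theorem majoranaRotation_linearSpan {a b : Fin N ⊕ Fin N} (hab : a ≠ b) (t : ℝ)
    {ψ x : Fock N} (hx : x ∈ linearSpan ψ) :
    majoranaRotation a b t x ∈ linearSpan (majoranaRotation a b t ψ) := by
  induction hx using Submodule.span_induction with
  | mem x hx =>
    obtain ⟨c, rfl⟩ := hx
    exact majoranaRotation_ξ hab c t ψ
  | zero => simp [majoranaRotation]
  | add x y _ _ hx hy =>
    rw [majoranaRotation_map_add]
    exact Submodule.add_mem _ hx hy
  | smul r x _ hx =>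
    rw [majoranaRotation_real_smul]
    exact Submodule.smul_mem _ _ hx

/-- The unitary carries `linearSpan ψ` into the span of the rotated state, and with it the stability
under `i` and the orthogonality to the state that expresses `z = 0`. -/
theorem majoranaRotation_mem_fermionGaussian {a b : Fin N ⊕ Fin N} (hab : a ≠ b) (t : ℝ)
    {ψ : Fock N} (hψ : ψ ∈ fermionGaussian N) :
    majoranaRotation a b t ψ ∈ fermionGaussian N := by
  have hI : ∀ x ∈ linearSpan ψ, I • x ∈ linearSpan ψ := by
    intro x hx
    induction hx using Submodule.span_induction with
    | mem x hx =>
      obtain ⟨c, rfl⟩ := hx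
      exact I_smul_mem_linearSpan hψ c
    | zero => simp
    | add x y _ _ hx hy =>
      rw [smul_add]
      exact Submodule.add_mem _ hx hy
    | smul r x _ hx =>
      rw [smul_comm]
      exact Submodule.smul_mem _ _ hx
  have horth : ∀ x ∈ linearSpan ψ, inner ℂ ψ x = 0 := by
    intro x hx
    induction hx using Submodule.span_induction with
    | mem x hx =>
      obtain ⟨c, rfl⟩ := hx
      exact fermion_displacement_eq_zero_iff.1 (hψ.2.1 c)
    | zero => simp
    | add x y _ _ hx hy => rw [inner_add_right, hx, hy, add_zero]
    | smul r x _ hx => rw [← Complex.coe_smul, inner_smul_right, hx, mul_zero]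
  -- Applying the inverse rotation pulls every `ξ^c` of the rotated state back to a vector of
  -- `linearSpan ψ`.
  have hback : ∀ c, ∃ y ∈ linearSpan ψ,
      (fermion N).ξ c (majoranaRotation a b t ψ) = majoranaRotation a b t y := by
    intro c
    have h := majoranaRotation_ξ hab c (-t) (majoranaRotation a b t ψ)
    rw [majoranaRotation_add hab, neg_add_cancel, majoranaRotation_zero] at h
    refine ⟨_, h, ?_⟩
    rw [majoranaRotation_add hab, add_neg_cancel, majoranaRotation_zero]
  refine mem_fermionGaussian ?_ (fun c => ?_) (fun c => ?_)
  · have h := inner_majoranaRotation hab t ψ ψ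
    rw [inner_self_eq_norm_sq_to_K, inner_self_eq_norm_sq_to_K, hψ.1] at h
    have h2 : ‖majoranaRotation a b t ψ‖ ^ 2 = 1 := by
      have h3 : ((‖majoranaRotation a b t ψ‖ ^ 2 : ℝ) : ℂ) = ((1 : ℝ) : ℂ) := by simpa using h
      exact_mod_cast h3
    exact (pow_eq_one_iff_of_nonneg (norm_nonneg _) two_ne_zero).1 h2
  · obtain ⟨y, hy, h⟩ := hback c
    rw [fermion_displacement_eq_zero_iff, h, inner_majoranaRotation hab, horth y hy]
  · obtain ⟨y, hy, h⟩ := hback c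
    rw [h, ← majoranaRotation_I_smul]
    exact majoranaRotation_linearSpan hab t (hI y hy)

/-! ### The fermionic tangent space -/

/-- For `a ≠ b` the vector is half the velocity of the rotation curve; for `a = b` the product is a
multiple of `ψ`, removed by the phase projection. -/
theorem phaseProj_pair_mem {ψ : Fock N} (hψ : ψ ∈ fermionGaussian N) (a b : Fin N ⊕ Fin N) :
    phaseProj ψ ((fermion N).ξ a ((fermion N).ξ b ψ))
      ∈ (fermion N).tangentSpace (fermionGaussian N) ψ := by
  by_cases hab : a = b
  · subst hab
    rw [fermion_sq, phaseProj_smul_self hψ.1]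
    exact Submodule.zero_mem _
  · have hv : HasVelocity (fun t => majoranaRotation a b t ψ)
        ((2 : ℝ) • (fermion N).ξ a ((fermion N).ξ b ψ)) := by
      have h := ((Real.hasDerivAt_cos 0).smul_const ψ).add
        (((Real.hasDerivAt_sin 0).const_mul 2).smul_const ((fermion N).ξ a ((fermion N).ξ b ψ)))
      refine hasDerivAt_of_eq h (fun t => rfl) ?_
      simp
    have hmem : phaseProj ψ ((2 : ℝ) • (fermion N).ξ a ((fermion N).ξ b ψ))
        ∈ (fermion N).tangentSpace (fermionGaussian N) ψ :=
      (fermion N).mem_tangentSpace ⟨fun t => majoranaRotation a b t ψ, _,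
        majoranaRotation_zero a b ψ, fun t => majoranaRotation_mem_fermionGaussian hab t hψ, hv,
        rfl⟩
    have h2 := Submodule.smul_mem _ (1 / 2 : ℝ) hmem
    rw [phaseProj_real_smul, smul_smul] at h2
    norm_num at h2
    exact h2

/-- The factor `i` is absorbed into the right operator, since `i ξ^b ψ` is a real combination of the
`ξ^c ψ`. -/
theorem phaseProj_smul_pair_mem {ψ : Fock N} (hψ : ψ ∈ fermionGaussian N) (a b : Fin N ⊕ Fin N)
    (z : ℂ) : phaseProj ψ (z • (fermion N).ξ a ((fermion N).ξ b ψ))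
      ∈ (fermion N).tangentSpace (fermionGaussian N) ψ := by
  have hlin : ∀ x ∈ linearSpan ψ, phaseProj ψ ((fermion N).ξ a x)
      ∈ (fermion N).tangentSpace (fermionGaussian N) ψ := by
    intro x hx
    induction hx using Submodule.span_induction with
    | mem x hx =>
      obtain ⟨c, rfl⟩ := hx
      exact phaseProj_pair_mem hψ a c
    | zero => simp [phaseProj]
    | add x y _ _ hx hy =>
      rw [map_add, phaseProj_add]
      exact Submodule.add_mem _ hx hy
    | smul r x _ hx =>
      rw [fermion_map_real_smul, phaseProj_real_smul]
      exact Submodule.smul_mem _ _ hx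
  have hz : z • (fermion N).ξ a ((fermion N).ξ b ψ)
      = z.re • (fermion N).ξ a ((fermion N).ξ b ψ)
        + z.im • (fermion N).ξ a (I • (fermion N).ξ b ψ) := by
    rw [map_smul, ← Complex.coe_smul, ← Complex.coe_smul, smul_smul, ← add_smul,
      Complex.re_add_im]
  rw [hz, phaseProj_add, phaseProj_real_smul, phaseProj_real_smul]
  exact Submodule.add_mem _ (Submodule.smul_mem _ _ (phaseProj_pair_mem hψ a b))
    (Submodule.smul_mem _ _ (hlin _ (I_smul_mem_linearSpan hψ b)))

/-- The Majorana operators have no first-order change along Gaussian tangent vectors. -/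
theorem inner_ξ_tangentSpace {ψ : Fock N} (hψ : ψ ∈ fermionGaussian N) (a : Fin N ⊕ Fin N)
    {w : Fock N} (hw : w ∈ (fermion N).tangentSpace (fermionGaussian N) ψ) :
    inner ℂ ((fermion N).ξ a ψ) w = 0 := by
  -- The displacement vanishes identically along a curve of fermionic Gaussian states, hence so does
  -- its derivative.
  have hre : ∀ b, (inner ℂ ((fermion N).ξ b ψ) w).re = 0 := by
    intro b
    refine (fermion N).map_tangentSpace_eq_zero
      (Complex.reCLM.comp ((innerSL ℂ ((fermion N).ξ b ψ)).restrictScalars ℝ)) ?_ hw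
    rintro v ⟨γ, δ, h0, hγ, hδ, rfl⟩
    have h0' : (fun t => (fermion N).incl (γ t)) 0 = (fermion N).incl ψ := h0
    have hn : (inner ℂ ψ δ).re = 0 := by
      have h := re_inner_eq_zero_of_norm_eq_one hδ fun t => (hγ t).1
      change (inner ℂ (γ 0) δ).re = 0 at h
      rwa [h0] at h
    have hd : DenseRange (fermion N).incl := Function.Surjective.denseRange fun x => ⟨x, rfl⟩
    have hcont : ContinuousAt (fun t => (fermion N).incl ((fermion N).ξ b (γ t))) 0 :=
      (LinearMap.continuous_of_finiteDimensional ((fermion N).ξ b)).continuousAt.comp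
        (f := fun t => (fermion N).incl (γ t)) hδ.continuousAt
    have h1 := (fermion_isHermitian b).hasDerivAt_expect hd h0' hδ
      (fun t => ModeSystem.closureMaps_incl _ (γ t)) hcont
    have h2 : HasDerivAt (fun _ : ℝ => (0 : ℝ)) ((fermion N).change ((fermion N).ξ b) ψ δ) 0 :=
      hasDerivAt_of_eq h1 (fun t => ((hγ t).2.1 b).symm) rfl
    have h3 := h2.unique (hasDerivAt_const 0 (0 : ℝ))
    have h4 := (fermion_isHermitian b).change_phaseProj (ψ := ψ) hψ.1 (φ := δ) hn
    rw [h3] at h4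
    have h5 : 2 * (inner ℂ ((fermion N).ξ b ψ) (phaseProj ψ δ)).re = 0 := h4
    show (inner ℂ ((fermion N).ξ b ψ) (phaseProj ψ δ)).re = 0
    linarith
  refine Complex.ext (hre a) ?_
  -- The imaginary part is a real part for `i ξ^a ψ`, a real combination of the `ξ^b ψ`.
  have h : (inner ℂ (I • (fermion N).ξ a ψ) w).re = 0 := by
    rw [fermionGaussian_relation hψ a]
    simp only [inner_neg_left, sum_inner, inner_smul_left, Complex.conj_ofReal, Complex.neg_re,
      Complex.re_sum, Complex.re_ofReal_mul, hre, mul_zero, Finset.sum_const_zero, neg_zero]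
  rw [inner_smul_left] at h
  simpa using h

end Fermion

end GaussianProjection
end

/-! ### Irreducibility, parity of Gaussian states, and the fermionic results -/

noncomputable section

namespace GaussianProjection

open Filter Topology Complex

section Fermion

variable {N : ℕ}

/-! ### Irreducibility of the Majorana operators -/

/-- These products are diagonal in the occupation basis, which allows projecting onto basis vectors
inside an invariant subspace. -/
theorem fermion_occupation_apply (j : Fin N) (ψ : Fock N) (s : Finset (Fin N)) :
    (fermion N).ξ (Sum.inr j) ((fermion N).ξ (Sum.inl j) ψ) s = I / 2 * occSign j s * ψ s := by
  rw [fermion_ξ_apply, fermion_ξ_apply]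
  simp only [modeOf, Sum.elim_inl, Sum.elim_inr, id, symmDiff_symmDiff_cancel_right,
    majoranaCoeff, fockSign_symmDiff, lt_irrefl, if_false]
  linear_combination (I * occSign j s * (fockSign j s * fockSign j s) * ψ s)
    * sqrt_two_inv_mul_self + (I / 2 * occSign j s * ψ s) * fockSign_mul_self j s

theorem single_mem_of_invariant {W : Submodule ℂ (Fock N)}
    (hW : ∀ a, ∀ x ∈ W, (fermion N).ξ a x ∈ W) {e : Fock N} (he : e ∈ W) {s₀ : Finset (Fin N)}
    (hs : e s₀ ≠ 0) : EuclideanSpace.single s₀ (1 : ℂ) ∈ W := by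
  have h : ∀ F : Finset (Fin N), ∃ x ∈ W, ∀ s, x s = if ∀ j ∈ F, (j ∈ s ↔ j ∈ s₀) then e s else 0 := by
    intro F
    induction F using Finset.induction_on with
    | empty => exact ⟨e, he, by simp⟩
    | insert k F _ ih =>
      obtain ⟨x, hx, hxs⟩ := ih
      -- This operator acts as `(1 + occSign k s₀ * occSign k s) / 2`, the projector onto
      -- configurations agreeing with `s₀` in mode `k`.
      refine ⟨(1 / 2 : ℂ) • x + (-I * occSign k s₀) •
        (fermion N).ξ (Sum.inr k) ((fermion N).ξ (Sum.inl k) x),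
        W.add_mem (W.smul_mem _ hx) (W.smul_mem _ (hW _ _ (hW _ _ hx))), fun s => ?_⟩
      have h1 : ((1 / 2 : ℂ) • x + (-I * occSign k s₀) •
          (fermion N).ξ (Sum.inr k) ((fermion N).ξ (Sum.inl k) x)) s
          = (1 + occSign k s₀ * occSign k s) / 2 * x s := by
        rw [PiLp.add_apply, PiLp.smul_apply, PiLp.smul_apply, fermion_occupation_apply,
          smul_eq_mul, smul_eq_mul]
        linear_combination (-(occSign k s₀ * occSign k s) / 2 * x s) * Complex.I_mul_I
      rw [h1, hxs]
      simp only [Finset.forall_mem_insert, occSign]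
      by_cases h2 : k ∈ s <;> by_cases h3 : k ∈ s₀ <;> simp [h2, h3]
  obtain ⟨x, hx, hxs⟩ := h Finset.univ
  have hx2 : x = e s₀ • EuclideanSpace.single s₀ (1 : ℂ) := by
    ext s
    have : (∀ j ∈ Finset.univ, (j ∈ s ↔ j ∈ s₀)) ↔ s = s₀ := by simp [Finset.ext_iff]
    rw [hxs, if_congr this rfl rfl]
    by_cases hss : s = s₀ <;> simp [hss]
  rw [hx2] at hx
  exact (W.smul_mem_iff hs).1 hx

theorem single_symmDiff_mem {W : Submodule ℂ (Fock N)}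
    (hW : ∀ a, ∀ x ∈ W, (fermion N).ξ a x ∈ W) {s : Finset (Fin N)} (j : Fin N)
    (h : EuclideanSpace.single s (1 : ℂ) ∈ W) :
    EuclideanSpace.single (symmDiff s {j}) (1 : ℂ) ∈ W := by
  have h1 : (fermion N).ξ (Sum.inl j) (EuclideanSpace.single s (1 : ℂ))
      = majoranaCoeff (Sum.inl j) (symmDiff s {j}) •
        EuclideanSpace.single (symmDiff s {j}) (1 : ℂ) := by
    ext t
    rw [fermion_ξ_apply, PiLp.smul_apply, smul_eq_mul]
    have h3 : symmDiff t {j} = s ↔ t = symmDiff s {j} := by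
      constructor <;> rintro rfl <;> simp
    by_cases h4 : t = symmDiff s {j}
    · subst h4
      simp [modeOf]
    · have h5 : symmDiff t {j} ≠ s := fun h => h4 (h3.1 h)
      simp [modeOf, h4, h5]
  have hne : majoranaCoeff (Sum.inl j) (symmDiff s {j}) ≠ 0 := by
    simp [majoranaCoeff, fockSign]
  have h2 := hW (Sum.inl j) _ h
  rw [h1] at h2
  exact (W.smul_mem_iff hne).1 h2

/-- Irreducibility: some basis vector lies in the subspace, and toggling modes leads from it to the
empty configuration and from there to all others. -/
theorem eq_top_of_invariant {W : Submodule ℂ (Fock N)}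
    (hW : ∀ a, ∀ x ∈ W, (fermion N).ξ a x ∈ W) {e : Fock N} (he : e ∈ W) (h0 : e ≠ 0) :
    W = ⊤ := by
  obtain ⟨s₀, hs₀⟩ : ∃ s, e s ≠ 0 := by
    by_contra! h
    exact h0 (by ext s; exact h s)
  have hins : ∀ (j : Fin N) (s : Finset (Fin N)), j ∉ s → symmDiff (insert j s) {j} = s ∧
      symmDiff s {j} = insert j s := by
    intro j s hj
    constructor <;> ext x <;> by_cases hx : x = j <;> simp [Finset.mem_symmDiff, hx, hj]
  have hempty : ∀ s : Finset (Fin N), EuclideanSpace.single s (1 : ℂ) ∈ W →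
      EuclideanSpace.single (∅ : Finset (Fin N)) (1 : ℂ) ∈ W := by
    intro s
    induction s using Finset.induction_on with
    | empty => exact id
    | insert j s hj ih =>
      intro h
      have h2 := single_symmDiff_mem hW j h
      rw [(hins j s hj).1] at h2
      exact ih h2
  have hall : ∀ s : Finset (Fin N), EuclideanSpace.single s (1 : ℂ) ∈ W := by
    intro s
    induction s using Finset.induction_on with
    | empty => exact hempty s₀ (single_mem_of_invariant hW he hs₀)
    | insert j s hj ih =>
      rw [← (hins j s hj).2]
      exact single_symmDiff_mem hW j ih
  rw [eq_top_iff]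
  intro x _
  have hx : x = ∑ s, x s • EuclideanSpace.single s (1 : ℂ) := by
    ext t
    simp [Finset.sum_apply, Pi.single_apply]
  rw [hx]
  exact W.sum_mem fun s _ => W.smul_mem _ (hall s)

/-! ### Uniqueness of the vacuum and parity of Gaussian states -/

/-- The annihilation operator `ξ^a - i ∑_c K^{ca} ξ^c` (up to normalization) of a complex
structure. -/
def lowering (K : Matrix (Fin N ⊕ Fin N) (Fin N ⊕ Fin N) ℝ) (a : Fin N ⊕ Fin N) :
    Fock N →ₗ[ℂ] Fock N :=
  (fermion N).ξ a - I • ∑ c, ((K c a : ℝ) : ℂ) • (fermion N).ξ c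

theorem lowering_apply (K : Matrix (Fin N ⊕ Fin N) (Fin N ⊕ Fin N) ℝ) (a : Fin N ⊕ Fin N)
    (x : Fock N) : lowering K a x
      = (fermion N).ξ a x - I • ∑ c, ((K c a : ℝ) : ℂ) • (fermion N).ξ c x := by
  simp only [lowering, LinearMap.sub_apply, LinearMap.smul_apply, LinearMap.sum_apply]

/-- The anticommutator of `lowering K a` with a Majorana operator is a scalar. -/
theorem lowering_ξ (K : Matrix (Fin N ⊕ Fin N) (Fin N ⊕ Fin N) ℝ) (a b : Fin N ⊕ Fin N)
    (x : Fock N) : lowering K a ((fermion N).ξ b x)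
      = ((if a = b then 1 else 0) - I * ((K b a : ℝ) : ℂ)) • x
        - (fermion N).ξ b (lowering K a x) := by
  have h : ∀ c, (fermion N).ξ c ((fermion N).ξ b x)
      = (if c = b then (1 : ℂ) else 0) • x - (fermion N).ξ b ((fermion N).ξ c x) := fun c =>
    eq_sub_of_add_eq (fermion_anticomm c b x)
  simp only [lowering_apply, h, map_sub, map_smul, map_sum, smul_sub, Finset.sum_sub_distrib,
    smul_smul, ← Finset.sum_smul, mul_ite, mul_one, mul_zero, Finset.sum_ite_eq',
    Finset.mem_univ, if_true, sub_smul]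
  abel

/-- The vector `ξ^{a₁} ⋯ ξ^{aₖ} e`. -/
def majoranaWord (e : Fock N) (l : List (Fin N ⊕ Fin N)) : Fock N :=
  l.foldr (fun a x => (fermion N).ξ a x) e

/-- The span of the words shorter than `n`. -/
def wordSpan (e : Fock N) (n : ℕ) : Submodule ℂ (Fock N) :=
  Submodule.span ℂ (majoranaWord e '' {l | l.length < n})

/-- Anticommuting the lowering operator through a word deletes one letter at a time, and the last
term dies on `e`. -/
theorem lowering_word {K : Matrix (Fin N ⊕ Fin N) (Fin N ⊕ Fin N) ℝ} {e : Fock N}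
    (he : ∀ a, lowering K a e = 0) (a : Fin N ⊕ Fin N) (l : List (Fin N ⊕ Fin N)) :
    lowering K a (majoranaWord e l) ∈ wordSpan e l.length := by
  induction l with
  | nil =>
    show lowering K a e ∈ _
    rw [he]
    exact Submodule.zero_mem _
  | cons b l ih =>
    show lowering K a ((fermion N).ξ b (majoranaWord e l)) ∈ _
    rw [lowering_ξ]
    refine Submodule.sub_mem _ (Submodule.smul_mem _ _
      (Submodule.subset_span ⟨l, by simp, rfl⟩)) ?_
    have hle : (wordSpan e l.length).map ((fermion N).ξ b) ≤ wordSpan e (b :: l).length := by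
      rw [wordSpan, Submodule.map_span, Submodule.span_le]
      rintro _ ⟨_, ⟨l', hl', rfl⟩, rfl⟩
      exact Submodule.subset_span ⟨b :: l', by simpa using hl', rfl⟩
    exact hle ⟨_, ih, rfl⟩

theorem inner_word_eq_zero {K : Matrix (Fin N ⊕ Fin N) (Fin N ⊕ Fin N) ℝ} {e o : Fock N}
    (he : ∀ a, lowering K a e = 0) (ho : ∀ a, lowering K a o = 0) (hoe : inner ℂ o e = 0)
    (n : ℕ) : ∀ l : List (Fin N ⊕ Fin N), l.length < n → inner ℂ o (majoranaWord e l) = 0 := by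
  induction n with
  | zero => intro l hl; simp at hl
  | succ n ih =>
    intro l hl
    rcases l with _ | ⟨b, l⟩
    · exact hoe
    · have hspan : ∀ x ∈ wordSpan e l.length, inner ℂ o x = 0 := by
        intro x hx
        have hle : wordSpan e l.length ≤ LinearMap.ker (innerSL ℂ o).toLinearMap := by
          rw [wordSpan, Submodule.span_le]
          rintro _ ⟨l', hl', rfl⟩
          have h1 : l'.length < l.length := hl'
          simp only [List.length_cons] at hl
          exact ih l' (by omega)
        exact hle hx
      show inner ℂ o ((fermion N).ξ b (majoranaWord e l)) = 0
      have h1 := hspan _ (lowering_word he b l)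
      have h2 : inner ℂ (lowering K b o) (majoranaWord e l) = 0 := by rw [ho, inner_zero_left]
      rw [lowering_apply] at h1 h2
      simp only [inner_sub_left, inner_sub_right, inner_smul_left, inner_smul_right, inner_sum,
        sum_inner, Complex.conj_ofReal, Complex.conj_I, fermion_inner_ξ] at h1 h2
      -- Here `ξ^b` is half the sum of the lowering operator and its adjoint; the former shortens
      -- the word, the latter acts on `o`.
      linear_combination (1 / 2) * h1 + (1 / 2) * h2

/-- Uniqueness of the vacuum: a second vacuum orthogonal to `e` is orthogonal to all words in the
Majorana operators applied to `e`, and these span the whole space by irreducibility. -/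
theorem eq_zero_of_lowering {K : Matrix (Fin N ⊕ Fin N) (Fin N ⊕ Fin N) ℝ} {e o : Fock N}
    (h0 : e ≠ 0) (he : ∀ a, lowering K a e = 0) (ho : ∀ a, lowering K a o = 0)
    (hoe : inner ℂ o e = 0) : o = 0 := by
  set W : Submodule ℂ (Fock N) := Submodule.span ℂ (Set.range (majoranaWord e)) with hWdef
  have hW : ∀ a, ∀ x ∈ W, (fermion N).ξ a x ∈ W := by
    intro a x hx
    have hle : W.map ((fermion N).ξ a) ≤ W := by
      rw [hWdef, Submodule.map_span, Submodule.span_le]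
      rintro _ ⟨_, ⟨l, rfl⟩, rfl⟩
      exact Submodule.subset_span ⟨a :: l, rfl⟩
    exact hle ⟨x, hx, rfl⟩
  have htop := eq_top_of_invariant hW (Submodule.subset_span ⟨[], rfl⟩) h0
  have hle : W ≤ LinearMap.ker (innerSL ℂ o).toLinearMap := by
    rw [hWdef, Submodule.span_le]
    rintro _ ⟨l, rfl⟩
    exact inner_word_eq_zero he ho hoe (l.length + 1) l (by simp)
  have ho2 : o ∈ W := htop ▸ Submodule.mem_top
  exact inner_self_eq_zero.1 (hle ho2)

/-- Fermionic Gaussian states have definite parity. -/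
theorem exists_parity_eq_smul {ψ : Fock N} (hψ : ψ ∈ fermionGaussian N) :
    ∃ s : ℂ, parity N ψ = s • ψ := by
  set K := (fermion N).symplectic ψ
  have he : ∀ a, lowering K a ψ = 0 := by
    intro a
    have h := fermionGaussian_relation hψ a
    rw [lowering_apply, sub_eq_zero]
    have h2 := congrArg (fun x => (-I) • x) h
    simp only [smul_smul, smul_neg, neg_smul, neg_mul, Complex.I_mul_I, neg_neg, one_smul] at h2
    exact h2
  -- The lowering operators are odd, so `parity N ψ` is a vacuum of the same complex structure.
  have hP : ∀ a, lowering K a (parity N ψ) = 0 := by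
    intro a
    have h : ∀ c, (fermion N).ξ c (parity N ψ) = -parity N ((fermion N).ξ c ψ) := fun c => by
      rw [parity_ξ, neg_neg]
    have h2 : lowering K a (parity N ψ) = -parity N (lowering K a ψ) := by
      simp only [lowering_apply, h, map_sub, map_smul, map_sum, smul_neg, Finset.sum_neg_distrib]
      abel
    rw [h2, he, map_zero, neg_zero]
  have h0 : ψ ≠ 0 := by
    rintro rfl
    simpa using hψ.1
  refine ⟨inner ℂ ψ (parity N ψ), ?_⟩
  rw [← sub_eq_zero, ← phaseProj_of_norm_eq_one hψ.1]
  -- The component of `parity N ψ` orthogonal to `ψ` is again annihilated, so uniqueness makes it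
  -- zero.
  refine eq_zero_of_lowering h0 he (fun a => ?_) ?_
  · rw [phaseProj_of_norm_eq_one hψ.1, map_sub, map_smul, he, hP, smul_zero, sub_zero]
  · rw [← inner_conj_symm, inner_phaseProj hψ.1, map_zero]

theorem conj_mul_self_of_parity {ψ : Fock N} (h1 : ‖ψ‖ = 1) {s : ℂ} (hs : parity N ψ = s • ψ) :
    (starRingEnd ℂ) s * s = 1 := by
  have h := inner_parity_parity ψ ψ
  rw [hs, inner_smul_left, inner_smul_right, inner_self_eq_norm_sq_to_K, h1] at h
  simpa using h

/-- Parity preserves inner products, and `ξ^a ψ` has the opposite parity, so the inner product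
equals its own negative. -/
theorem inner_ξ_of_sameParity {ψ φ : Fock N} (h1 : ‖ψ‖ = 1) (h : SameParity ψ φ)
    (a : Fin N ⊕ Fin N) : inner ℂ ((fermion N).ξ a ψ) φ = 0 := by
  obtain ⟨s, hs, hφ⟩ := h
  have h2 := inner_parity_parity ((fermion N).ξ a ψ) φ
  rw [parity_ξ, hs, hφ, map_smul, inner_neg_left, inner_smul_left, inner_smul_right, ← mul_assoc,
    conj_mul_self_of_parity h1 hs] at h2
  linear_combination (-1 / 2 : ℂ) * h2

/-! ### The fermionic statements -/

theorem fermion_linQuad_apply (f : Fin N ⊕ Fin N → ℂ) (h : Fin N ⊕ Fin N → Fin N ⊕ Fin N → ℂ)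
    (ψ : Fock N) : (fermion N).linQuad f h ψ = ∑ a, f a • (fermion N).ξ a ψ
      + ∑ a, ∑ b, (1 / 2 * h a b) • (fermion N).ξ a ((fermion N).ξ b ψ) := by
  simp only [ModeSystem.linQuad, LinearMap.add_apply, LinearMap.sum_apply, LinearMap.smul_apply,
    LinearMap.comp_apply, Finset.smul_sum, smul_smul]

theorem phaseProj_quadratic_mem {ψ : Fock N} (hψ : ψ ∈ fermionGaussian N)
    (h : Fin N ⊕ Fin N → Fin N ⊕ Fin N → ℂ) :
    phaseProj ψ (∑ a, ∑ b, h a b • (fermion N).ξ a ((fermion N).ξ b ψ))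
      ∈ (fermion N).tangentSpace (fermionGaussian N) ψ := by
  have hadd : ∀ x y : Fock N, phaseProj ψ x ∈ (fermion N).tangentSpace (fermionGaussian N) ψ →
      phaseProj ψ y ∈ (fermion N).tangentSpace (fermionGaussian N) ψ →
      phaseProj ψ (x + y) ∈ (fermion N).tangentSpace (fermionGaussian N) ψ := by
    intro x y hx hy
    rw [phaseProj_add]
    exact Submodule.add_mem _ hx hy
  have h0 : phaseProj ψ 0 ∈ (fermion N).tangentSpace (fermionGaussian N) ψ := by
    simp [phaseProj]
  exact Finset.sum_induction _ _ hadd h0 fun a _ => Finset.sum_induction _ _ hadd h0 fun b _ =>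
    phaseProj_smul_pair_mem hψ a b (h a b)

theorem phaseProj_anticomm_mem {ψ : Fock N} (hψ : ψ ∈ fermionGaussian N) (a b : Fin N ⊕ Fin N) :
    phaseProj ψ ((fermion N).anticomm a b ψ)
      ∈ (fermion N).tangentSpace (fermionGaussian N) ψ := by
  simp only [ModeSystem.anticomm, LinearMap.add_apply, LinearMap.comp_apply, phaseProj_add]
  exact Submodule.add_mem _ (phaseProj_pair_mem hψ a b) (phaseProj_pair_mem hψ b a)

theorem phaseProj_hermComm_mem {ψ : Fock N} (hψ : ψ ∈ fermionGaussian N) (a b : Fin N ⊕ Fin N) :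
    phaseProj ψ ((fermion N).hermComm a b ψ)
      ∈ (fermion N).tangentSpace (fermionGaussian N) ψ := by
  have h : (fermion N).hermComm a b ψ = (-I) • (fermion N).ξ a ((fermion N).ξ b ψ)
      + I • (fermion N).ξ b ((fermion N).ξ a ψ) := by
    simp only [ModeSystem.hermComm, LinearMap.smul_apply, LinearMap.sub_apply,
      LinearMap.comp_apply]
    module
  rw [h, phaseProj_add]
  exact Submodule.add_mem _ (phaseProj_smul_pair_mem hψ a b _) (phaseProj_smul_pair_mem hψ b a _)

/-- The linear part contributes nothing on either side: on `φ` by `hf`, on the projection because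
Majorana operators have no first-order change along tangent vectors. The quadratic part is covered
by tangency. -/
theorem fermion_change_linQuad {ψ : Fock N} (hψ : ψ ∈ fermionGaussian N)
    (f : Fin N ⊕ Fin N → ℂ) (h : Fin N ⊕ Fin N → Fin N ⊕ Fin N → ℂ) {φ : Fock N}
    (hφ : inner ℂ ψ φ = 0) (hf : f = 0 ∨ SameParity ψ φ) :
    (fermion N).change ((fermion N).linQuad f h) ψ φ
      = (fermion N).change ((fermion N).linQuad f h) ψ
          ((fermion N).tangentProj (fermionGaussian N) ψ φ) := by
  have hsplit : ∀ χ : Fock N, (∀ a, (starRingEnd ℂ) (f a) * inner ℂ ((fermion N).ξ a ψ) χ = 0) →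
      (fermion N).change ((fermion N).linQuad f h) ψ χ
        = (fermion N).change ((fermion N).linQuad 0 h) ψ χ := by
    intro χ hχ
    show 2 * (inner ℂ ((fermion N).linQuad f h ψ) χ).re
      = 2 * (inner ℂ ((fermion N).linQuad 0 h ψ) χ).re
    simp only [fermion_linQuad_apply, inner_add_left, sum_inner, inner_smul_left, hχ,
      Pi.zero_apply, map_zero, zero_mul]
  rw [hsplit φ, hsplit]
  · refine (fermion N).change_tangentProj_of_inner_eq_zero hψ.1 ?_ hφ
    have h2 := phaseProj_quadratic_mem hψ fun a b => 1 / 2 * h a b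
    have h3 : (fermion N).linQuad 0 h ψ
        = ∑ a, ∑ b, (1 / 2 * h a b) • (fermion N).ξ a ((fermion N).ξ b ψ) := by
      simp [fermion_linQuad_apply]
    rw [← h3] at h2
    exact h2
  · intro a
    rw [inner_ξ_tangentSpace hψ a ((fermion N).tangentProj_mem _ ψ φ), mul_zero]
  · intro a
    rcases hf with rfl | hf
    · simp
    · rw [inner_ξ_of_sameParity hψ.1 hf, mul_zero]

theorem fermion_denseRange : DenseRange (fermion N).incl :=
  Function.Surjective.denseRange fun x => ⟨x, rfl⟩

theorem fermion_continuousAt (A : Fock N →ₗ[ℂ] Fock N) {u : ℝ → Fock N} {v : Fock N}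
    (hu : HasVelocity u v) : ContinuousAt (fun t => A (u t)) 0 :=
  (LinearMap.continuous_of_finiteDimensional A).continuousAt.comp (f := u) hu.continuousAt

/-- With `x = Aψ` and `y = Hψ` this turns the expectation of `[iH, A]` into the change of `A` along
`-iHψ`. -/
theorem commutator_eq_change {H : Type*} [NormedAddCommGroup H] [InnerProductSpace ℂ H]
    (x y : H) : I * (inner ℂ y x - inner ℂ x y)
      = ((2 * (inner ℂ x ((-I) • y)).re : ℝ) : ℂ) := by
  rw [← inner_conj_symm y x, inner_smul_right]
  generalize inner ℂ x y = w
  apply Complex.ext <;> simp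
  ring

theorem fermionCommExpect_eq {Ham A : Fock N →ₗ[ℂ] Fock N} (hHam : Ham.IsSymmetric)
    (hA : (fermion N).IsHermitian A) (ψ : Fock N) :
    fermionCommExpect Ham A ψ = (((fermion N).change A ψ ((-I) • Ham ψ) : ℝ) : ℂ) := by
  have h := commutator_eq_change (A ψ) (Ham ψ)
  have hA' : inner ℂ (A ψ) (Ham ψ) = inner ℂ ψ (A (Ham ψ)) := hA ψ (Ham ψ)
  rw [hA', hHam ψ (A ψ)] at h
  rw [fermionCommExpect, inner_smul_right, inner_sub_right]
  exact h

theorem re_inner_symmetric {Ham : Fock N →ₗ[ℂ] Fock N} (hHam : Ham.IsSymmetric) (ψ : Fock N) :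
    (inner ℂ ψ ((-I) • Ham ψ)).re = 0 := by
  have h := congrArg Complex.im (hHam ψ ψ)
  rw [← inner_conj_symm (Ham ψ), Complex.conj_im] at h
  rw [inner_smul_right]
  simp
  linarith

theorem fermion_change_ξ_of_parity {Ham : Fock N →ₗ[ℂ] Fock N} {ψ : Fock N}
    (hψ : ψ ∈ fermionGaussian N) (hP : ∀ x, parity N (Ham x) = Ham (parity N x))
    (a : Fin N ⊕ Fin N) : (fermion N).change ((fermion N).ξ a) ψ ((-I) • Ham ψ) = 0 := by
  obtain ⟨s, hs⟩ := exists_parity_eq_smul hψ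
  have h : inner ℂ ((fermion N).ξ a ψ) ((-I) • Ham ψ) = 0 := by
    refine inner_ξ_of_sameParity hψ.1 ⟨s, hs, ?_⟩ a
    rw [map_smul, hP, hs, map_smul, smul_comm]
  show 2 * (inner ℂ ((fermion N).ξ a ψ) ((-I) • Ham ψ)).re = 0
  rw [h]
  simp

theorem fermion_change_ξ_tangentSpace {ψ : Fock N} (hψ : ψ ∈ fermionGaussian N)
    (a : Fin N ⊕ Fin N) {χ : Fock N}
    (hχ : χ ∈ (fermion N).tangentSpace (fermionGaussian N) ψ) :
    (fermion N).change ((fermion N).ξ a) ψ χ = 0 := by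
  show 2 * (inner ℂ ((fermion N).ξ a ψ) χ).re = 0
  rw [inner_ξ_tangentSpace hψ a hχ]
  simp

theorem fermion_hasDerivAt_moments {ψ : Fock N} (hψ : ψ ∈ fermionGaussian N) {u : ℝ → Fock N}
    {v : Fock N} (h0 : u 0 = ψ) (hu : HasVelocity u v) (hv : (inner ℂ ψ v).re = 0) :
    (∀ a, HasDerivAt (fun t => (fermion N).displacement (u t) a)
      ((fermion N).change ((fermion N).ξ a) ψ v) 0) ∧
    (∀ a b, HasDerivAt (fun t => (fermion N).metric (u t) a b)
      ((fermion N).changeMetric ψ v a b) 0) ∧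
    (∀ a b, HasDerivAt (fun t => (fermion N).symplectic (u t) a b)
      ((fermion N).change ((fermion N).hermComm a b) ψ v) 0) :=
  ModeSystem.hasDerivAt_moments (S := fermion N) fermion_isHermitian fermion_denseRange hψ.1
    (y := fun t a b => (fermion N).ξ a ((fermion N).ξ b (u t))) h0 hu hv
    (fun t _ => ModeSystem.closureMaps_incl (S := fermion N) _ (u t))
    (fun t _ b => ModeSystem.closureMaps_incl (S := fermion N) _ ((fermion N).ξ b (u t)))
    (fun a => fermion_continuousAt ((fermion N).ξ a) hu)
    (fun a b => fermion_continuousAt ((fermion N).ξ a ∘ₗ (fermion N).ξ b) hu)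

/-- Curves with the exact velocity and curves with the projected velocity. -/
theorem fermion_curve_cases {Ham : Fock N →ₗ[ℂ] Fock N} (hHam : Ham.IsSymmetric)
    {ψ φ χ v : Fock N} (hψ : ψ ∈ fermionGaussian N) (hφ : φ = (-I) • Ham ψ)
    (hχ : χ = (fermion N).tangentProj (fermionGaussian N) ψ φ) {u : ℝ → Fock N} (h0 : u 0 = ψ)
    (hu : HasVelocity u v)
    (hv : v = φ ∨ ((∀ t, u t ∈ fermionGaussian N) ∧ phaseProj ψ v = χ)) :
    (inner ℂ ψ v).re = 0 ∧ ∀ A, (fermion N).IsHermitian A →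
      phaseProj ψ (A ψ) ∈ (fermion N).tangentSpace (fermionGaussian N) ψ →
      (fermion N).change A ψ v = (fermion N).change A ψ χ := by
  rcases hv with rfl | ⟨hG, hv⟩
  · have hre : (inner ℂ ψ v).re = 0 := hφ ▸ re_inner_symmetric hHam ψ
    refine ⟨hre, fun A hA hm => ?_⟩
    rw [hχ]
    exact (hA.change_tangentProj hψ.1 hm hre).symm
  · have hre : (inner ℂ ψ v).re = 0 := by
      have h := re_inner_eq_zero_of_norm_eq_one hu fun t => (hG t).1
      rwa [h0] at h
    refine ⟨hre, fun A hA hm => ?_⟩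
    rw [← hv]
    exact (hA.change_phaseProj (ψ := ψ) hψ.1 hre).symm

theorem fermion_proposition {ψ : Fock N} (hψ : ψ ∈ fermionGaussian N)
    (f : Fin N ⊕ Fin N → ℂ) (h : Fin N ⊕ Fin N → Fin N ⊕ Fin N → ℂ)
    (hA : (fermion N).IsHermitian ((fermion N).linQuad f h)) {φ : Fock N}
    (hφ : inner ℂ ψ φ = 0) (hf : f = 0 ∨ SameParity ψ φ) {v : Fock N}
    (hv : v = φ ∨ v = (fermion N).tangentProj (fermionGaussian N) ψ φ) {u : ℝ → Fock N}
    (h0 : u 0 = ψ) (hu : HasVelocity u v) :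
    HasDerivAt (fun t => (inner ℂ (u t) ((fermion N).linQuad f h (u t))).re / ‖u t‖ ^ 2)
      ((fermion N).change ((fermion N).linQuad f h) ψ φ) 0 := by
  have hc : (fermion N).change ((fermion N).linQuad f h) ψ v
      = (fermion N).change ((fermion N).linQuad f h) ψ φ := by
    rcases hv with rfl | rfl
    · rfl
    · exact (fermion_change_linQuad hψ f h hφ hf).symm
  have hre : (inner ℂ ψ v).re = 0 := by
    rcases hv with rfl | rfl
    · rw [hφ, Complex.zero_re]
    · have h2 := (fermion N).inner_tangentSpace (ψ := ψ) hψ.1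
        ((fermion N).tangentProj_mem (fermionGaussian N) ψ φ)
      exact congrArg Complex.re h2
  rw [← hc]
  exact hA.hasDerivAt_expect_div (ψ := ψ) fermion_denseRange hψ.1 h0 hu hre
    (fun t => ModeSystem.closureMaps_incl (S := fermion N) _ (u t)) (fermion_continuousAt _ hu)

theorem fermion_corollary {ψ : Fock N} (hψ : ψ ∈ fermionGaussian N)
    (Ham : Fock N →ₗ[ℂ] Fock N) (hHam : Ham.IsSymmetric) (φ χ : Fock N)
    (hφ : φ = (-Complex.I) • Ham ψ)
    (hχ : χ = (fermion N).tangentProj (fermionGaussian N) ψ φ) :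
    ((∀ x, parity N (Ham x) = Ham (parity N x)) → ∀ a,
      (((fermion N).change ((fermion N).ξ a) ψ χ : ℝ) : ℂ)
          = fermionCommExpect Ham ((fermion N).ξ a) ψ ∧
      ∀ (u : ℝ → Fock N) (v : Fock N), u 0 = ψ → HasVelocity u v →
        (v = φ ∨ ((∀ t, u t ∈ fermionGaussian N) ∧ phaseProj ψ v = χ)) →
        HasDerivAt (fun t => (fermion N).displacement (u t) a)
          ((fermion N).change ((fermion N).ξ a) ψ χ) 0) ∧
    (∀ a b, (((fermion N).changeMetric ψ χ a b : ℝ) : ℂ)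
        = fermionCommExpect Ham ((fermion N).anticomm a b) ψ
          - 2 * (fermionCommExpect Ham ((fermion N).ξ a) ψ * (fermion N).displacement ψ b
            + (fermion N).displacement ψ a * fermionCommExpect Ham ((fermion N).ξ b) ψ)) ∧
    (∀ a b, (((fermion N).change ((fermion N).hermComm a b) ψ χ : ℝ) : ℂ)
        = fermionCommExpect Ham ((fermion N).hermComm a b) ψ) ∧
    ∀ (u : ℝ → Fock N) (v : Fock N), u 0 = ψ → HasVelocity u v →
      (v = φ ∨ ((∀ t, u t ∈ fermionGaussian N) ∧ phaseProj ψ v = χ)) →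
      (∀ a b, HasDerivAt (fun t => (fermion N).metric (u t) a b)
        ((fermion N).changeMetric ψ χ a b) 0) ∧
      (∀ a b, HasDerivAt (fun t => (fermion N).symplectic (u t) a b)
        ((fermion N).change ((fermion N).hermComm a b) ψ χ) 0) := by
  have hmem : χ ∈ (fermion N).tangentSpace (fermionGaussian N) ψ :=
    hχ ▸ (fermion N).tangentProj_mem _ ψ φ
  have hre : (inner ℂ ψ φ).re = 0 := hφ ▸ re_inner_symmetric hHam ψ
  have hquad : ∀ A, (fermion N).IsHermitian A →
      phaseProj ψ (A ψ) ∈ (fermion N).tangentSpace (fermionGaussian N) ψ →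
      (((fermion N).change A ψ χ : ℝ) : ℂ) = fermionCommExpect Ham A ψ := by
    intro A hA hm
    rw [fermionCommExpect_eq hHam hA, ← hφ, hχ]
    exact congrArg _ (hA.change_tangentProj hψ.1 hm hre)
  have hanti := ModeSystem.isHermitian_anticomm (S := fermion N) fermion_isHermitian
  have hherm := ModeSystem.isHermitian_hermComm (S := fermion N) fermion_isHermitian
  refine ⟨fun hP a => ⟨?_, fun u v h0 hu hv => ?_⟩, fun a b => ?_, fun a b => ?_,
    fun u v h0 hu hv => ⟨fun a b => ?_, fun a b => ?_⟩⟩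
  · rw [fermionCommExpect_eq hHam (fermion_isHermitian a), fermion_change_ξ_of_parity hψ hP,
      fermion_change_ξ_tangentSpace hψ a hmem]
  · rw [fermion_change_ξ_tangentSpace hψ a hmem]
    rcases hv with rfl | ⟨hG, -⟩
    · have h := (fermion_hasDerivAt_moments hψ h0 hu hre).1 a
      rwa [hφ, fermion_change_ξ_of_parity hψ hP] at h
    · exact hasDerivAt_of_eq (hasDerivAt_const (0 : ℝ) (0 : ℝ)) (fun t => (hG t).2.1 a) rfl
  -- With `z = 0` all terms containing the velocity of the displacement drop out, so parity
  -- conservation of `Ham` is not needed here.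
  · rw [ModeSystem.changeMetric, hψ.2.1 a, hψ.2.1 b,
      ← hquad _ (hanti a b) (phaseProj_anticomm_mem hψ a b)]
    simp
  · exact hquad _ (hherm a b) (phaseProj_hermComm_mem hψ a b)
  · obtain ⟨hre', hcase⟩ := fermion_curve_cases hHam hψ hφ hχ h0 hu hv
    have h := (fermion_hasDerivAt_moments hψ h0 hu hre').2.1 a b
    rw [ModeSystem.changeMetric, hψ.2.1 a, hψ.2.1 b,
      hcase _ (hanti a b) (phaseProj_anticomm_mem hψ a b)] at h
    rw [ModeSystem.changeMetric, hψ.2.1 a, hψ.2.1 b]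
    simpa using h
  · obtain ⟨hre', hcase⟩ := fermion_curve_cases hHam hψ hφ hχ h0 hu hv
    have h := (fermion_hasDerivAt_moments hψ h0 hu hre').2.2 a b
    rwa [hcase _ (hherm a b) (phaseProj_hermComm_mem hψ a b)] at h

end Fermion

end GaussianProjection
end

/-! ### Canonical commutation relations in the Schrödinger representation -/

noncomputable section

namespace GaussianProjection

open Filter Topology Complex

section Boson

variable {N : ℕ}

/-! ### The canonical commutation relations -/

theorem boson_incl_eq (f : BosonCore N) : (boson N).incl f = f.toLp 2 volume := rfl

theorem boson_incl_injective : Function.Injective (boson N).incl :=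
  SchwartzMap.injective_toLp 2 volume

theorem boson_denseRange : DenseRange (boson N).incl :=
  SchwartzMap.denseRange_toLpCLM (F := ℂ) (p := 2) (μ := (volume : Measure (Conf N))) (by simp)

theorem boson_inner (f g : BosonCore N) :
    inner ℂ ((boson N).incl f) ((boson N).incl g) = ∫ x, inner ℂ (f x) (g x) :=
  SchwartzMap.inner_toL2_toL2_eq f g volume

theorem position_isHermitian (j : Fin N) : (boson N).IsHermitian (position N j) := by
  intro f g
  rw [boson_inner, boson_inner]
  congr 1
  funext x
  simp only [position_apply, RCLike.inner_apply, map_mul, Complex.conj_ofReal]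
  ring

/-- Integration by parts; the sign it produces is compensated by conjugating `-I`. -/
theorem momentum_isHermitian (j : Fin N) : (boson N).IsHermitian (momentum N j) := by
  intro f g
  have h := SchwartzMap.integral_bilinear_lineDerivOp_right_eq_neg_left (μ := volume) f g
    ((ContinuousLinearMap.mul ℝ ℂ).comp (Complex.conjCLE : ℂ →L[ℝ] ℂ))
    (EuclideanSpace.single j (1 : ℝ))
  simp only [ContinuousLinearMap.comp_apply, ContinuousLinearMap.mul_apply',
    ContinuousLinearEquiv.coe_coe, Complex.conjCLE_apply] at h
  have h1 : ∀ f : BosonCore N, ∀ x, momentum N j f x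
      = -I * LineDeriv.lineDerivOp (EuclideanSpace.single j (1 : ℝ)) f x := fun f x => by
    simp [momentum]
  rw [boson_inner, boson_inner]
  simp only [RCLike.inner_apply, h1, map_mul, map_neg, Complex.conj_I, neg_neg]
  calc _ = ∫ x, I * ((starRingEnd ℂ)
        (LineDeriv.lineDerivOp (EuclideanSpace.single j (1 : ℝ)) f x) * g x) := by
        congr 1; funext x; ring
    _ = ∫ x, (-I) * ((starRingEnd ℂ) (f x)
        * LineDeriv.lineDerivOp (EuclideanSpace.single j (1 : ℝ)) g x) := by
        rw [integral_const_mul, integral_const_mul, h]; ring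
    _ = _ := by congr 1; funext x; ring

theorem boson_isHermitian (a : Fin N ⊕ Fin N) : (boson N).IsHermitian ((boson N).ξ a) := by
  rcases a with j | j
  · exact position_isHermitian j
  · exact momentum_isHermitian j

theorem position_comm (j k : Fin N) (f : BosonCore N) :
    position N j (position N k f) = position N k (position N j f) := by
  ext x
  simp only [position_apply]
  ring

theorem momentum_comm (j k : Fin N) (f : BosonCore N) :
    momentum N j (momentum N k f) = momentum N k (momentum N j f) := by
  have hs : ContDiff ℝ 2 f := f.smooth 2
  have h : ∀ (v w x : Conf N), fderiv ℝ (fun y => fderiv ℝ f y v) x w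
      = fderiv ℝ (fderiv ℝ f) x w v := by
    intro v w x
    have hd : DifferentiableAt ℝ (fderiv ℝ f) x :=
      (hs.fderiv_right (m := 1) (by norm_num)).differentiable (by norm_num) x
    rw [fderiv_clm_apply hd (differentiableAt_const v)]
    simp
  have h2 : ∀ (i l : Fin N) (x : Conf N), momentum N i (momentum N l f) x
      = -fderiv ℝ (fderiv ℝ f) x (EuclideanSpace.single i 1) (EuclideanSpace.single l 1) := by
    intro i l x
    rw [momentum_apply]
    have h3 : ⇑(momentum N l f) = fun y => (-I) • fderiv ℝ f y (EuclideanSpace.single l 1) := by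
      funext y
      rw [momentum_apply, smul_eq_mul]
    have hd : DifferentiableAt ℝ (fun y => fderiv ℝ f y (EuclideanSpace.single l 1)) x :=
      ((hs.fderiv_right (m := 1) (by norm_num)).differentiable (by norm_num) x).clm_apply
        (differentiableAt_const _)
    rw [h3, fderiv_fun_const_smul hd, smul_apply, h, smul_eq_mul]
    linear_combination (fderiv ℝ (fderiv ℝ f) x (EuclideanSpace.single i 1)
      (EuclideanSpace.single l 1)) * Complex.I_mul_I
  ext x
  rw [h2, h2]
  have hsym : IsSymmSndFDerivAt ℝ f x :=
    hs.contDiffAt.isSymmSndFDerivAt (by simp)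
  rw [hsym.eq]

theorem position_hasFDerivAt (j : Fin N) (x : Conf N) : HasFDerivAt (fun y : Conf N => ((y j : ℝ) : ℂ))
    (Complex.ofRealCLM.comp (EuclideanSpace.proj (𝕜 := ℝ) j)) x :=
  (Complex.ofRealCLM.comp (EuclideanSpace.proj (𝕜 := ℝ) j)).hasFDerivAt

theorem momentum_position (j k : Fin N) (f : BosonCore N) :
    momentum N j (position N k f)
      = position N k (momentum N j f) - (if j = k then I else 0) • f := by
  ext x
  have h1 : ⇑(position N k f) = fun y => ((y k : ℝ) : ℂ) * f y := by
    funext y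
    rw [position_apply]
  rw [sub_apply, smul_apply, momentum_apply, position_apply,
    momentum_apply, h1,
    ((position_hasFDerivAt k x).fun_mul (f.differentiableAt (x := x)).hasFDerivAt).fderiv]
  by_cases h : j = k
  · subst h
    simp
    ring
  · have h' : k ≠ j := fun e => h e.symm
    simp [h, h']
    ring

theorem boson_corr {ψ : BosonCore N} (h1 : ‖(boson N).incl ψ‖ = 1) (a b : Fin N ⊕ Fin N) :
    corrOf ((boson N).incl ψ) (fun c => (boson N).incl ((boson N).ξ c ψ)) a b
      = inner ℂ ((boson N).incl ψ) ((boson N).incl ((boson N).ξ a ((boson N).ξ b ψ)))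
        - ((boson N).displacement ψ a * (boson N).displacement ψ b : ℝ) := by
  have hz : ∀ a, inner ℂ ((boson N).incl ψ) ((boson N).incl ((boson N).ξ a ψ))
      = ((boson N).displacement ψ a : ℂ) := by
    intro a
    refine Complex.ext rfl ?_
    have h := (boson_isHermitian a).im_expect ψ
    rw [boson_isHermitian a] at h
    rw [h, Complex.ofReal_im]
  have hd : ∀ a, displacementOf ((boson N).incl ψ)
    (fun c => (boson N).incl ((boson N).ξ c ψ)) a = (boson N).displacement ψ a := fun _ => rfl
  simp only [corrOf, hd, inner_sub_left, inner_sub_right, inner_smul_left, inner_smul_right,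
    Complex.conj_ofReal, boson_isHermitian a _ _, hz, inner_self_eq_norm_sq_to_K, h1]
  simp

/-- The imaginary part of `C₂` is the expectation of a commutator, which is a scalar and so the same
for all unit vectors. The minus sign reflects the sign convention of `Matrix.J`. -/
theorem boson_symplectic {ψ : BosonCore N} (h1 : ‖(boson N).incl ψ‖ = 1) :
    (boson N).symplectic ψ = -Matrix.J (Fin N) ℝ := by
  have hc : ∀ a b, (boson N).symplectic ψ a b = (inner ℂ ((boson N).incl ψ)
      ((boson N).incl ((boson N).ξ a ((boson N).ξ b ψ)
        - (boson N).ξ b ((boson N).ξ a ψ)))).im := by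
    intro a b
    show 2 * (corrOf ((boson N).incl ψ) (fun c => (boson N).incl ((boson N).ξ c ψ)) a b).im = _
    have h3 : inner ℂ ((boson N).incl ψ) ((boson N).incl ((boson N).ξ b ((boson N).ξ a ψ)))
        = (starRingEnd ℂ) (inner ℂ ((boson N).incl ψ)
          ((boson N).incl ((boson N).ξ a ((boson N).ξ b ψ)))) := by
      rw [inner_conj_symm, ← boson_isHermitian b, boson_isHermitian a, boson_isHermitian b]
    rw [boson_corr h1, map_sub, inner_sub_right, h3, Complex.sub_im, Complex.sub_im,
      Complex.conj_im, Complex.ofReal_im]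
    ring
  have hn : inner ℂ ((boson N).incl ψ) ((boson N).incl ψ) = 1 := by
    rw [inner_self_eq_norm_sq_to_K, h1]
    simp
  ext a b
  rw [hc]
  rcases a with j | j <;> rcases b with k | k
  · have : (boson N).ξ (Sum.inl j) ((boson N).ξ (Sum.inl k) ψ)
        - (boson N).ξ (Sum.inl k) ((boson N).ξ (Sum.inl j) ψ) = 0 :=
      sub_eq_zero.2 (position_comm j k ψ)
    rw [this]
    simp [Matrix.J]
  · have : (boson N).ξ (Sum.inl j) ((boson N).ξ (Sum.inr k) ψ)
        - (boson N).ξ (Sum.inr k) ((boson N).ξ (Sum.inl j) ψ) = (if k = j then I else 0) • ψ := by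
      show position N j (momentum N k ψ) - momentum N k (position N j ψ) = _
      rw [momentum_position]
      abel
    rw [this, map_smul, inner_smul_right, hn]
    by_cases h : j = k
    · simp [Matrix.J, h]
    · simp [Matrix.J, h, Ne.symm h]
  · have : (boson N).ξ (Sum.inr j) ((boson N).ξ (Sum.inl k) ψ)
        - (boson N).ξ (Sum.inl k) ((boson N).ξ (Sum.inr j) ψ) = -(if j = k then I else 0) • ψ := by
      show momentum N j (position N k ψ) - position N k (momentum N j ψ) = _
      rw [momentum_position, neg_smul]
      abel
    rw [this, map_smul, inner_smul_right, hn]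
    by_cases h : j = k <;> simp [Matrix.J, h]
  · have : (boson N).ξ (Sum.inr j) ((boson N).ξ (Sum.inr k) ψ)
        - (boson N).ξ (Sum.inr k) ((boson N).ξ (Sum.inr j) ψ) = 0 :=
      sub_eq_zero.2 (momentum_comm j k ψ)
    rw [this]
    simp [Matrix.J]

end Boson

end GaussianProjection
end

/-! ### Bosonic Gaussian states and their annihilation equations -/

noncomputable section

namespace GaussianProjection

open Filter Topology Complex
open scoped Matrix

section Boson

variable {N : ℕ}

/-! ### Bosonic Gaussian states as vacua -/

/-- The core vector `(ξ - z)^a ψ`. -/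
def centered (ψ : BosonCore N) (a : Fin N ⊕ Fin N) : BosonCore N :=
  (boson N).ξ a ψ - ((boson N).displacement ψ a : ℂ) • ψ

theorem inner_centered {ψ : BosonCore N} (h1 : ‖(boson N).incl ψ‖ = 1) (a b : Fin N ⊕ Fin N) :
    inner ℂ ((boson N).incl (centered ψ a)) ((boson N).incl (centered ψ b))
      = ((((boson N).metric ψ a b : ℝ) : ℂ) - ((Matrix.J (Fin N) ℝ a b : ℝ) : ℂ) * I) / 2 := by
  have hc : corrOf ((boson N).incl ψ) (fun c => (boson N).incl ((boson N).ξ c ψ)) a b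
      = inner ℂ ((boson N).incl (centered ψ a)) ((boson N).incl (centered ψ b)) := by
    simp only [centered, map_sub, map_smul]
    rfl
  have him : (boson N).symplectic ψ a b
      = 2 * (inner ℂ ((boson N).incl (centered ψ a)) ((boson N).incl (centered ψ b))).im := by
    rw [← hc]; rfl
  have hre : (boson N).metric ψ a b
      = 2 * (inner ℂ ((boson N).incl (centered ψ a)) ((boson N).incl (centered ψ b))).re := by
    rw [← hc]; rfl
  rw [boson_symplectic h1, Matrix.neg_apply] at him
  apply Complex.ext <;> simp <;> linarith

theorem boson_metric_comm (ψ : BosonCore N) (a b : Fin N ⊕ Fin N) :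
    (boson N).metric ψ a b = (boson N).metric ψ b a := by
  have h : ∀ a b, (boson N).metric ψ a b
      = 2 * (inner ℂ ((boson N).incl (centered ψ a)) ((boson N).incl (centered ψ b))).re := by
    intro a b
    simp only [centered, map_sub, map_smul]
    rfl
  rw [h, h, ← inner_conj_symm, Complex.conj_re]

theorem boson_complexStructure {ψ : BosonCore N} (h1 : ‖(boson N).incl ψ‖ = 1) :
    (boson N).complexStructure ψ = -((boson N).metric ψ * Matrix.J (Fin N) ℝ) := by
  rw [ModeSystem.complexStructure, boson_symplectic h1]
  congr 2
  exact Matrix.inv_eq_right_inv (by rw [neg_mul, Matrix.J_squared, neg_neg])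

theorem J_mul_inl (M : Matrix (Fin N ⊕ Fin N) (Fin N ⊕ Fin N) ℝ) (j : Fin N)
    (b : Fin N ⊕ Fin N) : (Matrix.J (Fin N) ℝ * M) (Sum.inl j) b = -M (Sum.inr j) b := by
  simp [Matrix.mul_apply, Matrix.J, Matrix.one_apply]

theorem J_mul_inr (M : Matrix (Fin N ⊕ Fin N) (Fin N ⊕ Fin N) ℝ) (j : Fin N)
    (b : Fin N ⊕ Fin N) : (Matrix.J (Fin N) ℝ * M) (Sum.inr j) b = M (Sum.inl j) b := by
  simp [Matrix.mul_apply, Matrix.J, Matrix.one_apply]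

/-- The condition `J² = -1` reads `(G J)² = -1` with the standard symplectic `J`; multiplying by `J`
on the right gives the form that also shows `G` to be invertible. -/
theorem metric_J_metric {ψ : BosonCore N} (hψ : ψ ∈ bosonGaussian N) :
    (boson N).metric ψ * Matrix.J (Fin N) ℝ * (boson N).metric ψ
    = Matrix.J (Fin N) ℝ := by
  have h := hψ.2
  rw [boson_complexStructure hψ.1, neg_mul_neg] at h
  set G := (boson N).metric ψ
  set J := Matrix.J (Fin N) ℝ
  have hJ : J * J = -1 := Matrix.J_squared _ _
  calc G * J * G = -(G * J * (G * J) * J) := by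
        rw [mul_assoc (G * J) (G * J) J, mul_assoc G J J, hJ]; simp
    _ = J := by rw [h]; simp

/-- As for fermions: `G J G = J` makes this combination orthogonal to all centered vectors, in whose
span it lies. -/
theorem bosonGaussian_relation {ψ : BosonCore N} (hψ : ψ ∈ bosonGaussian N)
    (b : Fin N ⊕ Fin N) :
    centered ψ b + I • ∑ a, (((Matrix.J (Fin N) ℝ * (boson N).metric ψ) a b : ℝ) : ℂ)
      • centered ψ a = 0 := by
  set x := centered ψ b + I • ∑ a, (((Matrix.J (Fin N) ℝ * (boson N).metric ψ) a b : ℝ) : ℂ)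
      • centered ψ a with hx
  have hGJG := metric_J_metric hψ
  have hi := inner_centered hψ.1
  set G := (boson N).metric ψ
  set J := Matrix.J (Fin N) ℝ
  have hJJG : J * (J * G) = -G := by
    rw [← mul_assoc, Matrix.J_squared, neg_mul, one_mul]
  have horth : ∀ c, inner ℂ ((boson N).incl (centered ψ c)) ((boson N).incl x) = 0 := by
    intro c
    have e1 : ∑ a, (((J * G) a b : ℝ) : ℂ) * ((((G c a : ℝ) : ℂ) - ((J c a : ℝ) : ℂ) * I) / 2)
        = (((J c b : ℝ) : ℂ) + ((G c b : ℝ) : ℂ) * I) / 2 := by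
      have e2 : ∑ a, G c a * (J * G) a b = J c b := by
        rw [← Matrix.mul_apply, ← mul_assoc, hGJG]
      have e3 : ∑ a, J c a * (J * G) a b = -G c b := by
        rw [← Matrix.mul_apply, hJJG, Matrix.neg_apply]
      have e4 : ∀ a, (((J * G) a b : ℝ) : ℂ) * ((((G c a : ℝ) : ℂ) - ((J c a : ℝ) : ℂ) * I) / 2)
          = ((G c a * (J * G) a b : ℝ) : ℂ) * (1 / 2)
            - ((J c a * (J * G) a b : ℝ) : ℂ) * (I / 2) := by
        intro a
        push_cast
        ring
      rw [Finset.sum_congr rfl fun a _ => e4 a, Finset.sum_sub_distrib, ← Finset.sum_mul,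
        ← Finset.sum_mul, ← Complex.ofReal_sum, ← Complex.ofReal_sum, e2, e3]
      push_cast
      ring
    simp only [hx, map_add, map_smul, map_sum, inner_add_right, inner_smul_right, inner_sum, hi]
    rw [e1]
    linear_combination (((G c b : ℝ) : ℂ) / 2) * Complex.I_mul_I
  have hxx : inner ℂ ((boson N).incl x) ((boson N).incl x) = 0 := by
    conv_lhs => arg 2; rw [hx]
    simp only [map_add, map_smul, map_sum, inner_add_left, inner_smul_left, sum_inner, horth,
      mul_zero, Finset.sum_const_zero, add_zero]
  exact boson_incl_injective ((inner_self_eq_zero.1 hxx).trans (map_zero _).symm)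

/-- The covariance of the positions is positive definite. -/
theorem posDef_position_metric {ψ : BosonCore N} (hψ : ψ ∈ bosonGaussian N) :
    ((boson N).metric ψ).toBlocks₁₁.PosDef := by
  rw [Matrix.posDef_iff_dotProduct_mulVec]
  have hi := inner_centered hψ.1
  have hGJG := metric_J_metric hψ
  refine ⟨?_, fun {x} hx => ?_⟩
  · ext j k
    simp [Matrix.toBlocks₁₁, boson_metric_comm ψ (Sum.inl k)]
  set G := (boson N).metric ψ
  set w : BosonCore N := ∑ j, ((x j : ℝ) : ℂ) • centered ψ (Sum.inl j) with hw
  have hJ0 : ∀ j k : Fin N, Matrix.J (Fin N) ℝ (Sum.inl j) (Sum.inl k) = 0 := fun j k => by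
    simp [Matrix.J]
  -- Positions commute, so the symplectic part is absent and the squared norm of `w` is half the
  -- quadratic form.
  have hval : inner ℂ ((boson N).incl w) ((boson N).incl w)
      = ((star x ⬝ᵥ G.toBlocks₁₁ *ᵥ x / 2 : ℝ) : ℂ) := by
    simp only [hw, map_sum, map_smul, sum_inner, inner_sum, inner_smul_left, inner_smul_right, hi,
      Complex.conj_ofReal, hJ0, dotProduct, Matrix.mulVec, Matrix.toBlocks₁₁, Matrix.of_apply,
      star_trivial, Complex.ofReal_zero, zero_mul, sub_zero]
    push_cast
    rw [Finset.sum_div]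
    refine Finset.sum_congr rfl fun j _ => ?_
    rw [Finset.mul_sum, Finset.mul_sum, Finset.sum_div]
    refine Finset.sum_congr rfl fun k _ => ?_
    have hjk : G (Sum.inl k) (Sum.inl j) = G (Sum.inl j) (Sum.inl k) := boson_metric_comm ψ _ _
    rw [hjk]
    ring
  rw [inner_self_eq_norm_sq_to_K] at hval
  have hval' : ‖(boson N).incl w‖ ^ 2 = star x ⬝ᵥ G.toBlocks₁₁ *ᵥ x / 2 := by
    refine Complex.ofReal_injective ?_
    rw [← hval]
    push_cast
    rfl
  have hnn : 0 ≤ star x ⬝ᵥ G.toBlocks₁₁ *ᵥ x := by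
    have := sq_nonneg ‖(boson N).incl w‖
    linarith
  refine lt_of_le_of_ne hnn fun h0 => hx ?_
  have hw0 : (boson N).incl w = 0 := by
    rw [← h0, zero_div] at hval'
    exact norm_eq_zero.1 (pow_eq_zero_iff two_ne_zero |>.1 hval')
  -- If the form vanishes at `x`, then `w = 0`; pairing with all centered vectors puts `(x, 0)` into
  -- the kernel of `G`, which is trivial by `G J G = J`.
  have hG0 : G *ᵥ (Sum.elim x 0) = 0 := by
    funext c
    have h2 : inner ℂ ((boson N).incl (centered ψ c)) ((boson N).incl w) = 0 := by
      rw [hw0, inner_zero_right]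
    simp only [hw, map_sum, map_smul, inner_sum, inner_smul_right, hi] at h2
    have h3 := congrArg Complex.re h2
    simp only [Complex.re_sum, Complex.re_ofReal_mul, Complex.zero_re] at h3
    have h4 : ∀ j : Fin N, ((((G c (Sum.inl j) : ℝ) : ℂ)
        - ((Matrix.J (Fin N) ℝ c (Sum.inl j) : ℝ) : ℂ) * I) / 2).re = G c (Sum.inl j) / 2 := by
      intro j
      simp
    simp only [h4] at h3
    simp only [Matrix.mulVec, dotProduct, Fintype.sum_sum_type, Sum.elim_inl, Sum.elim_inr,
      Pi.zero_apply, mul_zero, Finset.sum_const_zero, add_zero]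
    have h5 : ∑ j, G c (Sum.inl j) * x j = 2 * ∑ j, x j * (G c (Sum.inl j) / 2) := by
      rw [Finset.mul_sum]
      exact Finset.sum_congr rfl fun j _ => by ring
    rw [h5, h3, mul_zero]
  have hdet : G * -(Matrix.J (Fin N) ℝ * G * Matrix.J (Fin N) ℝ) = 1 := by
    rw [mul_neg, ← mul_assoc, ← mul_assoc, hGJG, Matrix.J_squared, neg_neg]
  have hinv := mul_eq_one_comm.1 hdet
  have h6 : (Sum.elim x 0 : Fin N ⊕ Fin N → ℝ) = 0 := by
    rw [← Matrix.one_mulVec (Sum.elim x 0), ← hinv, ← Matrix.mulVec_mulVec, hG0,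
      Matrix.mulVec_zero]
  funext j
  exact congrFun h6 (Sum.inl j)

/-- By homogeneity `δ` can be the minimum on the compact unit sphere; any constant works when the
sphere is empty. -/
theorem exists_pos_quadratic {A : Matrix (Fin N) (Fin N) ℝ} (hA : A.PosDef) :
    ∃ δ > 0, ∀ x : Conf N, δ * ‖x‖ ^ 2 ≤ ∑ m, ∑ k, x m * x k * A k m := by
  set q : Conf N → ℝ := fun x => ∑ m, ∑ k, x m * x k * A k m with hq
  have hpos : ∀ x : Conf N, x ≠ 0 → 0 < q x := by
    intro x hx
    have h := ((Matrix.posDef_iff_dotProduct_mulVec).1 hA).2 (x := x.ofLp)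
      (by simpa using hx)
    have h2 : star x.ofLp ⬝ᵥ A *ᵥ x.ofLp = q x := by
      simp only [dotProduct, Matrix.mulVec, star_trivial, hq, Finset.mul_sum]
      rw [Finset.sum_comm]
      exact Finset.sum_congr rfl fun m _ => Finset.sum_congr rfl fun k _ => by ring
    rwa [h2] at h
  have hhom : ∀ (r : ℝ) (x : Conf N), q (r • x) = r ^ 2 * q x := by
    intro r x
    simp only [hq, PiLp.smul_apply, smul_eq_mul, Finset.mul_sum]
    exact Finset.sum_congr rfl fun m _ => Finset.sum_congr rfl fun k _ => by ring
  have hcont : Continuous q := by fun_prop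
  by_cases hne : (Metric.sphere (0 : Conf N) 1).Nonempty
  · obtain ⟨y, hy, hmin⟩ := (isCompact_sphere (0 : Conf N) 1).exists_isMinOn hne hcont.continuousOn
    have hy0 : y ≠ 0 := by
      rintro rfl
      simp at hy
    refine ⟨q y, hpos y hy0, fun x => ?_⟩
    by_cases hx : x = 0
    · simp [hx]
    · have hxn : ‖x‖ ≠ 0 := norm_ne_zero_iff.2 hx
      have h1 : q y ≤ q (‖x‖⁻¹ • x) := hmin (by simp [norm_smul, hxn])
      have h2 : q x = ‖x‖ ^ 2 * q (‖x‖⁻¹ • x) := by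
        rw [hhom, ← mul_assoc, inv_pow, mul_inv_cancel₀ (pow_ne_zero 2 hxn), one_mul]
      show q y * ‖x‖ ^ 2 ≤ q x
      rw [h2, mul_comm]
      exact mul_le_mul_of_nonneg_left h1 (sq_nonneg _)
  · refine ⟨1, one_pos, fun x => ?_⟩
    by_cases hx : x = 0
    · simp [hx]
    · exact absurd ⟨‖x‖⁻¹ • x, by simp [norm_smul, norm_ne_zero_iff.2 hx]⟩ hne

/-- A Gaussian state is annihilated by `i p_m - ∑ₖ B_{mk} q_k - c_m`, where `Re B` is negative
definite. -/
theorem exists_annihilation {ψ : BosonCore N} (hψ : ψ ∈ bosonGaussian N) :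
    ∃ (B : Matrix (Fin N) (Fin N) ℂ) (c : Fin N → ℂ),
    (∀ m, I • momentum N m ψ = ∑ k, B m k • position N k ψ + c m • ψ) ∧
    ∃ δ > 0, ∀ x : Conf N, ∑ m, ∑ k, x m * x k * (B m k).re ≤ -δ * ‖x‖ ^ 2 := by
  have hA := posDef_position_metric hψ
  set G := (boson N).metric ψ with hG
  set A := G.toBlocks₁₁ with hAdef
  have hAu : IsUnit A.det := (Matrix.isUnit_iff_isUnit_det A).1 hA.isUnit
  have hAA : ∀ j m, ∑ l, A j l * A⁻¹ l m = if j = m then 1 else 0 := by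
    intro j m
    rw [← Matrix.mul_apply, Matrix.mul_nonsing_inv _ hAu, Matrix.one_apply]
  -- This solves the position rows of `bosonGaussian_relation` for `i p_m`: their momentum
  -- coefficients form the position covariance `A`, inverted by contraction with `A⁻¹`. The real
  -- part of `B` is the negative transpose of `A⁻¹`, hence negative definite.
  set B : Matrix (Fin N) (Fin N) ℂ := fun m k => -((A⁻¹ k m : ℝ) : ℂ)
    + I * ((∑ l, G (Sum.inr k) (Sum.inl l) * A⁻¹ l m : ℝ) : ℂ) with hB
  have hcent : ∀ m, I • centered ψ (Sum.inr m) = ∑ k, B m k • centered ψ (Sum.inl k) := by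
    intro m
    have hrel : ∀ l, centered ψ (Sum.inl l)
        - I • ∑ k, ((G (Sum.inr k) (Sum.inl l) : ℝ) : ℂ) • centered ψ (Sum.inl k)
        + I • ∑ j, ((A j l : ℝ) : ℂ) • centered ψ (Sum.inr j) = 0 := by
      intro l
      have h := bosonGaussian_relation hψ (Sum.inl l)
      rw [Fintype.sum_sum_type] at h
      simp only [J_mul_inl, J_mul_inr] at h
      rw [← h]
      simp only [Complex.ofReal_neg, neg_smul, Finset.sum_neg_distrib, smul_add, smul_neg]
      simp only [hAdef, Matrix.toBlocks₁₁, Matrix.of_apply, hG]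
      abel
    have hsum : ∑ l, ((A⁻¹ l m : ℝ) : ℂ) • (centered ψ (Sum.inl l)
        - I • ∑ k, ((G (Sum.inr k) (Sum.inl l) : ℝ) : ℂ) • centered ψ (Sum.inl k)
        + I • ∑ j, ((A j l : ℝ) : ℂ) • centered ψ (Sum.inr j)) = 0 := by
      simp only [hrel, smul_zero, Finset.sum_const_zero]
    have e1 : ∑ l, ((A⁻¹ l m : ℝ) : ℂ) • I • ∑ j, ((A j l : ℝ) : ℂ) • centered ψ (Sum.inr j)
        = I • centered ψ (Sum.inr m) := by
      have : ∀ l, ((A⁻¹ l m : ℝ) : ℂ) • I • ∑ j, ((A j l : ℝ) : ℂ) • centered ψ (Sum.inr j)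
          = I • ∑ j, ((A j l * A⁻¹ l m : ℝ) : ℂ) • centered ψ (Sum.inr j) := by
        intro l
        rw [smul_comm, Finset.smul_sum]
        simp only [smul_smul, Complex.ofReal_mul, mul_comm]
      rw [Finset.sum_congr rfl fun l _ => this l, ← Finset.smul_sum, Finset.sum_comm]
      simp only [← Finset.sum_smul, ← Complex.ofReal_sum, hAA]
      congr 1
      rw [Finset.sum_eq_single m]
      · simp
      · intro j _ hj
        simp [hj]
      · simp
    have e2 : ∑ l, ((A⁻¹ l m : ℝ) : ℂ) • I
        • ∑ k, ((G (Sum.inr k) (Sum.inl l) : ℝ) : ℂ) • centered ψ (Sum.inl k)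
        = ∑ k, (I * ((∑ l, G (Sum.inr k) (Sum.inl l) * A⁻¹ l m : ℝ) : ℂ))
          • centered ψ (Sum.inl k) := by
      simp only [Finset.smul_sum, smul_smul, Complex.ofReal_sum, Finset.mul_sum, Finset.sum_smul]
      rw [Finset.sum_comm]
      refine Finset.sum_congr rfl fun k _ => Finset.sum_congr rfl fun l _ => ?_
      congr 1
      push_cast
      ring
    simp only [smul_add, smul_sub, Finset.sum_add_distrib, Finset.sum_sub_distrib, e1, e2] at hsum
    rw [eq_neg_of_add_eq_zero_right hsum]
    simp only [hB, add_smul, neg_smul, Finset.sum_add_distrib, Finset.sum_neg_distrib]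
    abel
  refine ⟨B, fun m => I * (boson N).displacement ψ (Sum.inr m)
    - ∑ k, B m k * (boson N).displacement ψ (Sum.inl k), fun m => ?_, ?_⟩
  · have h := hcent m
    have hp : (boson N).ξ (Sum.inr m) ψ = momentum N m ψ := rfl
    have hq : ∀ k, (boson N).ξ (Sum.inl k) ψ = position N k ψ := fun _ => rfl
    simp only [centered, hp, hq, smul_sub, smul_smul, Finset.sum_sub_distrib,
      ← Finset.sum_smul] at h
    rw [sub_eq_iff_eq_add.1 h, sub_smul]
    abel
  · obtain ⟨δ, hδ, h⟩ := exists_pos_quadratic hA.inv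
    refine ⟨δ, hδ, fun x => ?_⟩
    have h2 : ∀ m k, (B m k).re = -A⁻¹ k m := by
      intro m k
      simp only [hB, Complex.add_re, Complex.neg_re, Complex.ofReal_re, Complex.mul_re,
        Complex.I_re, Complex.I_im, Complex.ofReal_im]
      ring
    simp only [h2, mul_neg, Finset.sum_neg_distrib]
    have := h x
    linarith

/-- Here `G = Ω' (T J T⁻¹)`; in the square of `G J` the middle factors `J Ω'` cancel, and the
conjugated `J` squares to `-1`. -/
theorem neg_one_of_intertwine {n : Type*} [Fintype n] [DecidableEq n] {G Ω' T J : Matrix n n ℝ}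
    (hT : IsUnit T.det) (hJ : J * J = -1) (hΩ : Ω' * J = 1) (hG : G * T = Ω' * T * J) :
    G * J * (G * J) = -1 := by
  have hJΩ : J * Ω' = 1 := mul_eq_one_comm.1 hΩ
  have hG' : G = Ω' * T * J * T⁻¹ := by
    rw [← hG, mul_assoc, Matrix.mul_nonsing_inv _ hT, mul_one]
  calc G * J * (G * J) = Ω' * T * J * (T⁻¹ * (J * Ω') * T) * J * T⁻¹ * J := by
        rw [hG']; noncomm_ring
    _ = Ω' * T * (J * J) * T⁻¹ * J := by
        rw [hJΩ, mul_one, Matrix.nonsing_inv_mul _ hT, mul_one, mul_assoc (Ω' * T)]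
    _ = -(Ω' * (T * T⁻¹) * J) := by rw [hJ]; noncomm_ring
    _ = -1 := by rw [Matrix.mul_nonsing_inv _ hT, mul_one, hΩ]

/-- The hypotheses are the real and imaginary parts of the annihilation equations paired with the
centered vectors; the block form supplies the intertwiner `T` of `neg_one_of_intertwine`. -/
theorem mul_fromBlocks_eq {n : Type*} [Fintype n] [DecidableEq n] {G Ω' : Matrix (n ⊕ n) (n ⊕ n) ℝ}
    {R Y : Matrix n n ℝ}
    (h1 : ∀ a m, -Ω' a (Sum.inr m)
      = ∑ k, (R k m * G a (Sum.inl k) - Y k m * Ω' a (Sum.inl k)))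
    (h2 : ∀ a m, G a (Sum.inr m)
      = ∑ k, (R k m * Ω' a (Sum.inl k) + Y k m * G a (Sum.inl k))) :
    G * Matrix.fromBlocks R Y 0 (-1 : Matrix n n ℝ)
      = Ω' * Matrix.fromBlocks Y (-R) (-1 : Matrix n n ℝ) 0 := by
  ext a m
  rcases m with m | m
  · have h := h1 a m
    rw [Finset.sum_sub_distrib] at h
    simp only [Matrix.mul_apply, Fintype.sum_sum_type, Matrix.fromBlocks_apply₁₁,
      Matrix.fromBlocks_apply₂₁, Matrix.zero_apply, mul_zero, Finset.sum_const_zero, add_zero,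
      Matrix.neg_apply, Matrix.one_apply, mul_neg, mul_ite, mul_one, Finset.sum_neg_distrib,
      Finset.sum_ite_eq', Finset.mem_univ, if_true, mul_comm (G a _) (R _ _),
      mul_comm (Ω' a _) (Y _ _)]
    linarith
  · have h := h2 a m
    rw [Finset.sum_add_distrib] at h
    simp only [Matrix.mul_apply, Fintype.sum_sum_type, Matrix.fromBlocks_apply₁₂,
      Matrix.fromBlocks_apply₂₂, Matrix.zero_apply, mul_zero, Finset.sum_const_zero, add_zero,
      Matrix.neg_apply, Matrix.one_apply, mul_neg, mul_ite, mul_one, Finset.sum_neg_distrib,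
      Finset.sum_ite_eq', Finset.mem_univ, if_true, mul_comm (G a _) (Y _ _),
      mul_comm (Ω' a _) (R _ _)]
    linarith

/-- A unit vector annihilated by all `i p_m - ∑ₖ B_{mk} q_k - c_m` with `Re B` negative definite is
Gaussian. -/
theorem mem_bosonGaussian {φ : BosonCore N} (h1 : ‖(boson N).incl φ‖ = 1)
    {B : Matrix (Fin N) (Fin N) ℂ} {c : Fin N → ℂ}
    (hB : ∀ m, I • momentum N m φ = ∑ k, B m k • position N k φ + c m • φ)
    (hneg : ∀ x : Conf N, x ≠ 0 → ∑ m, ∑ k, x m * x k * (B m k).re < 0) :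
    φ ∈ bosonGaussian N := by
  have hi := inner_centered h1
  set G := (boson N).metric φ
  have hn : inner ℂ ((boson N).incl φ) ((boson N).incl φ) = 1 := by
    rw [inner_self_eq_norm_sq_to_K, h1]
    simp
  have hz : ∀ a, inner ℂ ((boson N).incl φ) ((boson N).incl ((boson N).ξ a φ))
      = ((boson N).displacement φ a : ℂ) := by
    intro a
    refine Complex.ext rfl ?_
    have h := (boson_isHermitian a).im_expect φ
    rw [boson_isHermitian a] at h
    rw [h, Complex.ofReal_im]
  have hp : ∀ m, (boson N).ξ (Sum.inr m) φ = momentum N m φ := fun _ => rfl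
  have hq : ∀ k, (boson N).ξ (Sum.inl k) φ = position N k φ := fun _ => rfl
  have hc : ∀ m, I * ((boson N).displacement φ (Sum.inr m) : ℂ)
      = ∑ k, B m k * ((boson N).displacement φ (Sum.inl k) : ℂ) + c m := by
    intro m
    have h := congrArg (fun x => inner ℂ ((boson N).incl φ) ((boson N).incl x)) (hB m)
    simp only [map_smul, map_add, map_sum, inner_smul_right, inner_add_right, inner_sum, ← hp,
      ← hq, hz, hn, mul_one] at h
    exact h
  have hcent : ∀ m, I • centered φ (Sum.inr m) = ∑ k, B m k • centered φ (Sum.inl k) := by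
    intro m
    simp only [centered, hp, hq, smul_sub, smul_smul, Finset.sum_sub_distrib, ← Finset.sum_smul,
      hB, hc, add_smul]
    abel
  have hentry : ∀ a m, (-(-Matrix.J (Fin N) ℝ) a (Sum.inr m)
        = ∑ k, ((B m k).re * G a (Sum.inl k)
          - (B m k).im * (-Matrix.J (Fin N) ℝ) a (Sum.inl k))) ∧
      (G a (Sum.inr m) = ∑ k, ((B m k).re * (-Matrix.J (Fin N) ℝ) a (Sum.inl k)
        + (B m k).im * G a (Sum.inl k))) := by
    intro a m
    have h := congrArg (fun x => inner ℂ ((boson N).incl (centered φ a)) ((boson N).incl x))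
      (hcent m)
    simp only [map_smul, map_sum, inner_smul_right, inner_sum, hi] at h
    have hre := congrArg Complex.re h
    have him := congrArg Complex.im h
    have hdre : ∀ (z : ℂ) (x y : ℝ), (z * (((x : ℂ) - (y : ℂ) * I) / 2)).re
        = (z.re * x + z.im * y) / 2 := by
      intro z x y
      simp [Complex.mul_re]
      ring
    have hdim : ∀ (z : ℂ) (x y : ℝ), (z * (((x : ℂ) - (y : ℂ) * I) / 2)).im
        = (z.im * x - z.re * y) / 2 := by
      intro z x y
      simp [Complex.mul_im]
      ring
    simp only [Complex.re_sum, Complex.im_sum, hdre, hdim, ← Finset.sum_div, Complex.I_re,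
      Complex.I_im] at hre him
    simp only [Matrix.neg_apply, mul_neg, sub_neg_eq_add, neg_neg]
    constructor
    · linarith
    · simp only [neg_add_eq_sub]
      linarith
  refine ⟨h1, ?_⟩
  rw [boson_complexStructure h1, neg_mul_neg]
  set R : Matrix (Fin N) (Fin N) ℝ := fun k m => (B m k).re with hR
  set Y : Matrix (Fin N) (Fin N) ℝ := fun k m => (B m k).im with hY
  -- A kernel vector of `R` would make the negative definite form of `Re B` vanish.
  have hRdet : IsUnit R.det := by
    rw [isUnit_iff_ne_zero]
    intro h0
    obtain ⟨x, hx, hxR⟩ := Matrix.exists_mulVec_eq_zero_iff.2 h0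
    have h2 := hneg (WithLp.toLp 2 x) (by simpa using hx)
    have h3 : ∑ m, ∑ k, (WithLp.toLp 2 x : Conf N) m * (WithLp.toLp 2 x : Conf N) k * (B m k).re
        = ∑ k, x k * (R *ᵥ x) k := by
      simp only [Matrix.mulVec, dotProduct, hR, Finset.mul_sum]
      rw [Finset.sum_comm]
      exact Finset.sum_congr rfl fun m _ => Finset.sum_congr rfl fun k _ => by ring
    rw [h3, hxR] at h2
    simp at h2
  refine neg_one_of_intertwine (Ω' := -Matrix.J (Fin N) ℝ) 
    (T := Matrix.fromBlocks R Y 0 (-1 : Matrix (Fin N) (Fin N) ℝ)) ?_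
    (Matrix.J_squared _ _) (by rw [neg_mul, Matrix.J_squared, neg_neg]) ?_
  · rw [Matrix.det_fromBlocks_zero₂₁]
    refine hRdet.mul ?_
    rw [isUnit_iff_ne_zero, Matrix.det_neg, Matrix.det_one]
    simp
  · have hTJ : Matrix.fromBlocks R Y 0 (-1 : Matrix (Fin N) (Fin N) ℝ) * Matrix.J (Fin N) ℝ
        = Matrix.fromBlocks Y (-R) (-1) 0 := by
      simp [Matrix.J, Matrix.fromBlocks_multiply]
    rw [mul_assoc, hTJ]
    exact mul_fromBlocks_eq (fun a m => (hentry a m).1) fun a m => (hentry a m).2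

end Boson

end GaussianProjection
end

/-! ### Wave functions with affine logarithmic derivative -/

noncomputable section

namespace GaussianProjection

open Filter Topology Complex

section Boson

variable {N : ℕ}

/-! ### Schwartz functions with Gaussian decay -/

/-- Combines `r ^ k ≤ k! exp r` with completing the square in `r - δ r²`. -/
theorem pow_mul_exp_neg_le (k : ℕ) {δ : ℝ} (hδ : 0 < δ) {r : ℝ} (hr : 0 ≤ r) :
    r ^ k * Real.exp (-δ * r ^ 2) ≤ k.factorial * Real.exp (1 / (4 * δ)) := by
  have h1 : r ^ k ≤ k.factorial * Real.exp r := by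
    have h := Real.pow_div_factorial_le_exp r hr k
    rwa [div_le_iff₀ (by positivity), mul_comm] at h
  calc r ^ k * Real.exp (-δ * r ^ 2) ≤ k.factorial * Real.exp r * Real.exp (-δ * r ^ 2) := by
        gcongr
    _ = k.factorial * Real.exp (r + -δ * r ^ 2) := by rw [mul_assoc, Real.exp_add]
    _ ≤ k.factorial * Real.exp (1 / (4 * δ)) := by
        gcongr
        rw [le_div_iff₀ (by positivity)]
        nlinarith [sq_nonneg (2 * δ * r - 1)]

/-- A function of Gaussian decay whose logarithmic derivative has temperate growth is a Schwartz
function. -/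
theorem exists_schwartz {g : Conf N → ℂ} {l : Conf N → Conf N →L[ℝ] ℂ}
    (hg : ∀ x, HasFDerivAt g (g x • l x) x) (hl : l.HasTemperateGrowth) {C δ : ℝ} (hδ : 0 < δ)
    (hb : ∀ x, ‖g x‖ ≤ C * Real.exp (-δ * ‖x‖ ^ 2)) : ∃ f : BosonCore N, ∀ x, f x = g x := by
  have hfd : fderiv ℝ g = fun x => g x • l x := funext fun x => (hg x).fderiv
  have hdiff : Differentiable ℝ g := fun x => (hg x).differentiableAt
  have hsm : ∀ n : ℕ, ContDiff ℝ n g := by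
    intro n
    induction n with
    | zero => exact contDiff_zero.2 hdiff.continuous
    | succ n ih =>
      rw [Nat.cast_succ]
      refine contDiff_succ_iff_fderiv.2 ⟨hdiff, fun h => absurd h (by simp), ?_⟩
      rw [hfd]
      exact ih.smul (hl.1.of_le (by exact_mod_cast le_top))
  have hC : 0 ≤ C := by
    exact nonneg_of_mul_nonneg_left ((norm_nonneg _).trans (hb 0)) (Real.exp_pos _)
  have hdec : ∀ n k : ℕ, ∃ M : ℝ, ∀ x, ‖x‖ ^ k * ‖iteratedFDeriv ℝ n g x‖ ≤ M := by
    intro n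
    induction n using Nat.strong_induction_on with
    | _ n ih =>
      rcases n with _ | n
      · intro k
        refine ⟨C * (k.factorial * Real.exp (1 / (4 * δ))), fun x => ?_⟩
        rw [norm_iteratedFDeriv_zero]
        calc ‖x‖ ^ k * ‖g x‖ ≤ ‖x‖ ^ k * (C * Real.exp (-δ * ‖x‖ ^ 2)) := by
              gcongr
              exact hb x
          _ = C * (‖x‖ ^ k * Real.exp (-δ * ‖x‖ ^ 2)) := by ring
          _ ≤ _ := by
              exact mul_le_mul_of_nonneg_left (pow_mul_exp_neg_le k hδ (norm_nonneg x)) hC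
      · intro k
        -- The derivative of order `n + 1` of `g` is the one of order `n` of `g • l`. By Leibniz it
        -- involves only lower derivatives of `g`, and the growth of `l` is paid for by raising the
        -- weight from `k` to `p + k`.
        obtain ⟨p, K, hK, hlK⟩ := hl.norm_iteratedFDeriv_le_uniform n
        choose! M hM using fun i (hi : i < n + 1) => ih i hi
        refine ⟨∑ i ∈ Finset.range (n + 1), (n.choose i : ℝ)
          * (K * 2 ^ (p - 1) * (M i k + M i (p + k))), fun x => ?_⟩
        rw [← norm_iteratedFDeriv_fderiv, hfd]
        have h1 := norm_iteratedFDeriv_smul_le (N := n) (hsm n)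
          (hl.1.of_le (by exact_mod_cast le_top) : ContDiff ℝ n l) x le_rfl
        calc ‖x‖ ^ k * ‖iteratedFDeriv ℝ n (fun x => g x • l x) x‖
            ≤ ‖x‖ ^ k * ∑ i ∈ Finset.range (n + 1), (n.choose i : ℝ)
              * ‖iteratedFDeriv ℝ i g x‖ * ‖iteratedFDeriv ℝ (n - i) l x‖ := by
              gcongr
          _ = ∑ i ∈ Finset.range (n + 1), (n.choose i : ℝ) * (‖x‖ ^ k
              * (‖iteratedFDeriv ℝ i g x‖ * ‖iteratedFDeriv ℝ (n - i) l x‖)) := by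
              rw [Finset.mul_sum]
              exact Finset.sum_congr rfl fun i _ => by ring
          _ ≤ _ := by
              refine Finset.sum_le_sum fun i hi => ?_
              have hi' : i < n + 1 := Finset.mem_range.1 hi
              refine mul_le_mul_of_nonneg_left ?_ (by positivity)
              have h2 := hM i hi' k x
              have h3 := hM i hi' (p + k) x
              have h4 : (1 + ‖x‖) ^ p ≤ 2 ^ (p - 1) * (1 + ‖x‖ ^ p) := by
                simpa using add_pow_le (zero_le_one (α := ℝ)) (norm_nonneg x) p
              calc ‖x‖ ^ k * (‖iteratedFDeriv ℝ i g x‖ * ‖iteratedFDeriv ℝ (n - i) l x‖)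
                  ≤ ‖x‖ ^ k * (‖iteratedFDeriv ℝ i g x‖
                    * (K * (2 ^ (p - 1) * (1 + ‖x‖ ^ p)))) := by
                    gcongr
                    refine (hlK (n - i) (Nat.sub_le n i) x).trans ?_
                    gcongr
                _ = K * 2 ^ (p - 1) * (‖x‖ ^ k * ‖iteratedFDeriv ℝ i g x‖
                    + ‖x‖ ^ (p + k) * ‖iteratedFDeriv ℝ i g x‖) := by
                    rw [pow_add]
                    ring
                _ ≤ _ := by gcongr
  refine ⟨⟨g, contDiff_infty.2 hsm, fun k n => hdec n k⟩, fun x => rfl⟩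

/-! ### The wave function of a Gaussian state -/

theorem clm_conf_ext {T T' : Conf N →L[ℝ] ℂ}
    (h : ∀ m, T (EuclideanSpace.single m 1) = T' (EuclideanSpace.single m 1)) : T = T' := by
  have h2 : T.toLinearMap = T'.toLinearMap := by
    refine (EuclideanSpace.basisFun (Fin N) ℝ).toBasis.ext fun m => ?_
    simpa using h m
  exact ContinuousLinearMap.ext fun x => LinearMap.congr_fun h2 x

/-- Since `i p_m` is the partial derivative along `m`, the annihilation equations are a first-order
system with affine coefficients. -/
theorem exists_hasFDerivAt_of_mem_bosonGaussian {ψ : BosonCore N} (hψ : ψ ∈ bosonGaussian N) :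
    ∃ (L : Conf N →L[ℝ] Conf N →L[ℝ] ℂ) (c : Conf N →L[ℝ] ℂ),
      (∀ x, HasFDerivAt ψ (ψ x • (L x + c)) x) ∧ ∃ δ > 0, ∀ x, (L x x).re ≤ -δ * ‖x‖ ^ 2 := by
  obtain ⟨B, b, hB, δ, hδ, hneg⟩ := exists_annihilation hψ
  let P : Fin N → Conf N →L[ℝ] ℂ := fun j =>
    Complex.ofRealCLM.comp (EuclideanSpace.proj (𝕜 := ℝ) j)
  have hP : ∀ j x, P j x = (x j : ℂ) := fun j x => rfl
  let L : Conf N →L[ℝ] Conf N →L[ℝ] ℂ :=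
    ∑ m, ∑ k, (EuclideanSpace.proj (𝕜 := ℝ) k : Conf N →L[ℝ] ℝ).smulRight (B m k • P m)
  have hL : ∀ x y, L x y = ∑ m, ∑ k, B m k * x k * y m := by
    intro x y
    simp only [L, sum_apply, ContinuousLinearMap.smulRight_apply,
      smul_apply, hP, PiLp.proj_apply, Complex.real_smul, smul_eq_mul]
    exact Finset.sum_congr rfl fun m _ => Finset.sum_congr rfl fun k _ => by ring
  refine ⟨L, ∑ m, b m • P m, fun x => ?_, δ, hδ, fun x => ?_⟩
  · have h : fderiv ℝ ψ x = ψ x • (L x + ∑ m, b m • P m) := by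
      refine clm_conf_ext fun m => ?_
      have h1 := congrArg (fun f : BosonCore N => f x) (hB m)
      simp only [smul_apply, add_apply, sum_apply, momentum_apply, position_apply,
        smul_eq_mul] at h1
      have h2 : L x (EuclideanSpace.single m 1) = ∑ k, B m k * x k := by
        rw [hL, Finset.sum_eq_single m]
        · simp
        · intro j _ hj
          simp [hj]
        · simp
      have h3 : ∑ j, b j * P j (EuclideanSpace.single m 1) = b m := by
        rw [Finset.sum_eq_single m]
        · simp [hP]
        · intro j _ hj
          simp [hP, hj]
        · simp
      simp only [smul_apply, add_apply, sum_apply, smul_eq_mul, h2, h3]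
      rw [mul_add, Finset.mul_sum]
      have h4 : ∑ k, ψ x * (B m k * x k) = ∑ k, B m k * (x k * ψ x) :=
        Finset.sum_congr rfl fun k _ => by ring
      rw [h4]
      linear_combination h1 + fderiv ℝ ψ x (EuclideanSpace.single m 1) * Complex.I_mul_I
    rw [← h]
    exact (ψ.differentiableAt (x := x)).hasFDerivAt
  · refine le_trans (le_of_eq ?_) (hneg x)
    rw [hL]
    simp only [Complex.re_sum]
    refine Finset.sum_congr rfl fun m _ => Finset.sum_congr rfl fun k _ => ?_
    simp
    ring

theorem mem_bosonGaussian_of_hasFDerivAt {φ : BosonCore N} (h1 : ‖(boson N).incl φ‖ = 1)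
    {L : Conf N →L[ℝ] Conf N →L[ℝ] ℂ} {c : Conf N →L[ℝ] ℂ}
    (hφ : ∀ x, HasFDerivAt φ (φ x • (L x + c)) x) (hneg : ∀ x, x ≠ 0 → (L x x).re < 0) :
    φ ∈ bosonGaussian N := by
  have hexp : ∀ x : Conf N, x = ∑ k, x k • EuclideanSpace.single k (1 : ℝ) := by
    intro x
    ext j
    simp [Finset.sum_apply, Pi.single_apply]
  refine mem_bosonGaussian h1 (B := fun m k => L (EuclideanSpace.single k 1)
    (EuclideanSpace.single m 1)) (c := fun m => c (EuclideanSpace.single m 1)) (fun m => ?_)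
    fun x hx => ?_
  · ext x
    simp only [smul_apply, add_apply, sum_apply, momentum_apply, position_apply, smul_eq_mul,
      (hφ x).fderiv]
    have h2 : L x (EuclideanSpace.single m 1) = ∑ k, L (EuclideanSpace.single k 1)
        (EuclideanSpace.single m 1) * x k := by
      conv_lhs => rw [hexp x]
      simp only [map_sum, map_smul, sum_apply, smul_apply, Complex.real_smul]
      exact Finset.sum_congr rfl fun k _ => by ring
    rw [h2]
    have h3 : ∑ k, L (EuclideanSpace.single k 1) (EuclideanSpace.single m 1) * (x k * φ x)
        = (∑ k, L (EuclideanSpace.single k 1) (EuclideanSpace.single m 1) * x k) * φ x := by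
      rw [Finset.sum_mul]
      exact Finset.sum_congr rfl fun k _ => by ring
    rw [h3]
    generalize ∑ k, L (EuclideanSpace.single k 1) (EuclideanSpace.single m 1) * (x k : ℂ) = z
    linear_combination (-(φ x * (z + c (EuclideanSpace.single m 1)))) * Complex.I_mul_I
  · refine lt_of_eq_of_lt ?_ (hneg x hx)
    conv_rhs => rw [hexp x]
    simp only [map_sum, map_smul, sum_apply, smul_apply, Complex.real_smul,
      Complex.re_sum, Complex.re_ofReal_mul]
    refine Finset.sum_congr rfl fun m _ => ?_
    rw [Finset.mul_sum]
    refine Finset.sum_congr rfl fun k _ => ?_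
    ring

/-- Gaussian decay of a function with logarithmic derivative `L x + c`. -/
theorem exists_gaussian_bound {g : Conf N → ℂ} {L : Conf N →L[ℝ] Conf N →L[ℝ] ℂ}
    {c : Conf N →L[ℝ] ℂ} (hg : ∀ x, HasFDerivAt g (g x • (L x + c)) x) {δ : ℝ} (hδ : 0 < δ)
    (hneg : ∀ x, (L x x).re ≤ -δ * ‖x‖ ^ 2) :
    ∃ C, 0 ≤ C ∧ ∀ x, ‖g x‖ ≤ C * Real.exp (-(δ / 4) * ‖x‖ ^ 2) := by
  have hformula : ∀ x, g x = g 0 * Complex.exp (L x x / 2 + c x) := by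
    intro x
    -- Along the ray through `x`, `g` is divided by the expected exponential; the quotient has
    -- derivative zero.
    set F : ℝ → ℂ := fun s => g (s • x) * Complex.exp (-((s : ℂ) ^ 2 * (L x x / 2) + s * c x))
      with hF
    have hderiv : ∀ s, HasDerivAt F 0 s := by
      intro s
      have h1 : HasDerivAt (fun s : ℝ => g (s • x)) (g (s • x) * (s * L x x + c x)) s := by
        have h2 : HasDerivAt (fun s : ℝ => s • x) x s := by
          simpa using (hasDerivAt_id s).smul_const x
        have h3 := (hg (s • x)).comp_hasDerivAt s h2
        refine hasDerivAt_of_eq h3 (fun _ => rfl) ?_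
        simp [Complex.real_smul]
        ring
      have h4 : HasDerivAt (fun s : ℝ => Complex.exp (-((s : ℂ) ^ 2 * (L x x / 2) + s * c x)))
          (Complex.exp (-((s : ℂ) ^ 2 * (L x x / 2) + s * c x)) * -(s * L x x + c x)) s := by
        have h5 : HasDerivAt (fun s : ℝ => (s : ℂ)) 1 s := Complex.ofRealCLM.hasDerivAt
        have h6 := (((h5.pow 2).mul_const (L x x / 2)).add (h5.mul_const (c x))).neg.cexp
        refine hasDerivAt_of_eq h6 (fun _ => rfl) ?_
        simp
        ring
      refine hasDerivAt_of_eq (h1.mul h4) (fun _ => rfl) ?_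
      ring
    have hconst := is_const_of_deriv_eq_zero (fun s => (hderiv s).differentiableAt)
      (fun s => (hderiv s).deriv) 1 0
    simp only [hF, one_smul, zero_smul, Complex.ofReal_one, Complex.ofReal_zero, one_pow, one_mul,
      zero_mul, ne_eq, OfNat.ofNat_ne_zero, not_false_eq_true, zero_pow, add_zero, neg_zero,
      Complex.exp_zero, mul_one] at hconst
    rw [← hconst, mul_assoc, ← Complex.exp_add, neg_add_cancel, Complex.exp_zero, mul_one]
  refine ⟨‖g 0‖ * Real.exp (‖c‖ ^ 2 / δ), by positivity, fun x => ?_⟩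
  rw [hformula x, norm_mul, Complex.norm_exp, mul_assoc, ← Real.exp_add]
  gcongr
  have h1 := hneg x
  have h2 : (c x).re ≤ ‖c‖ * ‖x‖ := (Complex.re_le_norm _).trans (c.le_opNorm x)
  -- Half of the available decay `δ / 2` is spent on the linear term.
  have h3 : ‖c‖ * ‖x‖ ≤ ‖c‖ ^ 2 / δ + δ / 4 * ‖x‖ ^ 2 := by
    have h4 : ‖c‖ ^ 2 / δ + δ / 4 * ‖x‖ ^ 2 - ‖c‖ * ‖x‖ = (‖c‖ - δ / 2 * ‖x‖) ^ 2 / δ := by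
      field_simp
      ring
    have h5 : 0 ≤ (‖c‖ - δ / 2 * ‖x‖) ^ 2 / δ := by positivity
    linarith
  simp only [Complex.add_re, Complex.div_ofNat_re]
  nlinarith

end Boson

end GaussianProjection
end

/-! ### Gaussian curves obtained by multiplying with exponentials of polynomials -/

noncomputable section

namespace GaussianProjection

open Filter Topology Complex

section Boson

variable {N : ℕ}

/-! ### Curves of Gaussian states -/

theorem exists_gaussian (K : ℝ) {δ : ℝ} (hδ : 0 < δ) :
    ∃ D : BosonCore N, ∀ x, D x = ((K * Real.exp (-δ * ‖x‖ ^ 2) : ℝ) : ℂ) := by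
  let l : Conf N →L[ℝ] Conf N →L[ℝ] ℂ :=
    (ContinuousLinearMap.compL ℝ (Conf N) ℝ ℂ Complex.ofRealCLM).comp ((-2 * δ) • innerSL ℝ)
  refine exists_schwartz (l := l) (C := |K|) (δ := δ) (fun x => ?_) l.hasTemperateGrowth hδ
    fun x => ?_
  · have h1 : HasFDerivAt (fun y : Conf N => ‖y‖ ^ 2) (2 • innerSL ℝ x) x :=
      (hasStrictFDerivAt_norm_sq x).hasFDerivAt
    have h2 := Complex.ofRealCLM.hasFDerivAt.comp x ((h1.const_mul (-δ)).exp.const_mul K)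
    refine h2.congr_fderiv ?_
    ext y
    simp [l]
    ring
  · rw [Complex.norm_real, norm_mul, Real.norm_eq_abs, Real.norm_of_nonneg (Real.exp_pos _).le]

theorem norm_toLp_le {f D : BosonCore N} (h : ∀ x, ‖f x‖ ≤ ‖D x‖) :
    ‖(boson N).incl f‖ ≤ ‖(boson N).incl D‖ := by
  rw [boson_incl_eq, boson_incl_eq]
  refine Lp.norm_le_norm_of_ae_le ?_
  filter_upwards [f.coeFn_toLp 2 volume, D.coeFn_toLp 2 volume] with x h1 h2
  rw [h1, h2]
  exact h x

theorem normalize_mem_bosonGaussian {φ : BosonCore N} (h0 : (boson N).incl φ ≠ 0)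
    {L : Conf N →L[ℝ] Conf N →L[ℝ] ℂ} {c : Conf N →L[ℝ] ℂ}
    (hφ : ∀ x, HasFDerivAt φ (φ x • (L x + c)) x) (hneg : ∀ x, x ≠ 0 → (L x x).re < 0) :
    ((‖(boson N).incl φ‖⁻¹ : ℝ) : ℂ) • φ ∈ bosonGaussian N := by
  refine mem_bosonGaussian_of_hasFDerivAt (L := L) (c := c) ?_ (fun x => ?_) hneg
  · rw [map_smul, norm_smul, Complex.norm_real, norm_inv, norm_norm,
      inv_mul_cancel₀ (norm_ne_zero_iff.2 h0)]
  · have h := (hφ x).const_smul ((‖(boson N).incl φ‖⁻¹ : ℝ) : ℂ)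
    refine h.congr_fderiv ?_
    rw [smul_apply, smul_assoc]

/-- Multiplication by `exp(tP)` keeps the logarithmic derivative affine and merely shifts its
coefficients. -/
theorem hasFDerivAt_mul_cexp {g P : Conf N → ℂ} {L L' : Conf N →L[ℝ] Conf N →L[ℝ] ℂ}
    {c c' : Conf N →L[ℝ] ℂ} {x : Conf N} (hg : HasFDerivAt g (g x • (L x + c)) x)
    (hP : HasFDerivAt P (L' x + c') x) (t : ℝ) :
    HasFDerivAt (fun x => g x * Complex.exp (t * P x))
      ((g x * Complex.exp (t * P x)) • ((L + t • L') x + (c + t • c'))) x := by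
  have h := hg.mul ((hP.const_mul (t : ℂ)).cexp)
  refine h.congr_fderiv ?_
  ext y
  simp only [add_apply, smul_apply, smul_eq_mul, Complex.real_smul]
  ring

/-- The quadratic Taylor remainder of `exp` contains `‖p‖² exp(τ‖p‖)`. Bounding `‖p‖²` by a second
such exponential, `hA` ensures that both together cost at most half of the Gaussian decay. The bound
is `t²` times a fixed Gaussian. -/
theorem norm_mul_cexp_sub_le {a p : ℂ} {t τ C r δ A : ℝ} (hτ : 0 < τ) (ht : |t| ≤ τ)
    (hC : 0 ≤ C) (ha : ‖a‖ ≤ C * Real.exp (-δ * r ^ 2)) (hp : ‖p‖ ≤ A * (1 + r ^ 2))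
    (hA : 2 * τ * A ≤ δ / 2) :
    ‖a * Complex.exp (t * p) - a - t * (p * a)‖
      ≤ t ^ 2 * (2 / τ ^ 2 * (C * Real.exp (δ / 2)) * Real.exp (-(δ / 2) * r ^ 2)) := by
  have h1 := Complex.norm_exp_sub_sum_le_norm_mul_exp (t * p) 2
  simp only [Finset.sum_range_succ, Finset.sum_range_zero, pow_zero, Nat.factorial, Nat.cast_one,
    div_one, zero_add, pow_one, mul_one, norm_mul, Complex.norm_real, Real.norm_eq_abs] at h1
  have h2 : a * Complex.exp (t * p) - a - t * (p * a)
      = a * (Complex.exp (t * p) - (1 + t * p)) := by ring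
  have h3 : ‖p‖ ^ 2 ≤ 2 / τ ^ 2 * Real.exp (τ * ‖p‖) := by
    have h := Real.pow_div_factorial_le_exp (τ * ‖p‖) (by positivity) 2
    rw [div_mul_eq_mul_div, le_div_iff₀ (by positivity)]
    rw [div_le_iff₀ (by positivity)] at h
    simp only [Nat.factorial, Nat.succ_eq_add_one] at h
    push_cast at h
    nlinarith
  have h4 : Real.exp (-δ * r ^ 2) * (Real.exp (τ * ‖p‖) * Real.exp (τ * ‖p‖))
      ≤ Real.exp (δ / 2) * Real.exp (-(δ / 2) * r ^ 2) := by
    rw [← Real.exp_add, ← Real.exp_add, ← Real.exp_add]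
    refine Real.exp_le_exp.2 ?_
    have h5 : τ * ‖p‖ ≤ τ * (A * (1 + r ^ 2)) := by gcongr
    have h6 : 2 * τ * A * (1 + r ^ 2) ≤ δ / 2 * (1 + r ^ 2) := by gcongr
    linarith
  rw [h2, norm_mul]
  calc ‖a‖ * ‖Complex.exp (t * p) - (1 + t * p)‖
      ≤ (C * Real.exp (-δ * r ^ 2)) * ((|t| * ‖p‖) ^ 2 * Real.exp (τ * ‖p‖)) := by
        gcongr
        refine h1.trans ?_
        gcongr
    _ = t ^ 2 * (C * Real.exp (-δ * r ^ 2) * (‖p‖ ^ 2 * Real.exp (τ * ‖p‖))) := by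
        rw [mul_pow, sq_abs]
        ring
    _ ≤ t ^ 2 * (C * Real.exp (-δ * r ^ 2)
        * ((2 / τ ^ 2 * Real.exp (τ * ‖p‖)) * Real.exp (τ * ‖p‖))) := by gcongr
    _ = t ^ 2 * (2 / τ ^ 2 * C * (Real.exp (-δ * r ^ 2)
        * (Real.exp (τ * ‖p‖) * Real.exp (τ * ‖p‖)))) := by ring
    _ ≤ t ^ 2 * (2 / τ ^ 2 * C * (Real.exp (δ / 2) * Real.exp (-(δ / 2) * r ^ 2))) := by gcongr
    _ = _ := by ring

/-- The normalized curve of a differentiable curve has the same velocity up to a multiple of the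
state. -/
theorem hasVelocity_normalize {H : Type*} [NormedAddCommGroup H] [InnerProductSpace ℂ H]
    {u : ℝ → H} {v : H} (hu : HasVelocity u v) (h1 : ‖u 0‖ = 1) :
    ∃ r : ℂ, HasVelocity (fun t => ((‖u t‖⁻¹ : ℝ) : ℂ) • u t) (v + r • u 0) := by
  have h2 := (hasDerivAt_norm_sq hu).sqrt (by rw [h1]; norm_num)
  have h3 := h2.inv (by rw [Real.sqrt_sq (norm_nonneg _), h1]; norm_num)
  have h4 := HasDerivAt.smul h3 hu
  simp only [Pi.inv_apply, Real.sqrt_sq (norm_nonneg _), h1] at h4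
  refine ⟨((-(2 * (inner ℂ (u 0) v).re / (2 * √(1 ^ 2))) / √(1 ^ 2) ^ 2 : ℝ) : ℂ),
    hasDerivAt_of_eq h4 (fun t => Complex.coe_smul _ _) ?_⟩
  rw [inv_one, one_smul, Complex.coe_smul]

theorem hasVelocity_of_isBigO {H : Type*} [NormedAddCommGroup H] [InnerProductSpace ℂ H]
    {u : ℝ → H} {v : H}
    (h : (fun t : ℝ => u t - u 0 - (t : ℂ) • v) =O[𝓝 0] fun t => ‖t - 0‖ ^ 2) :
    HasVelocity u v := by
  have h1 := (h.hasFDerivAt one_lt_two).hasDerivAt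
  have h2 := (h1.add_const (u 0)).add ((hasDerivAt_id (0 : ℝ)).smul_const v)
  refine hasDerivAt_of_eq h2 (fun t => ?_) (by simp)
  simp only [Pi.add_apply, id, Complex.coe_smul]
  abel

/-- Multiplication of a bosonic Gaussian state by a polynomial of degree at most two gives a
tangent vector. -/
theorem phaseProj_mem_of_polynomial {ψ : BosonCore N} (hψ : ψ ∈ bosonGaussian N) {P : Conf N → ℂ}
    {L' : Conf N →L[ℝ] Conf N →L[ℝ] ℂ} {c' : Conf N →L[ℝ] ℂ}
    (hP : ∀ x, HasFDerivAt P (L' x + c') x) {A : ℝ} (hA : ∀ x, ‖P x‖ ≤ A * (1 + ‖x‖ ^ 2))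
    {w : BosonCore N} (hw : ∀ x, w x = P x * ψ x) :
    phaseProj ((boson N).incl ψ) ((boson N).incl w)
      ∈ (boson N).tangentSpace (bosonGaussian N) ψ := by
  obtain ⟨L, c, hL, δ, hδ, hneg⟩ := exists_hasFDerivAt_of_mem_bosonGaussian hψ
  obtain ⟨C, hC, hbound⟩ := exists_gaussian_bound hL hδ hneg
  have hA0 : 0 ≤ A := nonneg_of_mul_nonneg_left ((norm_nonneg _).trans (hA 0)) (by positivity)
  set δ' := δ / 4 with hδ'
  have hδ'0 : 0 < δ' := by positivity
  -- The first condition keeps the quadratic part of the exponent negative definite for `|t| ≤ τ`,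
  -- the second is the one required by `norm_mul_cexp_sub_le`.
  obtain ⟨τ, hτ, hτ1, hτ2⟩ : ∃ τ > 0, τ * ‖L'‖ ≤ δ / 2 ∧ 2 * τ * A ≤ δ' / 2 := by
    refine ⟨min (δ / 2 / (‖L'‖ + 1)) (δ' / 4 / (A + 1)), by positivity, ?_, ?_⟩
    · calc _ ≤ δ / 2 / (‖L'‖ + 1) * (‖L'‖ + 1) := by
            gcongr
            · exact min_le_left _ _
            · linarith
        _ = δ / 2 := by field_simp
    · calc _ ≤ 2 * (δ' / 4 / (A + 1)) * (A + 1) := by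
            gcongr
            · exact min_le_right _ _
            · linarith
        _ = δ' / 2 := by
            field_simp
            norm_num
  -- A curve in `tangentVectors` must be Gaussian for all times, so outside `|t| ≤ τ` it is given
  -- the constant value `ψ`.
  have hex : ∀ t : ℝ, ∃ f : BosonCore N,
      (|t| ≤ τ → ∀ x, f x = ψ x * Complex.exp (t * P x)) ∧ (¬|t| ≤ τ → f = ψ) := by
    intro t
    by_cases ht : |t| ≤ τ
    · have h := exists_schwartz (g := fun x => ψ x * Complex.exp (t * P x))
        (l := fun x => (L + t • L') x + (c + t • c')) (C := C * Real.exp (δ' / 2)) (δ := δ' / 2)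
        (fun x => hasFDerivAt_mul_cexp (hL x) (hP x) t)
        ((L + t • L').hasTemperateGrowth.add (Function.HasTemperateGrowth.const _))
        (by positivity) fun x => ?_
      · obtain ⟨f, hf⟩ := h
        exact ⟨f, fun _ => hf, fun h => absurd ht h⟩
      · rw [norm_mul, Complex.norm_exp]
        have h1 : ((t : ℂ) * P x).re ≤ δ' / 2 * (1 + ‖x‖ ^ 2) := by
          calc ((t : ℂ) * P x).re ≤ ‖(t : ℂ) * P x‖ := Complex.re_le_norm _
            _ = |t| * ‖P x‖ := by rw [norm_mul, Complex.norm_real, Real.norm_eq_abs]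
            _ ≤ τ * (A * (1 + ‖x‖ ^ 2)) := by
                gcongr
                exact hA x
            _ = τ * A * (1 + ‖x‖ ^ 2) := by ring
            _ ≤ δ' / 2 * (1 + ‖x‖ ^ 2) := by
                gcongr
                nlinarith [mul_nonneg hτ.le hA0]
        calc ‖ψ x‖ * Real.exp ((t : ℂ) * P x).re
            ≤ (C * Real.exp (-δ' * ‖x‖ ^ 2)) * Real.exp (δ' / 2 * (1 + ‖x‖ ^ 2)) := by
              gcongr
              exact hbound x
          _ = C * Real.exp (δ' / 2) * Real.exp (-(δ' / 2) * ‖x‖ ^ 2) := by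
              rw [mul_assoc, mul_assoc, ← Real.exp_add, ← Real.exp_add]
              ring_nf
    · exact ⟨ψ, fun h => absurd h ht, fun _ => rfl⟩
  choose F hF hF' using hex
  have hF0 : F 0 = ψ := by
    ext x
    rw [hF 0 (by simpa using hτ.le)]
    simp
  obtain ⟨D, hD⟩ := exists_gaussian (N := N) (2 / τ ^ 2 * (C * Real.exp (δ' / 2)))
    (half_pos hδ'0)
  have hderiv : HasVelocity (fun t => (boson N).incl (F t)) ((boson N).incl w) := by
    refine hasVelocity_of_isBigO (Asymptotics.IsBigO.of_bound ‖(boson N).incl D‖ ?_)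
    filter_upwards [Metric.closedBall_mem_nhds (0 : ℝ) hτ] with t ht
    have ht' : |t| ≤ τ := by simpa using ht
    rw [hF0, ← map_smul, ← map_sub, ← map_sub]
    calc ‖(boson N).incl (F t - ψ - (t : ℂ) • w)‖
        ≤ ‖(boson N).incl (((t ^ 2 : ℝ) : ℂ) • D)‖ := by
          refine norm_toLp_le fun x => ?_
          have h3 := norm_mul_cexp_sub_le hτ ht' hC (hbound x) (hA x) hτ2
          simp only [sub_apply, smul_apply, hF t ht', hw, hD, smul_eq_mul]
          refine h3.trans (le_of_eq ?_)
          rw [← Complex.ofReal_mul, Complex.norm_real, Real.norm_of_nonneg (by positivity)]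
      _ = ‖(boson N).incl D‖ * ‖‖t - 0‖ ^ 2‖ := by
          rw [map_smul, norm_smul, Complex.norm_real, sub_zero, norm_pow, norm_pow, norm_norm,
            mul_comm]
  have hψ0 : ψ ≠ 0 := by
    rintro rfl
    simpa using hψ.1
  obtain ⟨x₀, hx₀⟩ : ∃ x, ψ x ≠ 0 := by
    by_contra! h
    exact hψ0 (by ext x; exact h x)
  -- Normalization adds only a multiple of `ψ` to the velocity, which the phase projection removes.
  obtain ⟨r, hr⟩ := hasVelocity_normalize hderiv (by rw [hF0]; exact hψ.1)
  refine (boson N).mem_tangentSpace ⟨fun t => ((‖(boson N).incl (F t)‖⁻¹ : ℝ) : ℂ) • F t,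
    (boson N).incl w + r • (boson N).incl ψ, ?_, fun t => ?_, ?_, ?_⟩
  · show ((‖(boson N).incl (F 0)‖⁻¹ : ℝ) : ℂ) • F 0 = ψ
    rw [hF0, hψ.1]
    simp
  · by_cases ht : |t| ≤ τ
    · refine normalize_mem_bosonGaussian (L := L + t • L') (c := c + t • c') (fun h => ?_)
        (fun x => ?_) fun x hx => ?_
      · have h2 : F t = 0 := boson_incl_injective (by rw [h, map_zero])
        have h3 := hF t ht x₀
        rw [h2] at h3
        exact mul_ne_zero hx₀ (Complex.exp_ne_zero _) h3.symm
      · have h := hasFDerivAt_mul_cexp (hL x) (hP x) t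
        rw [show (F t : Conf N → ℂ) = fun x => ψ x * Complex.exp (t * P x) from
          funext (hF t ht)]
        exact h
      · have hx0 : 0 < ‖x‖ := norm_pos_iff.2 hx
        have h1 : (L' x x).re * t ≤ δ / 2 * ‖x‖ ^ 2 := by
          calc (L' x x).re * t ≤ |(L' x x).re * t| := le_abs_self _
            _ = |t| * |(L' x x).re| := by rw [abs_mul, mul_comm]
            _ ≤ τ * (‖L'‖ * ‖x‖ * ‖x‖) := by
                gcongr
                exact (Complex.abs_re_le_norm _).trans (L'.le_opNorm₂ x x)
            _ = τ * ‖L'‖ * ‖x‖ ^ 2 := by ring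
            _ ≤ δ / 2 * ‖x‖ ^ 2 := by gcongr
        have h2 := hneg x
        simp only [add_apply, smul_apply, Complex.add_re, Complex.real_smul, Complex.re_ofReal_mul]
        nlinarith [pow_pos hx0 2]
    · show ((‖(boson N).incl (F t)‖⁻¹ : ℝ) : ℂ) • F t ∈ bosonGaussian N
      rw [hF' t ht, hψ.1]
      simpa using hψ
  · refine hasDerivAt_of_eq hr (fun t => ?_) ?_
    · rw [map_smul]
    · rw [hF0]
  · rw [phaseProj_add, phaseProj_smul_self hψ.1, add_zero]

end Boson

end GaussianProjection
end

/-! ### Tangency of linear-quadratic observables and the bosonic results -/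

noncomputable section

namespace GaussianProjection

open Filter Topology Complex

section Boson

variable {N : ℕ}

/-! ### Tangent vectors generated by linear and quadratic observables -/

theorem phaseProj_mem_of_mul_affine {ψ : BosonCore N} (hψ : ψ ∈ bosonGaussian N)
    (m₁ m₂ : Conf N →L[ℝ] ℂ) (b₁ b₂ k : ℂ) {w : BosonCore N}
    (hw : ∀ x, w x = ((m₁ x + b₁) * (m₂ x + b₂) + k) * ψ x) :
    phaseProj ((boson N).incl ψ) ((boson N).incl w)
      ∈ (boson N).tangentSpace (bosonGaussian N) ψ := by
  have hd : ∀ x, HasFDerivAt (fun x => (m₁ x + b₁) * (m₂ x + b₂) + k)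
      (((m₁.smulRight m₂ : Conf N →L[ℝ] Conf N →L[ℝ] ℂ)
        + (m₂.smulRight m₁ : Conf N →L[ℝ] Conf N →L[ℝ] ℂ)) x + (b₁ • m₂ + b₂ • m₁)) x := by
    intro x
    have h := ((m₁.hasFDerivAt (x := x).add_const b₁).mul
      (m₂.hasFDerivAt (x := x).add_const b₂)).add_const k
    refine h.congr_fderiv ?_
    ext y
    simp only [add_apply, smul_apply, ContinuousLinearMap.smulRight_apply, smul_eq_mul]
    ring
  refine phaseProj_mem_of_polynomial hψ hd (A := ‖m₁‖ * ‖m₂‖ + ‖m₁‖ * ‖b₂‖ + ‖b₁‖ * ‖m₂‖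
    + ‖b₁‖ * ‖b₂‖ + ‖k‖) (fun x => ?_) hw
  have h1 : ‖m₁ x + b₁‖ ≤ ‖m₁‖ * ‖x‖ + ‖b₁‖ :=
    (norm_add_le _ _).trans (by gcongr; exact m₁.le_opNorm x)
  have h2 : ‖m₂ x + b₂‖ ≤ ‖m₂‖ * ‖x‖ + ‖b₂‖ :=
    (norm_add_le _ _).trans (by gcongr; exact m₂.le_opNorm x)
  have h3 : ‖x‖ ≤ 1 + ‖x‖ ^ 2 := by nlinarith [sq_nonneg (‖x‖ - 1), norm_nonneg x]
  have h4 : ‖x‖ ^ 2 ≤ 1 + ‖x‖ ^ 2 := by linarith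
  have h5 : 1 ≤ 1 + ‖x‖ ^ 2 := by nlinarith [sq_nonneg ‖x‖]
  calc ‖(m₁ x + b₁) * (m₂ x + b₂) + k‖
      ≤ ‖m₁ x + b₁‖ * ‖m₂ x + b₂‖ + ‖k‖ := (norm_add_le _ _).trans_eq (by rw [norm_mul])
    _ ≤ (‖m₁‖ * ‖x‖ + ‖b₁‖) * (‖m₂‖ * ‖x‖ + ‖b₂‖) + ‖k‖ := by gcongr
    _ = ‖m₁‖ * ‖m₂‖ * ‖x‖ ^ 2 + ‖m₁‖ * ‖b₂‖ * ‖x‖ + ‖b₁‖ * ‖m₂‖ * ‖x‖ + ‖b₁‖ * ‖b₂‖ * 1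
        + ‖k‖ * 1 := by ring
    _ ≤ ‖m₁‖ * ‖m₂‖ * (1 + ‖x‖ ^ 2) + ‖m₁‖ * ‖b₂‖ * (1 + ‖x‖ ^ 2)
        + ‖b₁‖ * ‖m₂‖ * (1 + ‖x‖ ^ 2) + ‖b₁‖ * ‖b₂‖ * (1 + ‖x‖ ^ 2) + ‖k‖ * (1 + ‖x‖ ^ 2) := by
        gcongr
    _ = _ := by ring

/-- On a Gaussian state, and on its products with affine functions, the quadratures act as
multiplication by affine functions up to a constant. -/
theorem exists_affine {ψ : BosonCore N} (hψ : ψ ∈ bosonGaussian N) (a : Fin N ⊕ Fin N) :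
    ∃ (m : Conf N →L[ℝ] ℂ) (b : ℂ), ∀ (m' : Conf N →L[ℝ] ℂ) (b' : ℂ), ∃ k : ℂ,
      ∀ f : BosonCore N, (∀ x, f x = (m' x + b') * ψ x) →
        ∀ x, (boson N).ξ a f x = ((m' x + b') * (m x + b) + k) * ψ x := by
  obtain ⟨L, c, hL, -⟩ := exists_hasFDerivAt_of_mem_bosonGaussian hψ
  rcases a with j | j
  · refine ⟨Complex.ofRealCLM.comp (EuclideanSpace.proj (𝕜 := ℝ) j), 0, fun m' b' => ⟨0,
      fun f hf x => ?_⟩⟩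
    show position N j f x = _
    rw [position_apply, hf]
    simp
    ring
  -- By the product rule, differentiating `ψ` gives the affine multiplier and differentiating the
  -- prefactor gives the constant `k`.
  · refine ⟨(-I) • L.flip (EuclideanSpace.single j 1), -I * c (EuclideanSpace.single j 1),
      fun m' b' => ⟨-I * m' (EuclideanSpace.single j 1), fun f hf x => ?_⟩⟩
    show momentum N j f x = _
    have h := (m'.hasFDerivAt (x := x).add_const b').mul (hL x)
    have hf' : HasFDerivAt f _ x := h.congr_of_eventuallyEq (Eventually.of_forall hf)
    rw [momentum_apply, hf'.fderiv]
    simp only [add_apply, smul_apply, smul_eq_mul, ContinuousLinearMap.flip_apply]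
    ring

theorem boson_phaseProj_smul_ξ_mem {ψ : BosonCore N} (hψ : ψ ∈ bosonGaussian N)
    (a : Fin N ⊕ Fin N) (z : ℂ) :
    phaseProj ((boson N).incl ψ) ((boson N).incl (z • (boson N).ξ a ψ))
      ∈ (boson N).tangentSpace (bosonGaussian N) ψ := by
  obtain ⟨m, b, h⟩ := exists_affine hψ a
  obtain ⟨k, hk⟩ := h 0 1
  refine phaseProj_mem_of_mul_affine hψ (z • m) 0 (z * (b + k)) 1 0 fun x => ?_
  rw [smul_apply, hk ψ (by simp)]
  simp
  ring

theorem boson_phaseProj_smul_pair_mem {ψ : BosonCore N} (hψ : ψ ∈ bosonGaussian N)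
    (a b : Fin N ⊕ Fin N) (z : ℂ) :
    phaseProj ((boson N).incl ψ) ((boson N).incl (z • (boson N).ξ a ((boson N).ξ b ψ)))
      ∈ (boson N).tangentSpace (bosonGaussian N) ψ := by
  obtain ⟨m, β, h⟩ := exists_affine hψ b
  obtain ⟨k, hk⟩ := h 0 1
  obtain ⟨m', β', h'⟩ := exists_affine hψ a
  -- The inner operator, applied to `ψ` with prefactor `1`, yields the affine factor `m + β + k`,
  -- which is the prefactor for the outer one.
  obtain ⟨k', hk'⟩ := h' m (β + k)
  refine phaseProj_mem_of_mul_affine hψ (z • m) m' (z * (β + k)) β' (z * k') fun x => ?_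
  rw [smul_apply, hk' _ fun x => by
    rw [hk ψ (by simp), zero_apply]
    ring]
  simp
  ring

theorem boson_phaseProj_linQuad_mem {ψ : BosonCore N} (hψ : ψ ∈ bosonGaussian N)
    (f : Fin N ⊕ Fin N → ℂ) (h : Fin N ⊕ Fin N → Fin N ⊕ Fin N → ℂ) :
    phaseProj ((boson N).incl ψ) ((boson N).incl ((boson N).linQuad f h ψ))
      ∈ (boson N).tangentSpace (bosonGaussian N) ψ := by
  let p : BosonCore N → Prop := fun g => phaseProj ((boson N).incl ψ) ((boson N).incl g)
    ∈ (boson N).tangentSpace (bosonGaussian N) ψ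
  have hadd : ∀ x y, p x → p y → p (x + y) := by
    intro x y hx hy
    show phaseProj _ ((boson N).incl (x + y)) ∈ _
    rw [map_add, phaseProj_add]
    exact Submodule.add_mem _ hx hy
  have h0 : p 0 := by simp [p, phaseProj]
  have h1 : (boson N).linQuad f h ψ = ∑ a, f a • (boson N).ξ a ψ
      + ∑ a, ∑ b, (1 / 2 * h a b) • (boson N).ξ a ((boson N).ξ b ψ) := by
    simp only [ModeSystem.linQuad, LinearMap.add_apply, LinearMap.sum_apply,
      LinearMap.smul_apply, LinearMap.comp_apply, Finset.smul_sum, smul_smul]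
  show p _
  rw [h1]
  exact hadd _ _
    (Finset.sum_induction _ _ hadd h0 fun a _ => boson_phaseProj_smul_ξ_mem hψ a (f a))
    (Finset.sum_induction _ _ hadd h0 fun a _ => Finset.sum_induction _ _ hadd h0 fun b _ =>
      boson_phaseProj_smul_pair_mem hψ a b _)

theorem boson_phaseProj_ξ_mem {ψ : BosonCore N} (hψ : ψ ∈ bosonGaussian N) (a : Fin N ⊕ Fin N) :
    phaseProj ((boson N).incl ψ) ((boson N).incl ((boson N).ξ a ψ))
      ∈ (boson N).tangentSpace (bosonGaussian N) ψ := by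
  simpa only [one_smul] using boson_phaseProj_smul_ξ_mem hψ a 1

theorem boson_phaseProj_anticomm_mem {ψ : BosonCore N} (hψ : ψ ∈ bosonGaussian N)
    (a b : Fin N ⊕ Fin N) :
    phaseProj ((boson N).incl ψ) ((boson N).incl ((boson N).anticomm a b ψ))
      ∈ (boson N).tangentSpace (bosonGaussian N) ψ := by
  have h : (boson N).anticomm a b ψ = (1 : ℂ) • (boson N).ξ a ((boson N).ξ b ψ)
      + (1 : ℂ) • (boson N).ξ b ((boson N).ξ a ψ) := by
    simp only [ModeSystem.anticomm, LinearMap.add_apply, LinearMap.comp_apply, one_smul]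
  rw [h, map_add, phaseProj_add]
  exact Submodule.add_mem _ (boson_phaseProj_smul_pair_mem hψ a b _)
    (boson_phaseProj_smul_pair_mem hψ b a _)

theorem boson_phaseProj_hermComm_mem {ψ : BosonCore N} (hψ : ψ ∈ bosonGaussian N)
    (a b : Fin N ⊕ Fin N) :
    phaseProj ((boson N).incl ψ) ((boson N).incl ((boson N).hermComm a b ψ))
      ∈ (boson N).tangentSpace (bosonGaussian N) ψ := by
  have h : (boson N).hermComm a b ψ = (-I) • (boson N).ξ a ((boson N).ξ b ψ)
      + I • (boson N).ξ b ((boson N).ξ a ψ) := by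
    simp only [ModeSystem.hermComm, LinearMap.smul_apply, LinearMap.sub_apply,
      LinearMap.comp_apply]
    module
  rw [h, map_add, phaseProj_add]
  exact Submodule.add_mem _ (boson_phaseProj_smul_pair_mem hψ a b _)
    (boson_phaseProj_smul_pair_mem hψ b a _)

/-! ### The bosonic statements -/

theorem boson_change_linQuad {ψ : BosonCore N} (hψ : ψ ∈ bosonGaussian N)
    (f : Fin N ⊕ Fin N → ℂ) (h : Fin N ⊕ Fin N → Fin N ⊕ Fin N → ℂ) {φ : BosonSpace N}
    (hφ : inner ℂ ((boson N).incl ψ) φ = 0) :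
    (boson N).change ((boson N).linQuad f h) ψ φ
      = (boson N).change ((boson N).linQuad f h) ψ
          ((boson N).tangentProj (bosonGaussian N) ψ φ) :=
  (boson N).change_tangentProj_of_inner_eq_zero hψ.1 (boson_phaseProj_linQuad_mem hψ f h) hφ

theorem boson_proposition {ψ : BosonCore N} (hψ : ψ ∈ bosonGaussian N)
    (f : Fin N ⊕ Fin N → ℂ) (h : Fin N ⊕ Fin N → Fin N ⊕ Fin N → ℂ)
    (hA : (boson N).IsHermitian ((boson N).linQuad f h)) {φ : BosonSpace N}
    (hφ : inner ℂ ((boson N).incl ψ) φ = 0) {v : BosonSpace N}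
    (hv : v = φ ∨ v = (boson N).tangentProj (bosonGaussian N) ψ φ) {u w : ℝ → BosonSpace N}
    (h0 : u 0 = (boson N).incl ψ) (hu : HasVelocity u v)
    (hm : ∀ t, (boson N).ClosureMaps ((boson N).linQuad f h) (u t) (w t))
    (hw : ContinuousAt w 0) :
    HasDerivAt (fun t => (inner ℂ (u t) (w t)).re / ‖u t‖ ^ 2)
      ((boson N).change ((boson N).linQuad f h) ψ φ) 0 := by
  have hc : (boson N).change ((boson N).linQuad f h) ψ v
      = (boson N).change ((boson N).linQuad f h) ψ φ := by
    rcases hv with rfl | rfl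
    · rfl
    · exact (boson_change_linQuad hψ f h hφ).symm
  have hre : (inner ℂ ((boson N).incl ψ) v).re = 0 := by
    rcases hv with rfl | rfl
    · rw [hφ, Complex.zero_re]
    · exact congrArg Complex.re ((boson N).inner_tangentSpace (ψ := ψ) hψ.1
        ((boson N).tangentProj_mem (bosonGaussian N) ψ φ))
  rw [← hc]
  exact hA.hasDerivAt_expect_div (ψ := ψ) boson_denseRange hψ.1 h0 hu hre hm hw

theorem re_inner_of_isFormalAdjoint {Ham : BosonSpace N →ₗ.[ℂ] BosonSpace N}
    (hHam : Ham.IsFormalAdjoint Ham) (x : Ham.domain) :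
    (inner ℂ (x : BosonSpace N) ((-I) • Ham x)).re = 0 := by
  have h := congrArg Complex.im (hHam x x)
  rw [← inner_conj_symm (Ham x), Complex.conj_im] at h
  rw [inner_smul_right]
  simp
  linarith

theorem boson_corollary {ψ : BosonCore N} (hψ : ψ ∈ bosonGaussian N)
    (Ham : BosonSpace N →ₗ.[ℂ] BosonSpace N) (hHam : Ham.IsFormalAdjoint Ham)
    (hdom : (boson N).incl ψ ∈ Ham.domain) (φ χ : BosonSpace N)
    (hφ : φ = (-Complex.I) • Ham ⟨(boson N).incl ψ, hdom⟩)
    (hχ : χ = (boson N).tangentProj (bosonGaussian N) ψ φ) :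
    (∀ a, (((boson N).change ((boson N).ξ a) ψ χ : ℝ) : ℂ)
        = bosonCommExpect Ham ((boson N).ξ a) ψ hdom) ∧
    (∀ a b, (((boson N).changeMetric ψ χ a b : ℝ) : ℂ)
        = bosonCommExpect Ham ((boson N).anticomm a b) ψ hdom
          - 2 * (bosonCommExpect Ham ((boson N).ξ a) ψ hdom * (boson N).displacement ψ b
            + (boson N).displacement ψ a * bosonCommExpect Ham ((boson N).ξ b) ψ hdom)) ∧
    (∀ a b, (((boson N).change ((boson N).hermComm a b) ψ χ : ℝ) : ℂ)
        = bosonCommExpect Ham ((boson N).hermComm a b) ψ hdom) ∧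
    ∀ (c : (boson N).MomentCurve) (v : BosonSpace N),
      c.vec 0 = (boson N).incl ψ → HasVelocity c.vec v →
      (v = φ ∨
        ((∀ t, c.vec t ∈ (boson N).incl '' bosonGaussian N) ∧
          phaseProj ((boson N).incl ψ) v = χ)) →
      (∀ a, HasDerivAt (fun t => displacementOf (c.vec t) (c.img t) a)
        ((boson N).change ((boson N).ξ a) ψ χ) 0) ∧
      (∀ a b, HasDerivAt (fun t => metricOf (c.vec t) (c.img t) a b)
        ((boson N).changeMetric ψ χ a b) 0) ∧
      (∀ a b, HasDerivAt (fun t => symplecticOf (c.vec t) (c.img t) a b)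
        ((boson N).change ((boson N).hermComm a b) ψ χ) 0) := by
  have hre : (inner ℂ ((boson N).incl ψ) φ).re = 0 :=
    hφ ▸ re_inner_of_isFormalAdjoint hHam ⟨(boson N).incl ψ, hdom⟩
  have hanti := ModeSystem.isHermitian_anticomm (S := boson N) boson_isHermitian
  have hherm := ModeSystem.isHermitian_hermComm (S := boson N) boson_isHermitian
  have hproj : ∀ A, (boson N).IsHermitian A → phaseProj ((boson N).incl ψ) ((boson N).incl (A ψ))
        ∈ (boson N).tangentSpace (bosonGaussian N) ψ →
      (boson N).change A ψ χ = (boson N).change A ψ φ := fun A hA hm => by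
    rw [hχ]
    exact hA.change_tangentProj hψ.1 hm hre
  have hcomm : ∀ A, (boson N).IsHermitian A → phaseProj ((boson N).incl ψ) ((boson N).incl (A ψ))
        ∈ (boson N).tangentSpace (bosonGaussian N) ψ →
      (((boson N).change A ψ χ : ℝ) : ℂ) = bosonCommExpect Ham A ψ hdom := fun A hA hm => by
    rw [hproj A hA hm, bosonCommExpect, commutator_eq_change, hφ]
    rfl
  have hξ := fun a => hcomm _ (boson_isHermitian a) (boson_phaseProj_ξ_mem hψ a)
  refine ⟨hξ, fun a b => ?_,
    fun a b => hcomm _ (hherm a b) (boson_phaseProj_hermComm_mem hψ a b),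
    fun c v h0 hu hv => ?_⟩
  · rw [← hξ a, ← hξ b, ← hcomm _ (hanti a b) (boson_phaseProj_anticomm_mem hψ a b),
      ModeSystem.changeMetric]
    push_cast
    ring
  -- For the exact velocity the changes agree with those along `χ` by tangency; for a projected
  -- curve they agree because `v` and `χ` differ by an imaginary multiple of `ψ`.
  · obtain ⟨hre', hcase⟩ : (inner ℂ ((boson N).incl ψ) v).re = 0 ∧
        ∀ A, (boson N).IsHermitian A → phaseProj ((boson N).incl ψ) ((boson N).incl (A ψ))
          ∈ (boson N).tangentSpace (bosonGaussian N) ψ →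
        (boson N).change A ψ v = (boson N).change A ψ χ := by
      rcases hv with rfl | ⟨hG, hv⟩
      · exact ⟨hre, fun A hA hm => (hproj A hA hm).symm⟩
      · have hre' : (inner ℂ ((boson N).incl ψ) v).re = 0 := by
          have h := re_inner_eq_zero_of_norm_eq_one hu fun t => by
            obtain ⟨g, hg, hgt⟩ := hG t
            rw [← hgt]
            exact hg.1
          rwa [h0] at h
        refine ⟨hre', fun A hA _ => ?_⟩
        rw [← hv]
        exact (hA.change_phaseProj (ψ := ψ) hψ.1 hre').symm
    have hξ' := fun a => hcase _ (boson_isHermitian a) (boson_phaseProj_ξ_mem hψ a)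
    obtain ⟨h1, h2, h3⟩ := ModeSystem.hasDerivAt_moments boson_isHermitian boson_denseRange hψ.1
      h0 hu hre' c.maps c.maps2 c.continuousAt_img c.continuousAt_img2
    refine ⟨fun a => hξ' a ▸ h1 a, fun a b => ?_, fun a b => ?_⟩
    · have h := h2 a b
      rwa [ModeSystem.changeMetric, hξ', hξ',
        hcase _ (hanti a b) (boson_phaseProj_anticomm_mem hψ a b)] at h
    · have h := h3 a b
      rwa [hcase _ (hherm a b) (boson_phaseProj_hermComm_mem hψ a b)] at h

end Boson
end GaussianProjection
end

theorem mainTheorem12 (N : ℕ) :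
    -- bosons
    (∀ ψ ∈ bosonGaussian N,
      -- first-order changes of linear-quadratic observables
      (∀ (f : Fin N ⊕ Fin N → ℂ) (h : Fin N ⊕ Fin N → Fin N ⊕ Fin N → ℂ),
        (boson N).IsHermitian ((boson N).linQuad f h) →
        ∀ φ : BosonSpace N, inner ℂ ((boson N).incl ψ) φ = 0 →
          (boson N).change ((boson N).linQuad f h) ψ φ
              = (boson N).change ((boson N).linQuad f h) ψ
                  ((boson N).tangentProj (bosonGaussian N) ψ φ) ∧
          ∀ v : BosonSpace N, (v = φ ∨ v = (boson N).tangentProj (bosonGaussian N) ψ φ) →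
            ∀ u w : ℝ → BosonSpace N, u 0 = (boson N).incl ψ → HasVelocity u v →
              (∀ t, (boson N).ClosureMaps ((boson N).linQuad f h) (u t) (w t)) →
              ContinuousAt w 0 →
              HasDerivAt (fun t => (inner ℂ (u t) (w t)).re / ‖u t‖ ^ 2)
                ((boson N).change ((boson N).linQuad f h) ψ φ) 0) ∧
      -- exact and projected dynamics
      (∀ (Ham : BosonSpace N →ₗ.[ℂ] BosonSpace N), Ham.IsFormalAdjoint Ham →
        ∀ (hψ : (boson N).incl ψ ∈ Ham.domain) (φ χ : BosonSpace N),
          φ = (-Complex.I) • Ham ⟨(boson N).incl ψ, hψ⟩ →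
          χ = (boson N).tangentProj (bosonGaussian N) ψ φ →
          (∀ a, (((boson N).change ((boson N).ξ a) ψ χ : ℝ) : ℂ)
              = bosonCommExpect Ham ((boson N).ξ a) ψ hψ) ∧
          (∀ a b, (((boson N).changeMetric ψ χ a b : ℝ) : ℂ)
              = bosonCommExpect Ham ((boson N).anticomm a b) ψ hψ
                - 2 * (bosonCommExpect Ham ((boson N).ξ a) ψ hψ * (boson N).displacement ψ b
                  + (boson N).displacement ψ a * bosonCommExpect Ham ((boson N).ξ b) ψ hψ)) ∧
          (∀ a b, (((boson N).change ((boson N).hermComm a b) ψ χ : ℝ) : ℂ)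
              = bosonCommExpect Ham ((boson N).hermComm a b) ψ hψ) ∧
          ∀ (c : (boson N).MomentCurve) (v : BosonSpace N),
            c.vec 0 = (boson N).incl ψ → HasVelocity c.vec v →
            (v = φ ∨
              ((∀ t, c.vec t ∈ (boson N).incl '' bosonGaussian N) ∧
                phaseProj ((boson N).incl ψ) v = χ)) →
            (∀ a, HasDerivAt (fun t => displacementOf (c.vec t) (c.img t) a)
              ((boson N).change ((boson N).ξ a) ψ χ) 0) ∧
            (∀ a b, HasDerivAt (fun t => metricOf (c.vec t) (c.img t) a b)
              ((boson N).changeMetric ψ χ a b) 0) ∧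
            (∀ a b, HasDerivAt (fun t => symplecticOf (c.vec t) (c.img t) a b)
              ((boson N).change ((boson N).hermComm a b) ψ χ) 0))) ∧
    -- fermions
    (∀ ψ ∈ fermionGaussian N,
      -- first-order changes of linear-quadratic observables
      (∀ (f : Fin N ⊕ Fin N → ℂ) (h : Fin N ⊕ Fin N → Fin N ⊕ Fin N → ℂ),
        (fermion N).IsHermitian ((fermion N).linQuad f h) →
        ∀ φ : Fock N, inner ℂ ψ φ = 0 → (f = 0 ∨ SameParity ψ φ) →
          (fermion N).change ((fermion N).linQuad f h) ψ φ
              = (fermion N).change ((fermion N).linQuad f h) ψ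
                  ((fermion N).tangentProj (fermionGaussian N) ψ φ) ∧
          ∀ v : Fock N, (v = φ ∨ v = (fermion N).tangentProj (fermionGaussian N) ψ φ) →
            ∀ u : ℝ → Fock N, u 0 = ψ → HasVelocity u v →
              HasDerivAt
                (fun t => (inner ℂ (u t) ((fermion N).linQuad f h (u t))).re / ‖u t‖ ^ 2)
                ((fermion N).change ((fermion N).linQuad f h) ψ φ) 0) ∧
      -- exact and projected dynamics
      (∀ (Ham : Fock N →ₗ[ℂ] Fock N), Ham.IsSymmetric →
        ∀ φ χ : Fock N, φ = (-Complex.I) • Ham ψ →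
          χ = (fermion N).tangentProj (fermionGaussian N) ψ φ →
          -- displacement
          ((∀ x, parity N (Ham x) = Ham (parity N x)) → ∀ a,
            (((fermion N).change ((fermion N).ξ a) ψ χ : ℝ) : ℂ)
                = fermionCommExpect Ham ((fermion N).ξ a) ψ ∧
            ∀ (u : ℝ → Fock N) (v : Fock N), u 0 = ψ → HasVelocity u v →
              (v = φ ∨ ((∀ t, u t ∈ fermionGaussian N) ∧ phaseProj ψ v = χ)) →
              HasDerivAt (fun t => (fermion N).displacement (u t) a)
                ((fermion N).change ((fermion N).ξ a) ψ χ) 0) ∧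
          -- second moments
          (∀ a b, (((fermion N).changeMetric ψ χ a b : ℝ) : ℂ)
              = fermionCommExpect Ham ((fermion N).anticomm a b) ψ
                - 2 * (fermionCommExpect Ham ((fermion N).ξ a) ψ
                    * (fermion N).displacement ψ b
                  + (fermion N).displacement ψ a
                    * fermionCommExpect Ham ((fermion N).ξ b) ψ)) ∧
          (∀ a b, (((fermion N).change ((fermion N).hermComm a b) ψ χ : ℝ) : ℂ)
              = fermionCommExpect Ham ((fermion N).hermComm a b) ψ) ∧
          ∀ (u : ℝ → Fock N) (v : Fock N), u 0 = ψ → HasVelocity u v →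
            (v = φ ∨ ((∀ t, u t ∈ fermionGaussian N) ∧ phaseProj ψ v = χ)) →
            (∀ a b, HasDerivAt (fun t => (fermion N).metric (u t) a b)
              ((fermion N).changeMetric ψ χ a b) 0) ∧
            (∀ a b, HasDerivAt (fun t => (fermion N).symplectic (u t) a b)
              ((fermion N).change ((fermion N).hermComm a b) ψ χ) 0))) := by
  refine ⟨fun ψ hψ => ⟨fun f h hA φ hφ => ⟨boson_change_linQuad hψ f h hφ,
    fun v hv u w h0 hu hm hw => boson_proposition hψ f h hA hφ hv h0 hu hm hw⟩,
    fun Ham hHam hdom φ χ hφ hχ => boson_corollary hψ Ham hHam hdom φ χ hφ hχ⟩,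
    fun ψ hψ => ⟨fun f h hA φ hφ hf => ⟨fermion_change_linQuad hψ f h hφ hf,
    fun v hv u h0 hu => fermion_proposition hψ f h hA hφ hf hv h0 hu⟩,
    fun Ham hHam φ χ hφ hχ => fermion_corollary hψ Ham hHam φ χ hφ hχ⟩⟩
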